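/- **Setting.** Let $\alpha\in(0,2)\setminus\{1\}$, $\rho\in[1-1/\alpha,1/\alpha]\cap(0,1)$, $T>0$, $\kappa\in(0,1)$. On a probability space let $E_i,\eta_+,\eta_-$ be exponential with mean $1$, $U_i$ uniform on $(0,1)$ and $V_i$ uniform on $(-\frac\pi2,\frac\pi2)$ ($i\ge1$), all independent. Put $\omega=\pi(\rho-\frac12)$, $$\ell_i=T(1-U_i)\prod_{j=1}^{i-1}U_j,\qquad g(v)=\frac{\sin(\alpha(v+\omega))}{\cos^{1/\alpha}(v)\cos^{1-1/\alpha}((1-\alpha)v-\alpha\omega)},\qquad G_i=g(V_i),\qquad S_i=E_i^{1-1/\alpha}G_i,$$ and, with $[x]^+=\max\{x,0\}$, $[x]^-=\max\{-x,0\}$, $$X_\pm=\sum_{i=1}^\infty \ell_i^{1/\alpha}[S_i]^\pm,\qquad X_{\pm,n}=\sum_{i=1}^n\ell_i^{1/\alpha}[S_i]^\pm+T^{1/\alpha}\kappa^n\eta_\pm^{1-1/\alpha}\quad(n\ge1),$$ $\chi=(X_+,X_-)$, $\chi_n=(X_{+,n},X_{-,n})$. *Smooth random variables.* $\Phi\in\mathbb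 S_m(\Omega)$ means that almost surely $\Phi=\phi(E_1,\dots,E_m,U_1,\dots,U_m,V_1,\dots,V_m,\eta_+,\eta_-,\vartheta)$, where $\vartheta$ is a random element of a metric space $S$, independent of the other arguments, and $\phi:D_m\times S\to\mathbb R$, with $D_m=(0,\infty)^m\times(0,1)^m\times(-\frac\pi2,\frac\pi2)^m\times(0,\infty)^2$, is continuous, $\phi(\cdot,s)\in C^\infty(D_m)$ for every $s\in S$, and for every $j\ge0$ there is a measurable $C_j:S\to\mathbb R$ with $\sup_{D_m}\|D^j\phi(\cdot,s)\|\le C_j(s)$ for all $s\in S$ and $\mathbb E[C_j(\vartheta)]<\infty$ (for instance, $\phi$ and all its derivatives in the first variables are bounded). *Weights.* For $m\ge n\ge1$ and $\Phi$ a function of the above variables let $$\mathcal D_m^\pm=\eta_\pm\partial_{\eta_\pm}+\sum_{i=1}^mE_i\mathbf 1_{\{[G_i]^\pm>0\}}\partial_{E_i},$$ $$H_{n,m}^\pm(\Phi)=\frac1{X_{\pm,n}}\frac{\alpha}{\alpha-1}\Big(\Big(\eta_\pm-\frac1\alpha+\sum_{i=1}^m(E_i-1)\mathbf 1_{\{[G_i]^\pm>0\}}\Big)\Phi-\mathcal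 D_m^\pm[\Phi]\Big),$$ where the partial derivatives are those of a representing function with $\vartheta$ fixed, and let $H^{\pm,k}_{n,m}$ be the $k$-th iterate of $H^\pm_{n,m}$. **Theorem.** Let $\Phi\in\mathbb S_m(\Omega)$ for all $m\ge1$, with an arbitrary choice, for each $m$, of a representation of level $m$, which is used in all weights with second index $m$. Let $n\ge1$, $k_+,k_-\ge0$, $\varepsilon>0$, and let $f:\mathbb R^2\to\mathbb R$ be of class $C^{k_++k_-}$, bounded together with its derivatives of order at most $k_++k_-$, and zero outside $[\varepsilon,\infty)^2$. Write $\Theta_{i,m}=f(\chi_i)H_{i,m}^{+,k_+}\big(H_{i,m}^{-,k_-}(\Phi)\big)$. Then: 1. The series for $X_+$ and $X_-$ converge almost surely, and $\partial_+^{k_+}\partial_-^{k_-}f(\chi)\Phi$ and all $\Theta_{i,m}$ ($m\ge i\ge1$) are integrable. 2. $\displaystyle \mathbb E\big[\partial_+^{k_+}\partial_-^{k_-}f(\chi)\Phi\big]=\mathbb E[\Theta_{n,n}]+\sum_{i=n}^\infty\mathbb E\big[\Theta_{i+1,i+1}-\Theta_{i,i+1}\big],$ the series being convergent. 3. If, for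 every $j$, the $C_j=C_{j,m}$ of the chosen representations can be taken with $\sup_{m\ge1}\mathbb E[C_{j,m}(\vartheta_m)]<\infty$, or if $\sum_{i\ge n}\mathbb E|\Theta_{i+1,i+1}-\Theta_{i,i+1}|<\infty$, then the series $$\langle f,\Phi\rangle_n^{k_+,k_-}=\Theta_{n,n}+\sum_{i=n}^\infty\big(\Theta_{i+1,i+1}-\Theta_{i,i+1}\big)$$ converges almost surely, its sum is integrable, and $\mathbb E\big[\partial_+^{k_+}\partial_-^{k_-}f(\chi)\Phi\big]=\mathbb E\big[\langle f,\Phi\rangle_n^{k_+,k_-}\big]$. -/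

import Mathlib

open MeasureTheory ProbabilityTheory Filter Set
open scoped Topology

noncomputable section

namespace StableIBP

/-- The two signs `+` and `-`. -/
inductive PM where
  | plus : PM
  | minus : PM

/-- Labels of the independent driving variables. The sequences are indexed from `0`, so that
`E i`, `U i`, `V i` stand for the variables usually written `E_{i+1}`, `U_{i+1}`, `V_{i+1}`. -/
inductive NoiseIdx where
  | E (i : ℕ) : NoiseIdx
  | U (i : ℕ) : NoiseIdx
  | V (i : ℕ) : NoiseIdx
  | eta (σ : PM) : NoiseIdx

/-- A realisation of all driving variables. -/
abbrev Noise := NoiseIdx → ℝ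

/-- The driving variables are independent, with `E i` and `eta σ` exponential of mean one,
`U i` uniform on `(0,1)` and `V i` uniform on `(-π/2, π/2)`. -/
structure IsDrivingNoise {Ω : Type*} [MeasurableSpace Ω] (P : Measure Ω) (N : Ω → Noise) :
    Prop where
  measurable : ∀ k, Measurable (fun ω => N ω k)
  law_E : ∀ i, P.map (fun ω => N ω (.E i)) = expMeasure 1
  law_U : ∀ i, pdf.IsUniform (fun ω => N ω (.U i)) (Ioo (0 : ℝ) 1) P volume
  law_V : ∀ i,
    pdf.IsUniform (fun ω => N ω (.V i)) (Ioo (-(Real.pi / 2)) (Real.pi / 2)) P volume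
  law_eta : ∀ σ, P.map (fun ω => N ω (.eta σ)) = expMeasure 1
  indep : iIndepFun (fun k ω => N ω k) P

/-- Positive part `[y]^+ = max y 0` and negative part `[y]^- = max (-y) 0`. -/
def part : PM → ℝ → ℝ
  | .plus, y => max y 0
  | .minus, y => max (-y) 0

/-- The stick lengths `ℓ_{i+1} = T (1 - U_{i+1}) U_1 ⋯ U_i`. -/
def stick (T : ℝ) (x : Noise) (i : ℕ) : ℝ :=
  T * (1 - x (.U i)) * ∏ j ∈ Finset.range i, x (.U j)

/-- The Chambers-Mallows-Stuck function `g`, with `ω = π (ρ - 1/2)`. -/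
def cms (α ρ v : ℝ) : ℝ :=
  Real.sin (α * (v + Real.pi * (ρ - 1 / 2))) /
    (Real.cos v ^ (1 / α) *
      Real.cos ((1 - α) * v - α * (Real.pi * (ρ - 1 / 2))) ^ (1 - 1 / α))

/-- `G_{i+1} = g(V_{i+1})`. -/
def angular (α ρ : ℝ) (x : Noise) (i : ℕ) : ℝ := cms α ρ (x (.V i))

/-- The stable variable `S_{i+1} = E_{i+1}^{1-1/α} G_{i+1}`. -/
def stable (α ρ : ℝ) (x : Noise) (i : ℕ) : ℝ := x (.E i) ^ (1 - 1 / α) * angular α ρ x i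

/-- The terms `ℓ_{i+1}^{1/α} [S_{i+1}]^±` of the series for `X_±`. -/
def jumpTerm (α ρ T : ℝ) (σ : PM) (x : Noise) (i : ℕ) : ℝ :=
  stick T x i ^ (1 / α) * part σ (stable α ρ x i)

/-- `X_±`. -/
def limX (α ρ T : ℝ) (σ : PM) (x : Noise) : ℝ := ∑' i, jumpTerm α ρ T σ x i

/-- The approximation `X_{±,n}`, for `n ≥ 1`, with `a_n = T^{1/α} κ^n`. -/
def approxX (α ρ T κ : ℝ) (n : ℕ) (σ : PM) (x : Noise) : ℝ :=
  ∑ i ∈ Finset.range n, jumpTerm α ρ T σ x i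
    + T ^ (1 / α) * κ ^ n * x (.eta σ) ^ (1 - 1 / α)

/-- `χ = (X_+, X_-)`. -/
def limChi (α ρ T : ℝ) (x : Noise) : ℝ × ℝ := (limX α ρ T .plus x, limX α ρ T .minus x)

/-- `χ_n = (X_{+,n}, X_{-,n})`. -/
def approxChi (α ρ T κ : ℝ) (n : ℕ) (x : Noise) : ℝ × ℝ :=
  (approxX α ρ T κ n .plus x, approxX α ρ T κ n .minus x)

/-- The indicator of `[G_{i+1}]^± > 0`. -/
def sgnInd (α ρ : ℝ) (σ : PM) (x : Noise) (i : ℕ) : ℝ :=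
  open Classical in if 0 < part σ (angular α ρ x i) then 1 else 0

/-- Partial derivative with respect to one driving variable, the others being frozen. -/
def pderiv (k : NoiseIdx) (ψ : Noise → ℝ) (x : Noise) : ℝ :=
  open Classical in deriv (fun t => ψ (Function.update x k t)) (x k)

/-- The operator `𝓓^±_m = η_± ∂_{η_±} + ∑_{i=1}^m E_i 1_{[G_i]^± > 0} ∂_{E_i}`. -/
def opD (α ρ : ℝ) (m : ℕ) (σ : PM) (ψ : Noise → ℝ) (x : Noise) : ℝ :=
  x (.eta σ) * pderiv (.eta σ) ψ x
    + ∑ i ∈ Finset.range m, x (.E i) * sgnInd α ρ σ x i * pderiv (.E i) ψ x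

/-- The integration-by-parts weight `H^±_{n,m}`, as an operator on functions of the noise. -/
def opH (α ρ T κ : ℝ) (n m : ℕ) (σ : PM) (ψ : Noise → ℝ) (x : Noise) : ℝ :=
  1 / approxX α ρ T κ n σ x * (α / (α - 1)) *
    ((x (.eta σ) - 1 / α + ∑ i ∈ Finset.range m, (x (.E i) - 1) * sgnInd α ρ σ x i) * ψ x
      - opD α ρ m σ ψ x)

/-- Values of `(E_1,…,E_m), (U_1,…,U_m), (V_1,…,V_m), η_+, η_-`. -/
abbrev Coord (m : ℕ) := (Fin m → ℝ) × (Fin m → ℝ) × (Fin m → ℝ) × ℝ × ℝ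

/-- The coordinates of level `m` of a realisation of the noise. -/
def trunc (m : ℕ) (x : Noise) : Coord m :=
  (fun i => x (.E i), fun i => x (.U i), fun i => x (.V i), x (.eta .plus), x (.eta .minus))

/-- The open set in which the coordinates of level `m` take their values. -/
def coordDomain (m : ℕ) : Set (Coord m) :=
  {c | (∀ i, 0 < c.1 i) ∧ (∀ i, c.2.1 i ∈ Ioo (0 : ℝ) 1) ∧
    (∀ i, c.2.2.1 i ∈ Ioo (-(Real.pi / 2)) (Real.pi / 2)) ∧ 0 < c.2.2.2.1 ∧ 0 < c.2.2.2.2}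

/-- The `j`-th derivative of `φ(·, s)` is bounded on the domain by some `C s`, with `C`
measurable and `E[C(ϑ)] ≤ K`. -/
def DerivBoundedInMean {Ω S : Type*} [MeasurableSpace Ω] [MeasurableSpace S]
    (P : Measure Ω) (m : ℕ) (φ : Coord m → S → ℝ) (ϑ : Ω → S) (j : ℕ) (K : ℝ) : Prop :=
  ∃ C : S → ℝ, Measurable C ∧
    (∀ c ∈ coordDomain m, ∀ s, ‖iteratedFDeriv ℝ j (fun c' => φ c' s) c‖ ≤ C s) ∧
    Integrable (fun ω => C (ϑ ω)) P ∧ ∫ ω, C (ϑ ω) ∂P ≤ K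

/-- `Φ` is a smooth random variable of level `m`, represented as
`Φ = φ(E_1,…,E_m, U_1,…,U_m, V_1,…,V_m, η_+, η_-, ϑ)` with `ϑ` independent of the other
arguments and `φ` continuous, and infinitely differentiable with bounded derivatives in all
arguments but the last. -/
structure IsSmoothRep {Ω S : Type*} [MeasurableSpace Ω] (P : Measure Ω) (N : Ω → Noise)
    [MetricSpace S] [MeasurableSpace S] (m : ℕ) (φ : Coord m → S → ℝ) (ϑ : Ω → S)
    (Φ : Ω → ℝ) : Prop where
  measurable : Measurable ϑ
  indep : IndepFun (fun ω => trunc m (N ω)) ϑ P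
  continuousOn : ContinuousOn (fun p : Coord m × S => φ p.1 p.2) (coordDomain m ×ˢ univ)
  contDiffOn : ∀ s, ContDiffOn ℝ (⊤ : ℕ∞) (fun c => φ c s) (coordDomain m)
  bounded : ∀ j, ∃ K, DerivBoundedInMean P m φ ϑ j K
  eq_rep : Φ =ᵐ[P] fun ω => φ (trunc m (N ω)) (ϑ ω)

/-- Functions on the plane that are `k` times continuously differentiable, bounded with all
derivatives of order at most `k`, and vanish outside `[ε,∞)²`. -/
structure IsTestFunction (k : ℕ) (ε : ℝ) (f : ℝ × ℝ → ℝ) : Prop where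
  contDiff : ContDiff ℝ k f
  bounded : ∀ j ≤ k, ∃ C, ∀ p, ‖iteratedFDeriv ℝ j f p‖ ≤ C
  support_subset : Function.support f ⊆ Ici ε ×ˢ Ici ε

/-- The mixed partial derivative `∂_+^{kp} ∂_-^{km} f`. -/
def mixedDeriv (kp km : ℕ) (f : ℝ × ℝ → ℝ) (p : ℝ × ℝ) : ℝ :=
  iteratedDeriv kp (fun a => iteratedDeriv km (fun b => f (a, b)) p.2) p.1

/-- `Θ_{n,m} = f(χ_n) H_{n,m}^{+,kp}(H_{n,m}^{-,km}(Φ))` for `Φ = φ(trunc m ·, ϑ)`. -/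
def Theta {Ω S : Type*} (α ρ T κ : ℝ) (N : Ω → Noise) (f : ℝ × ℝ → ℝ) (kp km n m : ℕ)
    (φ : Coord m → S → ℝ) (ϑ : Ω → S) (ω : Ω) : ℝ :=
  f (approxChi α ρ T κ n (N ω)) *
    (opH α ρ T κ n m .plus)^[kp]
      ((opH α ρ T κ n m .minus)^[km] (fun x => φ (trunc m x) (ϑ ω))) (N ω)

/-- The level difference `Θ_{i+1,i+1} - Θ_{i,i+1}`. -/
def levelDiff {Ω : Type*} {S : ℕ → Type*} (α ρ T κ : ℝ) (N : Ω → Noise) (f : ℝ × ℝ → ℝ)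
    (kp km : ℕ) (φ : ∀ m, Coord m → S m → ℝ) (ϑ : ∀ m, Ω → S m) (i : ℕ) (ω : Ω) : ℝ :=
  Theta α ρ T κ N f kp km (i + 1) (i + 1) (φ (i + 1)) (ϑ (i + 1)) ω
    - Theta α ρ T κ N f kp km i (i + 1) (φ (i + 1)) (ϑ (i + 1)) ω

end StableIBP

end

open StableIBP

/-! The engine is an Euler identity. Each exponential variable of level `m` enters `approxX` through
at most one term, homogeneous of degree `1 - 1/α` in it, and that term belongs to `X_+` or to `X_-`
but never to both, because the sign of `G_i` decides. So `𝓓^σ` multiplies `X_{σ,n}` by `1 - 1/α` and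
annihilates the other component, which gives `𝓓^σ[g(χ_n)] = (1 - 1/α) X_{σ,n} ∂_σ g(χ_n)`
(`opD_comp_mul`). For the exponential law, `E[t F'(t)] = E[(t - 1) F(t)]`
(`integral_mul_deriv_expMeasure`). Used in every exponential coordinate, with `g / X_σ` in place of
`g`, it moves `∂_σ` off `g` and produces exactly `H^σ` (`integral_opD_eq_zero`, `integral_pd_eq`).

To iterate, the singular powers of `X_±` are kept apart from the rest: `H^σ` sends `X_σ^(-j) W` to
`X_σ^(-j-1) coreH_j W` (`opH_invMonom_mul`). The regular part `fullCore` involves `m` but not `n`,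
and is bounded by a constant independent of `m`, times a power of `noiseGauge`, times `C(ϑ)`. The
singular part is harmless because `f` vanishes unless both coordinates are at least `ε`. Hence
`Θ_{n,m} = (f · monomial)(χ_n) · fullCore` (`Theta_eq`) is integrable, and its mean is that of the
mixed derivative of `f` at `χ_n`, times `Φ` (`integral_Theta`). This mean does not depend on `m` or
on the representation, so the series of expectations telescopes. Dominated convergence and `χ_n → χ`
identify its limit, with no uniformity in `m`.

For the almost sure series, `Θ_{i+1,i+1}` and `Θ_{i,i+1}` share the same `fullCore`, and `f ·
monomial` is bounded and Lipschitz, so their difference is controlled by `min 1 ‖χ_{i+1} - χ_i‖`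
times a power of the gauge times `C(ϑ)`. Stick breaking makes small moments of the increments decay
geometrically (`exists_jumpTerm_moment`), while gauge moments grow only polynomially in the level.
Under a uniform bound on the mean of `C`, the differences are therefore summable in mean
(`summable_increment_gauge`, `integral_abs_Theta_sub_le`). In order zero `f` need not be Lipschitz,
but then the series telescopes pathwise. -/

noncomputable section

namespace StableIBP

/-! ### The exponential law in one variable. -/

section OneDim

lemma expMeasure_one_eq :
    expMeasure 1 = (volume.restrict (Ioi (0 : ℝ))).withDensity
      (fun t => ENNReal.ofReal (Real.exp (-t))) := by
  have h : expMeasure 1 = volume.withDensity (exponentialPDF 1) := rfl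
  rw [h, ← withDensity_indicator measurableSet_Ioi]
  refine withDensity_congr_ae ?_
  have h0 : ∀ᵐ t : ℝ, t ≠ 0 := by simp [ae_iff, measure_singleton]
  filter_upwards [h0] with t ht
  rcases lt_or_gt_of_ne ht with h | h
  · rw [exponentialPDF_of_neg h, indicator_of_notMem (by simpa using h.le)]
  · rw [exponentialPDF_of_nonneg h.le, indicator_of_mem (by simpa using h)]; simp

instance instIsProbabilityMeasureExp : IsProbabilityMeasure (expMeasure 1) :=
  isProbabilityMeasure_expMeasure one_pos

lemma ae_expMeasure_pos : ∀ᵐ t ∂(expMeasure 1), 0 < t := by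
  rw [expMeasure_one_eq]
  exact (withDensity_absolutelyContinuous _ _).ae_le (ae_restrict_mem measurableSet_Ioi)

lemma integrable_expMeasure_iff {g : ℝ → ℝ} :
    Integrable g (expMeasure 1) ↔ IntegrableOn (fun t => Real.exp (-t) * g t) (Ioi 0) := by
  rw [expMeasure_one_eq, integrable_withDensity_iff_integrable_smul' (by fun_prop) (by simp)]
  simp only [ENNReal.toReal_ofReal (Real.exp_pos _).le, smul_eq_mul, IntegrableOn]

lemma integral_expMeasure (g : ℝ → ℝ) :
    ∫ t, g t ∂(expMeasure 1) = ∫ t in Ioi 0, Real.exp (-t) * g t := by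
  rw [expMeasure_one_eq, integral_withDensity_eq_integral_toReal_smul (by fun_prop) (by simp)]
  simp only [ENNReal.toReal_ofReal (Real.exp_pos _).le, smul_eq_mul]

/-- Polynomial growth costs only half of the exponential weight, so a factor `exp (-t/2)` survives
for integrability and for the limit at infinity. The shift `c` will stand for the frozen
coordinates. -/
lemma add_pow_le_exp_half (c : ℝ) (r : ℕ) {t : ℝ} (h : 0 ≤ c + t) :
    (c + t) ^ r ≤ r.factorial * 2 ^ r * Real.exp (c / 2) * Real.exp (t / 2) := by
  have h1 := Real.pow_div_factorial_le_exp (x := (c + t) / 2) (by positivity) r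
  rw [div_le_iff₀ (by positivity), div_pow, div_le_iff₀ (by positivity), add_div, Real.exp_add] at h1
  linarith

lemma integrable_add_pow_expMeasure (c : ℝ) (hc : 0 ≤ c) (r : ℕ) :
    Integrable (fun t => (c + t) ^ r) (expMeasure 1) := by
  rw [integrable_expMeasure_iff]
  have h := (exp_neg_integrableOn_Ioi 0 (b := 1 / 2) (by norm_num)).const_mul
    (r.factorial * 2 ^ r * Real.exp (c / 2))
  refine Integrable.mono' h (by fun_prop) ?_
  filter_upwards [ae_restrict_mem measurableSet_Ioi] with t ht
  have ht : 0 < t := ht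
  rw [Real.norm_of_nonneg (by positivity)]
  have := add_pow_le_exp_half c r (t := t) (by positivity)
  have e : Real.exp (-(1/2) * t) = Real.exp (-t) * Real.exp (t / 2) := by
    rw [← Real.exp_add]; ring_nf
  rw [e]
  have := mul_le_mul_of_nonneg_left this (Real.exp_pos (-t)).le
  linarith

lemma integrable_expMeasure_of_le_pow {g : ℝ → ℝ} {K c : ℝ} (hc : 0 ≤ c) {r : ℕ}
    (hg : AEStronglyMeasurable g (expMeasure 1)) (h : ∀ t, 0 < t → |g t| ≤ K * (c + t) ^ r) :
    Integrable g (expMeasure 1) :=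
  ((integrable_add_pow_expMeasure c hc r).const_mul K).mono' hg
    (ae_expMeasure_pos.mono fun t ht => h t ht)

lemma aestronglyMeasurable_expMeasure_of_continuousOn {g : ℝ → ℝ} (hg : ContinuousOn g (Ioi 0)) :
    AEStronglyMeasurable g (expMeasure 1) := by
  rw [expMeasure_one_eq]
  exact (hg.aestronglyMeasurable measurableSet_Ioi).mono_ac (withDensity_absolutelyContinuous _ _)

/-- Integration by parts for the exponential law. -/
lemma integral_mul_deriv_expMeasure {F : ℝ → ℝ} {K c : ℝ} (hc : 0 ≤ c) {r : ℕ}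
    (hF : ∀ t, 0 < t → DifferentiableAt ℝ F t)
    (hb : ∀ t, 0 < t → |F t| ≤ K * (c + t) ^ r)
    (hb' : ∀ t, 0 < t → |t * deriv F t| ≤ K * (c + t) ^ r) :
    ∫ t, t * deriv F t ∂(expMeasure 1) = ∫ t, (t - 1) * F t ∂(expMeasure 1) := by
  have hK : 0 ≤ K := by
    have := (abs_nonneg _).trans (hb 1 one_pos)
    exact nonneg_of_mul_nonneg_left this (by positivity)
  have hFc : ContinuousOn F (Ioi 0) := fun t ht => (hF t ht).continuousAt.continuousWithinAt
  have i1 : Integrable (fun t => t * deriv F t) (expMeasure 1) :=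
    integrable_expMeasure_of_le_pow hc
      ((measurable_id.mul (measurable_deriv F)).aestronglyMeasurable) hb'
  have hb2 : ∀ t, 0 < t → |(t - 1) * F t| ≤ K * (c + 1 + t) ^ (r + 1) := by
    intro t ht
    rw [abs_mul]
    have h1 : |t - 1| ≤ c + 1 + t := abs_le.2 ⟨by linarith, by linarith⟩
    have h2 : |F t| ≤ K * (c + 1 + t) ^ r := (hb t ht).trans
      (mul_le_mul_of_nonneg_left (pow_le_pow_left₀ (by positivity) (by linarith) _) hK)
    calc _ ≤ (c + 1 + t) * (K * (c + 1 + t) ^ r) :=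
          mul_le_mul h1 h2 (abs_nonneg _) (by positivity)
      _ = _ := by ring
  have i2 : Integrable (fun t => (t - 1) * F t) (expMeasure 1) :=
    integrable_expMeasure_of_le_pow (c := c + 1) (by positivity)
      (aestronglyMeasurable_expMeasure_of_continuousOn (by fun_prop)) hb2
  rw [← sub_eq_zero, ← integral_sub i1 i2, integral_expMeasure]
  have i3 := integrable_expMeasure_iff.1 (i1.sub i2)
  -- An antiderivative of the difference of the two integrands. Its factor `t` kills the boundary
  -- term at zero, where `F` is only known to be bounded.
  have hd : ∀ t ∈ Ioi (0 : ℝ), HasDerivAt (fun t => t * Real.exp (-t) * F t)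
      (Real.exp (-t) * (t * deriv F t - (t - 1) * F t)) t := by
    intro t ht
    have h1 := ((hasDerivAt_id' t).mul ((hasDerivAt_neg t).exp)).mul (hF t ht).hasDerivAt
    refine h1.congr_deriv ?_
    simp only [Pi.mul_apply]
    ring
  have hcont : ContinuousWithinAt (fun t => t * Real.exp (-t) * F t) (Ici 0) 0 := by
    rw [ContinuousWithinAt]
    simp only [zero_mul]
    refine squeeze_zero_norm' (a := fun t => t * Real.exp (-t) * (K * (c + t) ^ r)) ?_ ?_
    · filter_upwards [self_mem_nhdsWithin] with t ht
      rcases eq_or_lt_of_le (show (0 : ℝ) ≤ t from ht) with rfl | ht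
      · simp
      · rw [norm_mul, Real.norm_of_nonneg (by positivity)]
        exact mul_le_mul_of_nonneg_left (hb t ht) (by positivity)
    · have : Continuous (fun t : ℝ => t * Real.exp (-t) * (K * (c + t) ^ r)) := by fun_prop
      simpa using (this.tendsto 0).mono_left nhdsWithin_le_nhds
  have hlim : Tendsto (fun t => t * Real.exp (-t) * F t) atTop (𝓝 0) := by
    set D : ℝ := K * ((r + 1).factorial * 2 ^ (r + 1) * Real.exp (c / 2))
    have hlim0 : Tendsto (fun t : ℝ => D * Real.exp (-(t / 2))) atTop (𝓝 0) := by
      have h1 : Tendsto (fun t : ℝ => Real.exp (-(t / 2))) atTop (𝓝 0) :=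
        Real.tendsto_exp_neg_atTop_nhds_zero.comp (tendsto_id.atTop_div_const (by norm_num))
      simpa using h1.const_mul D
    refine squeeze_zero_norm' ?_ hlim0
    filter_upwards [eventually_gt_atTop 0] with t ht
    rw [norm_mul, Real.norm_of_nonneg (by positivity)]
    have h1 := add_pow_le_exp_half c (r + 1) (t := t) (by positivity)
    have h2 : t * |F t| ≤ (c + t) * (K * (c + t) ^ r) :=
      mul_le_mul (by linarith) (hb t ht) (abs_nonneg _) (by positivity)
    have e : Real.exp (-(t / 2)) = Real.exp (-t) * Real.exp (t / 2) := by
      rw [← Real.exp_add]; ring_nf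
    calc t * Real.exp (-t) * ‖F t‖ = Real.exp (-t) * (t * |F t|) := by
          rw [Real.norm_eq_abs]; ring
      _ ≤ Real.exp (-t) * (K * (c + t) ^ (r + 1)) := by
          refine mul_le_mul_of_nonneg_left (h2.trans_eq (by ring)) (Real.exp_pos _).le
      _ ≤ Real.exp (-t) * (K * ((r + 1).factorial * 2 ^ (r + 1) * Real.exp (c / 2)
            * Real.exp (t / 2))) := by gcongr
      _ = _ := by rw [e]; ring
  have := integral_Ioi_of_hasDerivAt_of_tendsto hcont hd i3 hlim
  simpa using this

lemma integrable_rpow_expMeasure {s : ℝ} (hs : -1 < s) :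
    Integrable (fun t => t ^ s) (expMeasure 1) := by
  rw [integrable_expMeasure_iff]
  simpa using Real.GammaIntegral_convergent (s := s + 1) (by linarith)

/-- Meant for `cms`, whose blow-up at the endpoints `±π/2` is at most a power of the distance to
them. -/
lemma integrableOn_pi_div_two_sub_abs_rpow {s : ℝ} (hs : -1 < s) :
    IntegrableOn (fun v => (Real.pi / 2 - |v|) ^ s) (Ioo (-(Real.pi / 2)) (Real.pi / 2)) := by
  have h1 : IntegrableOn (fun v => (Real.pi / 2 - v) ^ s) (Ioo 0 (Real.pi / 2)) := by
    have := (intervalIntegral.intervalIntegrable_rpow' (a := 0) (b := Real.pi / 2) hs).comp_sub_left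
      (Real.pi / 2)
    rw [sub_zero, sub_self] at this
    have := this.symm
    rw [intervalIntegrable_iff_integrableOn_Ioo_of_le (by positivity)] at this
    exact this
  have h1' : IntegrableOn (fun v => (Real.pi / 2 - |v|) ^ s) (Ioo 0 (Real.pi / 2)) :=
    h1.congr_fun (fun v hv => by simp only [abs_of_pos hv.1]) measurableSet_Ioo
  have h2 : IntegrableOn (fun v => (Real.pi / 2 - |v|) ^ s) (Ioo (-(Real.pi / 2)) 0) := by
    have := h1'.comp_neg
    simpa using this
  have h3 := h2.union h1'
  refine (h3.union (t := {0}) (by simp)).mono_set fun v hv => ?_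
  rcases lt_trichotomy v 0 with h | h | h
  · exact Or.inl (Or.inl ⟨hv.1, h⟩)
  · exact Or.inr h
  · exact Or.inl (Or.inr ⟨h, hv.2⟩)

end OneDim

/-! ### Coordinates, natural domains and the polynomial gauge. -/

section Indices

/-- Replace the coordinate `l` of `x` by `t`. -/
def upd (x : Noise) (l : NoiseIdx) (t : ℝ) : Noise := open Classical in Function.update x l t

@[simp] lemma upd_same (x : Noise) (l : NoiseIdx) (t : ℝ) : upd x l t l = t := by simp [upd]

lemma upd_of_ne (x : Noise) {k l : NoiseIdx} (h : k ≠ l) (t : ℝ) : upd x l t k = x k := by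
  simp [upd, h]

@[simp] lemma upd_upd (x : Noise) (l : NoiseIdx) (s t : ℝ) : upd (upd x l s) l t = upd x l t := by
  simp [upd]

@[simp] lemma upd_self (x : Noise) (l : NoiseIdx) : upd x l (x l) = x := by simp [upd]

lemma pderiv_eq (l : NoiseIdx) (ψ : Noise → ℝ) (x : Noise) :
    pderiv l ψ x = deriv (fun t => ψ (upd x l t)) (x l) := rfl

/-- The labels of the exponential variables of level `m`. -/
def expIdx (m : ℕ) : Finset NoiseIdx :=
  open Classical in (Finset.range m).image NoiseIdx.E ∪ {.eta .plus, .eta .minus}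

/-- The labels of all variables of level `m`. -/
def levelIdx (m : ℕ) : Finset NoiseIdx :=
  open Classical in expIdx m ∪ (Finset.range m).image NoiseIdx.U ∪ (Finset.range m).image NoiseIdx.V

@[simp] lemma E_mem_expIdx {m i : ℕ} : NoiseIdx.E i ∈ expIdx m ↔ i < m := by simp [expIdx]
@[simp] lemma eta_mem_expIdx {m : ℕ} {σ : PM} : NoiseIdx.eta σ ∈ expIdx m := by
  cases σ <;> simp [expIdx]
@[simp] lemma U_mem_expIdx {m i : ℕ} : NoiseIdx.U i ∉ expIdx m := by simp [expIdx]
@[simp] lemma V_mem_expIdx {m i : ℕ} : NoiseIdx.V i ∉ expIdx m := by simp [expIdx]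
@[simp] lemma E_mem_levelIdx {m i : ℕ} : NoiseIdx.E i ∈ levelIdx m ↔ i < m := by simp [levelIdx]
@[simp] lemma U_mem_levelIdx {m i : ℕ} : NoiseIdx.U i ∈ levelIdx m ↔ i < m := by simp [levelIdx]
@[simp] lemma V_mem_levelIdx {m i : ℕ} : NoiseIdx.V i ∈ levelIdx m ↔ i < m := by simp [levelIdx]
@[simp] lemma eta_mem_levelIdx {m : ℕ} {σ : PM} : NoiseIdx.eta σ ∈ levelIdx m := by simp [levelIdx]

lemma expIdx_subset (m : ℕ) : expIdx m ⊆ levelIdx m := by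
  intro l hl
  cases l <;> simp_all

lemma sum_expIdx (m : ℕ) (h : NoiseIdx → ℝ) :
    ∑ l ∈ expIdx m, h l = h (.eta .plus) + h (.eta .minus) + ∑ i ∈ Finset.range m, h (.E i) := by
  classical
  unfold expIdx
  rw [Finset.sum_union, Finset.sum_image, Finset.sum_pair, add_comm]
  · simp
  · intro a _ b _ h; simpa using h
  · rw [Finset.disjoint_left]; intro a ha; simp at ha ⊢; obtain ⟨i, _, rfl⟩ := ha; simp

lemma card_expIdx (m : ℕ) : (expIdx m).card = m + 2 := by
  have := sum_expIdx m (fun _ => 1)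
  simp only [Finset.sum_const, nsmul_eq_mul, mul_one, Finset.card_range] at this
  have h2 : ((expIdx m).card : ℝ) = ((m + 2 : ℕ) : ℝ) := by rw [this]; push_cast; ring
  exact_mod_cast h2

lemma trunc_congr {m : ℕ} {x y : Noise} (h : ∀ k ∈ levelIdx m, x k = y k) :
    trunc m x = trunc m y := by
  have hE : ∀ i : Fin m, x (.E i) = y (.E i) := fun i => h _ (by simp)
  have hU : ∀ i : Fin m, x (.U i) = y (.U i) := fun i => h _ (by simp)
  have hV : ∀ i : Fin m, x (.V i) = y (.V i) := fun i => h _ (by simp)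
  have h1 : ∀ σ, x (.eta σ) = y (.eta σ) := fun i => h _ (by simp)
  simp only [trunc, hE, hU, hV, h1]

lemma measurable_trunc (m : ℕ) : Measurable (trunc m) := by
  unfold trunc; fun_prop

lemma isOpen_coordDomain (m : ℕ) : IsOpen (coordDomain m) := by
  have : coordDomain m = (⋂ i, {c : Coord m | 0 < c.1 i}) ∩
      ((⋂ i, {c : Coord m | c.2.1 i ∈ Ioo (0 : ℝ) 1}) ∩
      ((⋂ i, {c : Coord m | c.2.2.1 i ∈ Ioo (-(Real.pi / 2)) (Real.pi / 2)}) ∩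
      ({c : Coord m | 0 < c.2.2.2.1} ∩ {c : Coord m | 0 < c.2.2.2.2}))) := by
    ext c; simp [coordDomain]
  rw [this]
  refine IsOpen.inter (isOpen_iInter_of_finite fun i => ?_) (IsOpen.inter
    (isOpen_iInter_of_finite fun i => ?_) (IsOpen.inter (isOpen_iInter_of_finite fun i => ?_)
      (IsOpen.inter ?_ ?_)))
  · exact isOpen_lt continuous_const (by fun_prop)
  · exact isOpen_Ioo.preimage (f := fun c : Coord m => c.2.1 i) (by fun_prop)
  · exact isOpen_Ioo.preimage (f := fun c : Coord m => c.2.2.1 i) (by fun_prop)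
  · exact isOpen_lt continuous_const (by fun_prop)
  · exact isOpen_lt continuous_const (by fun_prop)

/-- The realisations of the noise whose coordinates of level `m` lie in their natural range. -/
def noiseDomain (m : ℕ) : Set Noise := {x | trunc m x ∈ coordDomain m}

lemma measurableSet_noiseDomain (m : ℕ) : MeasurableSet (noiseDomain m) :=
  measurable_trunc m (isOpen_coordDomain m).measurableSet

lemma mem_noiseDomain_iff {m : ℕ} {x : Noise} :
    x ∈ noiseDomain m ↔ (∀ i < m, 0 < x (.E i)) ∧ (∀ i < m, x (.U i) ∈ Ioo (0 : ℝ) 1) ∧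
      (∀ i < m, x (.V i) ∈ Ioo (-(Real.pi / 2)) (Real.pi / 2)) ∧ ∀ σ, 0 < x (.eta σ) := by
  have hσ : (∀ σ, 0 < x (.eta σ)) ↔ 0 < x (.eta .plus) ∧ 0 < x (.eta .minus) :=
    ⟨fun h => ⟨h _, h _⟩, fun h σ => by cases σ; exacts [h.1, h.2]⟩
  simp only [noiseDomain, trunc, coordDomain, mem_ofPred_eq, Fin.forall_iff, hσ]

lemma noiseDomain_congr {m : ℕ} {x y : Noise} (h : ∀ k ∈ levelIdx m, x k = y k) :
    x ∈ noiseDomain m ↔ y ∈ noiseDomain m := by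
  simp only [noiseDomain, mem_ofPred_eq, trunc_congr h]

lemma pos_of_mem_noiseDomain {m : ℕ} {x : Noise} (hx : x ∈ noiseDomain m) {l : NoiseIdx}
    (hl : l ∈ expIdx m) : 0 < x l := by
  rw [mem_noiseDomain_iff] at hx
  cases l <;> simp_all

lemma upd_mem_noiseDomain {m : ℕ} {x : Noise} (hx : x ∈ noiseDomain m) {l : NoiseIdx}
    (hl : l ∈ expIdx m) {t : ℝ} (ht : 0 < t) : upd x l t ∈ noiseDomain m := by
  have key : ∀ k, 0 < x k → 0 < upd x l t k := fun k hk => by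
    by_cases h : k = l
    · subst h; simpa
    · rwa [upd_of_ne _ h]
  rw [mem_noiseDomain_iff] at hx ⊢
  refine ⟨fun i hi => key _ (hx.1 i hi), fun i hi => ?_, fun i hi => ?_, fun σ => key _ (hx.2.2.2 σ)⟩
  · rw [upd_of_ne _ (by rintro rfl; simp at hl)]; exact hx.2.1 i hi
  · rw [upd_of_ne _ (by rintro rfl; simp at hl)]; exact hx.2.2.1 i hi

lemma eventually_upd_mem {m : ℕ} {x : Noise} (hx : x ∈ noiseDomain m) {l : NoiseIdx}
    (hl : l ∈ expIdx m) : ∀ᶠ t in 𝓝 (x l), upd x l t ∈ noiseDomain m :=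
  (lt_mem_nhds (pos_of_mem_noiseDomain hx hl)).mono fun _ ht => upd_mem_noiseDomain hx hl ht

/-- The domain is open along each exponential coordinate, so identities valid only on the domain may
be differentiated there. -/
lemma pderiv_congr {m : ℕ} {x : Noise} (hx : x ∈ noiseDomain m) {l : NoiseIdx}
    (hl : l ∈ expIdx m) {ψ ψ' : Noise → ℝ} (h : ∀ y ∈ noiseDomain m, ψ y = ψ' y) :
    pderiv l ψ x = pderiv l ψ' x := by
  rw [pderiv_eq, pderiv_eq]
  exact Filter.EventuallyEq.deriv_eq ((eventually_upd_mem hx hl).mono fun t ht => h _ ht)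

lemma measurable_upd (l : NoiseIdx) : Measurable (fun p : Noise × ℝ => upd p.1 l p.2) := by
  refine measurable_pi_iff.2 fun k => ?_
  by_cases h : k = l
  · subst h; simpa using measurable_snd
  · simp only [upd_of_ne _ h]; fun_prop

/-- A polynomial gauge for the size of the exponential variables of level `m`. -/
def noiseGauge (m : ℕ) (x : Noise) : ℝ := ∑ l ∈ expIdx m, (1 + x l)

lemma measurable_gauge (m : ℕ) : Measurable (noiseGauge m) := by unfold noiseGauge; fun_prop

lemma gauge_congr {m : ℕ} {x y : Noise} (h : ∀ k ∈ levelIdx m, x k = y k) :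
    noiseGauge m x = noiseGauge m y :=
  Finset.sum_congr rfl fun l hl => by rw [h l (expIdx_subset m hl)]

lemma card_le_gauge {m : ℕ} {x : Noise} (hx : x ∈ noiseDomain m) : (m : ℝ) + 2 ≤ noiseGauge m x := by
  have : ∑ l ∈ expIdx m, (1 : ℝ) ≤ noiseGauge m x :=
    Finset.sum_le_sum fun l hl => by linarith [pos_of_mem_noiseDomain hx hl]
  simpa [card_expIdx] using this

lemma one_le_gauge {m : ℕ} {x : Noise} (hx : x ∈ noiseDomain m) : 1 ≤ noiseGauge m x := by
  have := card_le_gauge hx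
  have : (0 : ℝ) ≤ m := by positivity
  linarith

lemma le_gauge {m : ℕ} {x : Noise} (hx : x ∈ noiseDomain m) {l : NoiseIdx} (hl : l ∈ expIdx m) :
    x l ≤ noiseGauge m x := by
  have := Finset.single_le_sum (f := fun l => 1 + x l)
    (fun l hl => by linarith [pos_of_mem_noiseDomain hx hl]) hl
  have h : 1 + x l ≤ noiseGauge m x := this
  linarith

/-- Along one exponential coordinate the gauge has the form `c + t`, which is the shape of the
growth bounds in the one-dimensional integration by parts. -/
lemma gauge_upd {m : ℕ} (x : Noise) {l : NoiseIdx} (hl : l ∈ expIdx m) (t : ℝ) :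
    noiseGauge m (upd x l t) = noiseGauge m x - x l + t := by
  classical
  unfold noiseGauge
  rw [← Finset.add_sum_erase _ _ hl, ← Finset.add_sum_erase _ _ hl, upd_same]
  rw [Finset.sum_congr rfl fun k hk => by rw [upd_of_ne _ (Finset.ne_of_mem_erase hk)]]
  ring

end Indices

/-! ### Independence of single coordinates, resampling, and moments of the gauge. -/

section Independence

variable {Ω S : Type*} [MeasurableSpace Ω] {P : Measure Ω} {N : Ω → Noise}

lemma IsDrivingNoise.measurable_noise (hN : IsDrivingNoise P N) : Measurable N :=
  measurable_pi_iff.2 hN.measurable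

lemma IsDrivingNoise.law (hN : IsDrivingNoise P N) {m : ℕ} {l : NoiseIdx} (hl : l ∈ expIdx m) :
    P.map (fun ω => N ω l) = expMeasure 1 := by
  cases l
  · exact hN.law_E _
  · simp at hl
  · simp at hl
  · exact hN.law_eta _

lemma IsDrivingNoise.ae_pos (hN : IsDrivingNoise P N) {m : ℕ} {l : NoiseIdx} (hl : l ∈ expIdx m) :
    ∀ᵐ ω ∂P, 0 < N ω l := by
  have := ae_expMeasure_pos
  rw [← hN.law hl] at this
  exact ae_of_ae_map (hN.measurable l).aemeasurable this

lemma IsDrivingNoise.ae_mem_noiseDomain (hN : IsDrivingNoise P N) (m : ℕ) :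
    ∀ᵐ ω ∂P, N ω ∈ noiseDomain m := by
  have hu : ∀ {k : NoiseIdx} {a b : ℝ}, pdf.IsUniform (fun ω => N ω k) (Ioo a b) P volume →
      ∀ᵐ ω ∂P, N ω k ∈ Ioo a b := by
    intro k a b h
    have h1 : ∀ᵐ y ∂(P.map (fun ω => N ω k)), y ∈ Ioo a b := by
      rw [show P.map (fun ω => N ω k) = ProbabilityTheory.cond volume (Ioo a b) from h]
      exact ae_cond_mem measurableSet_Ioo
    exact ae_of_ae_map (hN.measurable k).aemeasurable h1
  have h1 : ∀ᵐ ω ∂P, ∀ i, 0 < N ω (.E i) :=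
    ae_all_iff.2 fun i => hN.ae_pos (m := i + 1) (by simp)
  have h2 : ∀ᵐ ω ∂P, ∀ i, N ω (.U i) ∈ Ioo (0 : ℝ) 1 := ae_all_iff.2 fun i => hu (hN.law_U i)
  have h3 : ∀ᵐ ω ∂P, ∀ i, N ω (.V i) ∈ Ioo (-(Real.pi / 2)) (Real.pi / 2) :=
    ae_all_iff.2 fun i => hu (hN.law_V i)
  have h4 := hN.ae_pos (l := .eta .plus) (m := 0) (by simp)
  have h5 := hN.ae_pos (l := .eta .minus) (m := 0) (by simp)
  filter_upwards [h1, h2, h3, h4, h5] with ω h1 h2 h3 h4 h5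
  exact mem_noiseDomain_iff.2 ⟨fun i _ => h1 i, fun i _ => h2 i, fun i _ => h3 i,
    fun σ => by cases σ; exacts [h4, h5]⟩

/-- The noise with prescribed coordinates of level `m`, all others being zero. -/
def liftCoord (m : ℕ) (c : Coord m) : Noise
  | .E i => if h : i < m then c.1 ⟨i, h⟩ else 0
  | .U i => if h : i < m then c.2.1 ⟨i, h⟩ else 0
  | .V i => if h : i < m then c.2.2.1 ⟨i, h⟩ else 0
  | .eta .plus => c.2.2.2.1
  | .eta .minus => c.2.2.2.2

lemma measurable_liftCoord (m : ℕ) : Measurable (liftCoord m) := by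
  refine measurable_pi_iff.2 fun k => ?_
  rcases k with i | i | i | σ
  · by_cases h : i < m <;> simp only [liftCoord, h, dite_true, dite_false] <;> fun_prop
  · by_cases h : i < m <;> simp only [liftCoord, h, dite_true, dite_false] <;> fun_prop
  · by_cases h : i < m <;> simp only [liftCoord, h, dite_true, dite_false] <;> fun_prop
  · cases σ <;> simp only [liftCoord] <;> fun_prop

lemma liftCoord_trunc {m : ℕ} (x : Noise) {k : NoiseIdx} (hk : k ∈ levelIdx m) :
    liftCoord m (trunc m x) k = x k := by
  rcases k with i | i | i | σ
  · simp only [E_mem_levelIdx] at hk; simp [liftCoord, trunc, hk]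
  · simp only [U_mem_levelIdx] at hk; simp [liftCoord, trunc, hk]
  · simp only [V_mem_levelIdx] at hk; simp [liftCoord, trunc, hk]
  · cases σ <;> simp [liftCoord, trunc]

/-- The coordinates of level `m` other than `l`, all the rest being set to zero. -/
def eraseCoord (m : ℕ) (l : NoiseIdx) (x : Noise) : Noise :=
  open Classical in fun k => if k ∈ (levelIdx m).erase l then x k else 0

lemma measurable_eraseCoord (m : ℕ) (l : NoiseIdx) : Measurable (eraseCoord m l) := by
  classical
  refine measurable_pi_iff.2 fun k => ?_
  by_cases h : k ∈ (levelIdx m).erase l <;> simp only [eraseCoord, h, if_true, if_false] <;> fun_prop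

lemma upd_eraseCoord {m : ℕ} {l : NoiseIdx} (x : Noise) (t : ℝ) :
    ∀ k ∈ levelIdx m, upd (eraseCoord m l x) l t k = upd x l t k := by
  intro k hk
  by_cases h : k = l
  · subst h; simp
  · rw [upd_of_ne _ h, upd_of_ne _ h]; simp [eraseCoord, h, hk]

/-- The joint law is a threefold product, which may be reassociated. -/
lemma indepFun_prodMk_right_of_indepFun {β γ δ : Type*} [MeasurableSpace β] [MeasurableSpace γ]
    [MeasurableSpace δ] [IsProbabilityMeasure P] {X : Ω → β} {Y : Ω → γ} {Z : Ω → δ}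
    (hX : Measurable X) (hY : Measurable Y) (hZ : Measurable Z) (h1 : IndepFun X Y P)
    (h2 : IndepFun (fun ω => (X ω, Y ω)) Z P) : IndepFun X (fun ω => (Y ω, Z ω)) P := by
  have := Measure.isProbabilityMeasure_map (μ := P) hX.aemeasurable
  have := Measure.isProbabilityMeasure_map (μ := P) hY.aemeasurable
  have := Measure.isProbabilityMeasure_map (μ := P) hZ.aemeasurable
  have hYZ : IndepFun Y Z P := h2.comp measurable_snd measurable_id
  rw [indepFun_iff_map_prod_eq_prod_map_map (by fun_prop) (by fun_prop)] at h1 h2 hYZ ⊢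
  rw [hYZ, ← Measure.prodAssoc_prod, ← h1, ← h2, Measure.map_map (by fun_prop) (by fun_prop)]
  rfl

variable [MeasurableSpace S]

/-- `ϑ` is only known to be independent of the coordinates of level `m`, and may depend on all later
ones. The conditioning variable is therefore the erased noise of level `m`, not the whole remaining
noise. -/
lemma IsDrivingNoise.indepFun_coord [IsProbabilityMeasure P] (hN : IsDrivingNoise P N) {m : ℕ}
    {ϑ : Ω → S} (hϑ : Measurable ϑ) (hind : IndepFun (fun ω => trunc m (N ω)) ϑ P)
    {l : NoiseIdx} (hl : l ∈ levelIdx m) :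
    IndepFun (fun ω => N ω l) (fun ω => (eraseCoord m l (N ω), ϑ ω)) P := by
  classical
  refine indepFun_prodMk_right_of_indepFun (hN.measurable l)
    ((measurable_eraseCoord m l).comp hN.measurable_noise) hϑ ?_ ?_
  · have h := hN.indep.indepFun_finset {l} ((levelIdx m).erase l) (by simp) hN.measurable
    have hφ : Measurable (fun y : ({l} : Finset NoiseIdx) → ℝ => y ⟨l, by simp⟩) := by fun_prop
    have hψ : Measurable (fun (y : ((levelIdx m).erase l : Finset NoiseIdx) → ℝ) (k : NoiseIdx) =>
        if h : k ∈ (levelIdx m).erase l then y ⟨k, h⟩ else 0) := measurable_pi_iff.2 fun k => by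
      by_cases h : k ∈ (levelIdx m).erase l <;> simp only [h, dite_true, dite_false] <;> fun_prop
    have := h.comp hφ hψ
    refine this.congr (by rfl) (Eventually.of_forall fun ω => ?_)
    funext k
    simp [eraseCoord]
  · have := hind.comp (φ := fun c => (liftCoord m c l, eraseCoord m l (liftCoord m c)))
      (ψ := id) (((measurable_pi_apply l).comp (measurable_liftCoord m)).prodMk
        ((measurable_eraseCoord m l).comp (measurable_liftCoord m))) measurable_id
    refine this.congr (Eventually.of_forall fun ω => ?_) (by rfl)
    simp only [Function.comp_apply]
    rw [liftCoord_trunc _ hl]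
    congr 1
    funext k
    by_cases h : k ∈ (levelIdx m).erase l
    · simp only [eraseCoord, h, if_true]; exact liftCoord_trunc _ (Finset.mem_of_mem_erase h)
    · simp only [eraseCoord, h, if_false]

/-- Resampling one exponential coordinate does not change the expectation. -/
lemma IsDrivingNoise.integral_resample [IsProbabilityMeasure P] (hN : IsDrivingNoise P N) {m : ℕ}
    {ϑ : Ω → S} (hϑ : Measurable ϑ) (hind : IndepFun (fun ω => trunc m (N ω)) ϑ P)
    {l : NoiseIdx} (hl : l ∈ expIdx m) {F : Noise × S → ℝ} (hF : Measurable F)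
    (hdep : ∀ x y s, (∀ k ∈ levelIdx m, x k = y k) → F (x, s) = F (y, s))
    (hint : Integrable (fun ω => F (N ω, ϑ ω)) P) :
    ∫ ω, F (N ω, ϑ ω) ∂P = ∫ ω, ∫ t, F (upd (N ω) l t, ϑ ω) ∂(expMeasure 1) ∂P := by
  have hi := hN.indepFun_coord hϑ hind (expIdx_subset m hl)
  have hB : Measurable (fun ω => (eraseCoord m l (N ω), ϑ ω)) :=
    ((measurable_eraseCoord m l).comp hN.measurable_noise).prodMk hϑ
  have := Measure.isProbabilityMeasure_map (μ := P) hB.aemeasurable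
  rw [indepFun_iff_map_prod_eq_prod_map_map (hN.measurable l).aemeasurable hB.aemeasurable,
    hN.law hl] at hi
  set F' : ℝ × (Noise × S) → ℝ := fun p => F (upd p.2.1 l p.1, p.2.2) with hF'
  have hF'm : Measurable F' := hF.comp
    (((measurable_upd l).comp (by fun_prop : Measurable fun p : ℝ × (Noise × S) =>
      (p.2.1, p.1))).prodMk (by fun_prop))
  have hJ : Measurable (fun ω => (N ω l, (eraseCoord m l (N ω), ϑ ω))) :=
    (hN.measurable l).prodMk hB
  have e : ∀ ω t, F (upd (eraseCoord m l (N ω)) l t, ϑ ω) = F (upd (N ω) l t, ϑ ω) :=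
    fun ω t => hdep _ _ _ (upd_eraseCoord _ _)
  have e1 : (fun ω => F (N ω, ϑ ω)) = fun ω => F' (N ω l, (eraseCoord m l (N ω), ϑ ω)) := by
    funext ω; simp only [hF', e, upd_self]
  have hint' : Integrable F' ((expMeasure 1).prod
      (P.map (fun ω => (eraseCoord m l (N ω), ϑ ω)))) := by
    rw [← hi, integrable_map_measure hF'm.aestronglyMeasurable hJ.aemeasurable]
    rw [e1] at hint; exact hint
  calc ∫ ω, F (N ω, ϑ ω) ∂P = ∫ ω, F' (N ω l, (eraseCoord m l (N ω), ϑ ω)) ∂P := by rw [e1]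
    _ = ∫ p, F' p ∂(P.map (fun ω => (N ω l, (eraseCoord m l (N ω), ϑ ω)))) :=
        (integral_map hJ.aemeasurable hF'm.aestronglyMeasurable).symm
    _ = ∫ p, ∫ t, F' (t, p) ∂(expMeasure 1)
          ∂(P.map (fun ω => (eraseCoord m l (N ω), ϑ ω))) := by
        rw [hi, integral_prod_symm _ hint']
    _ = ∫ ω, ∫ t, F' (t, (eraseCoord m l (N ω), ϑ ω)) ∂(expMeasure 1) ∂P := by
        rw [integral_map hB.aemeasurable]
        exact hF'm.stronglyMeasurable.integral_prod_left'.aestronglyMeasurable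
    _ = _ := by simp only [hF', e]

/-- The constant in the moment bound for `noiseGauge`. -/
def gaugeMoment (r : ℕ) : ℝ := ∫ t, (1 + t) ^ r ∂(expMeasure 1)

lemma IsDrivingNoise.integrable_coord_pow (hN : IsDrivingNoise P N) {m : ℕ} {l : NoiseIdx}
    (hl : l ∈ expIdx m) (r : ℕ) : Integrable (fun ω => (1 + N ω l) ^ r) P := by
  have h := integrable_add_pow_expMeasure 1 zero_le_one r
  rw [← hN.law hl] at h
  exact h.comp_measurable (hN.measurable l)

lemma IsDrivingNoise.integral_coord_pow (hN : IsDrivingNoise P N) {m : ℕ} {l : NoiseIdx}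
    (hl : l ∈ expIdx m) (r : ℕ) : ∫ ω, (1 + N ω l) ^ r ∂P = gaugeMoment r := by
  rw [gaugeMoment, ← hN.law hl, integral_map (hN.measurable l).aemeasurable
    (by fun_prop)]

lemma gauge_pow_le {m : ℕ} {x : Noise} (hx : x ∈ noiseDomain m) (r : ℕ) :
    noiseGauge m x ^ r ≤ ((m : ℝ) + 2) ^ r * ∑ l ∈ expIdx m, (1 + x l) ^ r := by
  have h2 : (1 : ℝ) ≤ (m : ℝ) + 2 := by linarith [(Nat.cast_nonneg m : (0:ℝ) ≤ m)]
  cases r with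
  | zero => simp [card_expIdx]; linarith
  | succ r =>
    have hp : ∀ l ∈ expIdx m, 0 ≤ 1 + x l := fun l hl => by
      linarith [pos_of_mem_noiseDomain hx hl]
    have h := pow_sum_le_card_mul_sum_pow hp r
    rw [card_expIdx] at h
    push_cast at h
    refine h.trans (mul_le_mul_of_nonneg_right (pow_le_pow_right₀ h2 (by omega))
      (Finset.sum_nonneg fun l hl => pow_nonneg (hp l hl) _))

lemma IsDrivingNoise.integrable_gauge_pow (hN : IsDrivingNoise P N) (m r : ℕ) :
    Integrable (fun ω => noiseGauge m (N ω) ^ r) P := by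
  refine Integrable.mono' (((integrable_finsetSum (expIdx m)
    fun l hl => hN.integrable_coord_pow hl r)).const_mul (((m : ℝ) + 2) ^ r))
    ((measurable_gauge m).comp hN.measurable_noise |>.pow_const r).aestronglyMeasurable ?_
  filter_upwards [hN.ae_mem_noiseDomain m] with ω hω
  rw [Real.norm_of_nonneg (pow_nonneg (zero_le_one.trans (one_le_gauge hω)) _)]
  exact gauge_pow_le hω r

/-- The point is polynomial growth in `m`, which the geometric decay of the increments of
`approxChi` will beat. -/
lemma IsDrivingNoise.integral_gauge_pow_le (hN : IsDrivingNoise P N) (m r : ℕ) :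
    ∫ ω, noiseGauge m (N ω) ^ r ∂P ≤ ((m : ℝ) + 2) ^ (r + 1) * gaugeMoment r := by
  have h1 := fun l (hl : l ∈ expIdx m) => hN.integrable_coord_pow hl r
  calc _ ≤ ∫ ω, ((m : ℝ) + 2) ^ r * ∑ l ∈ expIdx m, (1 + N ω l) ^ r ∂P := by
        refine integral_mono_ae (hN.integrable_gauge_pow m r)
          ((integrable_finsetSum _ h1).const_mul _) ?_
        filter_upwards [hN.ae_mem_noiseDomain m] with ω hω using gauge_pow_le hω r
    _ = _ := by
        rw [integral_const_mul, integral_finsetSum _ h1,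
          Finset.sum_congr rfl fun l hl => hN.integral_coord_pow hl r]
        simp [card_expIdx]; ring

end Independence

/-! ### Functions of finitely many coordinates, and integration by parts in one of them. -/

section Adapted

variable {Ω S : Type*} [MeasurableSpace Ω] {P : Measure Ω} {N : Ω → Noise} [MeasurableSpace S]

/-- Functions of the noise of level `m` and of a parameter, jointly measurable on the natural
domain. -/
structure IsAdapted (m : ℕ) (F : Noise → S → ℝ) : Prop where
  meas : Measurable ((noiseDomain m ×ˢ univ).indicator fun p : Noise × S => F p.1 p.2)
  dep : ∀ x ∈ noiseDomain m, ∀ y s, (∀ k ∈ levelIdx m, x k = y k) → F x s = F y s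

lemma measurableSet_domain_prod (m : ℕ) :
    MeasurableSet (noiseDomain m ×ˢ (univ : Set S)) :=
  (measurableSet_noiseDomain m).prod MeasurableSet.univ

lemma IsAdapted.of_measurable {m : ℕ} {F : Noise → S → ℝ}
    (h : Measurable fun p : Noise × S => F p.1 p.2)
    (dep : ∀ x ∈ noiseDomain m, ∀ y s, (∀ k ∈ levelIdx m, x k = y k) → F x s = F y s) : IsAdapted m F :=
  ⟨h.indicator (measurableSet_domain_prod m), dep⟩

lemma IsAdapted.add {m : ℕ} {F G : Noise → S → ℝ} (hF : IsAdapted m F) (hG : IsAdapted m G) :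
    IsAdapted m (fun x s => F x s + G x s) where
  meas := by
    rw [indicator_add]; exact hF.meas.add hG.meas
  dep x hx y s h := by rw [hF.dep x hx y s h, hG.dep x hx y s h]

lemma IsAdapted.mul {m : ℕ} {F G : Noise → S → ℝ} (hF : IsAdapted m F) (hG : IsAdapted m G) :
    IsAdapted m (fun x s => F x s * G x s) where
  meas := by
    rw [indicator_mul]; exact hF.meas.mul hG.meas
  dep x hx y s h := by rw [hF.dep x hx y s h, hG.dep x hx y s h]

lemma IsAdapted.const (m : ℕ) (c : ℝ) : IsAdapted m (fun _ (_ : S) => c) :=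
  .of_measurable measurable_const fun _ _ _ _ _ => rfl

lemma IsAdapted.sum {ι : Type*} {m : ℕ} {s : Finset ι} {F : ι → Noise → S → ℝ}
    (hF : ∀ i ∈ s, IsAdapted m (F i)) : IsAdapted m (fun x t => ∑ i ∈ s, F i x t) := by
  classical
  induction s using Finset.induction_on with
  | empty => simpa using IsAdapted.const m 0
  | insert a s ha ih =>
    simp only [Finset.sum_insert ha]
    exact (hF a (by simp)).add (ih fun i hi => hF i (by simp [hi]))

lemma IsAdapted.congr {m : ℕ} {F G : Noise → S → ℝ} (hF : IsAdapted m F)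
    (h : ∀ x ∈ noiseDomain m, ∀ s, F x s = G x s) : IsAdapted m G where
  meas := by
    have e : ((noiseDomain m ×ˢ univ).indicator fun p : Noise × S => G p.1 p.2)
        = (noiseDomain m ×ˢ univ).indicator fun p : Noise × S => F p.1 p.2 :=
      indicator_congr fun p hp => (h p.1 hp.1 p.2).symm
    rw [e]; exact hF.meas
  dep x hx y s hxy := by
    rw [← h x hx, ← h y ((noiseDomain_congr hxy).1 hx), hF.dep x hx y s hxy]

lemma IsAdapted.coord {m : ℕ} {l : NoiseIdx} (hl : l ∈ levelIdx m) :
    IsAdapted m (fun x (_ : S) => x l) :=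
  .of_measurable (by fun_prop) fun _ _ _ _ h => h l hl

/-- Joint measurability holds because the derivative is a pointwise limit of difference quotients
with steps `1/(n+1)`. Positive steps keep an exponential coordinate inside the domain. -/
lemma IsAdapted.pderiv {m : ℕ} {F : Noise → S → ℝ} (hF : IsAdapted m F) {l : NoiseIdx}
    (hl : l ∈ expIdx m)
    (hd : ∀ x ∈ noiseDomain m, ∀ s, DifferentiableAt ℝ (fun t => F (upd x l t) s) (x l)) :
    IsAdapted m (fun x s => pderiv l (fun y => F y s) x) where
  meas := by
    set G : Noise × S → ℝ := (noiseDomain m ×ˢ univ).indicator fun p : Noise × S => F p.1 p.2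
    have hu : ∀ n : ℕ, Measurable fun p : Noise × S =>
        (upd p.1 l (p.1 l + ((n : ℝ) + 1)⁻¹), p.2) := fun n =>
      ((measurable_upd l).comp (by fun_prop : Measurable fun p : Noise × S =>
        (p.1, p.1 l + ((n : ℝ) + 1)⁻¹))).prodMk measurable_snd
    refine measurable_of_tendsto_metrizable (f := fun (n : ℕ) =>
      (noiseDomain m ×ˢ univ).indicator fun p : Noise × S =>
        (((n : ℝ) + 1)⁻¹)⁻¹ * (G (upd p.1 l (p.1 l + ((n : ℝ) + 1)⁻¹), p.2) - G p)) ?_ ?_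
    · intro n
      exact (((hF.meas.comp (hu n)).sub hF.meas).const_mul _).indicator
        (measurableSet_domain_prod m)
    · rw [tendsto_pi_nhds]
      rintro ⟨x, s⟩
      by_cases hx : x ∈ noiseDomain m
      · have hx' : (x, s) ∈ noiseDomain m ×ˢ (univ : Set S) := ⟨hx, mem_univ _⟩
        simp only [indicator_of_mem hx']
        have h1 := (hd x hx s).hasDerivAt.tendsto_slope_zero
        have h2 : Tendsto (fun n : ℕ => ((n : ℝ) + 1)⁻¹) atTop (𝓝[≠] 0) := by
          refine tendsto_nhdsWithin_iff.2 ⟨?_, Eventually.of_forall fun n => ?_⟩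
          · simpa using tendsto_one_div_add_atTop_nhds_zero_nat (𝕜 := ℝ)
          · simp only [mem_compl_iff, mem_singleton_iff]; positivity
        refine (h1.comp h2).congr fun n => ?_
        have hx2 : (upd x l (x l + ((n : ℝ) + 1)⁻¹), s) ∈ noiseDomain m ×ˢ (univ : Set S) :=
          ⟨upd_mem_noiseDomain hx hl
            (add_pos (pos_of_mem_noiseDomain hx hl) (by positivity)), mem_univ _⟩
        simp only [Function.comp_apply, G, indicator_of_mem hx', indicator_of_mem hx2, smul_eq_mul,
          upd_self]
      · have hx' : (x, s) ∉ noiseDomain m ×ˢ (univ : Set S) := fun h => hx h.1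
        simp only [indicator_of_notMem hx']
        exact tendsto_const_nhds
  dep x hx y s h := by
    rw [pderiv_eq, pderiv_eq, ← h l (expIdx_subset m hl)]
    refine Filter.EventuallyEq.deriv_eq ((eventually_upd_mem hx hl).mono fun t ht => ?_)
    refine hF.dep _ ht _ _ fun k hk => ?_
    by_cases hkl : k = l
    · subst hkl; simp
    · rw [upd_of_ne _ hkl, upd_of_ne _ hkl, h k hk]

lemma IsAdapted.aestronglyMeasurable {m : ℕ} {F : Noise → S → ℝ} (hF : IsAdapted m F)
    (hN : IsDrivingNoise P N) {ϑ : Ω → S} (hϑ : Measurable ϑ) :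
    AEStronglyMeasurable (fun ω => F (N ω) (ϑ ω)) P := by
  refine AEStronglyMeasurable.congr
    (hF.meas.comp (hN.measurable_noise.prodMk hϑ)).aestronglyMeasurable ?_
  filter_upwards [hN.ae_mem_noiseDomain m] with ω hω
  simp only [Function.comp_apply]
  rw [indicator_of_mem (show (N ω, ϑ ω) ∈ noiseDomain m ×ˢ univ from ⟨hω, mem_univ _⟩)]

lemma indepFun_of_congr {m : ℕ} {ϑ : Ω → S}
    (hind : IndepFun (fun ω => trunc m (N ω)) ϑ P) {F : Noise → ℝ} (hF : Measurable F)
    (hdep : ∀ x y, (∀ k ∈ levelIdx m, x k = y k) → F x = F y) {C : S → ℝ} (hC : Measurable C) :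
    IndepFun (fun ω => F (N ω)) (fun ω => C (ϑ ω)) P := by
  have := hind.comp (φ := fun c => F (liftCoord m c)) (ψ := C)
    (hF.comp (measurable_liftCoord m)) hC
  refine this.congr (Eventually.of_forall fun ω => ?_) (by rfl)
  exact hdep _ _ fun k hk => liftCoord_trunc _ hk

lemma IsDrivingNoise.integrable_gauge_mul (hN : IsDrivingNoise P N) {m : ℕ} {ϑ : Ω → S}
    (hind : IndepFun (fun ω => trunc m (N ω)) ϑ P) {C : S → ℝ} (hC : Measurable C)
    (hCi : Integrable (fun ω => C (ϑ ω)) P) (r : ℕ) :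
    Integrable (fun ω => noiseGauge m (N ω) ^ r * C (ϑ ω)) P :=
  (indepFun_of_congr hind ((measurable_gauge m).pow_const r)
    (fun _ _ h => by rw [gauge_congr h]) hC).integrable_mul (hN.integrable_gauge_pow m r) hCi

lemma IsAdapted.integrable {m : ℕ} {F : Noise → S → ℝ} (hF : IsAdapted m F)
    (hN : IsDrivingNoise P N) {ϑ : Ω → S} (hϑ : Measurable ϑ)
    (hind : IndepFun (fun ω => trunc m (N ω)) ϑ P) {C : S → ℝ} (hC : Measurable C)
    (hCi : Integrable (fun ω => C (ϑ ω)) P) {K : ℝ} {r : ℕ}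
    (hb : ∀ x ∈ noiseDomain m, ∀ s, |F x s| ≤ K * noiseGauge m x ^ r * C s) :
    Integrable (fun ω => F (N ω) (ϑ ω)) P := by
  refine ((hN.integrable_gauge_mul hind hC hCi r).const_mul K).mono'
    (hF.aestronglyMeasurable hN hϑ) ?_
  filter_upwards [hN.ae_mem_noiseDomain m] with ω hω
  exact (hb _ hω _).trans_eq (by ring)

/-- Integration by parts in one exponential coordinate. -/
lemma IsAdapted.integral_mul_pderiv [IsProbabilityMeasure P] {m : ℕ} {F : Noise → S → ℝ} (hF : IsAdapted m F)
    (hN : IsDrivingNoise P N) {ϑ : Ω → S} (hϑ : Measurable ϑ)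
    (hind : IndepFun (fun ω => trunc m (N ω)) ϑ P) {C : S → ℝ} (hC : Measurable C)
    (hCi : Integrable (fun ω => C (ϑ ω)) P) {l : NoiseIdx} (hl : l ∈ expIdx m)
    (hd : ∀ x ∈ noiseDomain m, ∀ s, DifferentiableAt ℝ (fun t => F (upd x l t) s) (x l))
    {K : ℝ} {r : ℕ}
    (hb : ∀ x ∈ noiseDomain m, ∀ s, |F x s| ≤ K * noiseGauge m x ^ r * C s)
    (hb' : ∀ x ∈ noiseDomain m, ∀ s,
      |x l * StableIBP.pderiv l (fun y => F y s) x| ≤ K * noiseGauge m x ^ r * C s) :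
    ∫ ω, N ω l * StableIBP.pderiv l (fun y => F y (ϑ ω)) (N ω) ∂P
      = ∫ ω, (N ω l - 1) * F (N ω) (ϑ ω) ∂P := by
  have hl' := expIdx_subset m hl
  have a1 : IsAdapted m (fun x s => x l * StableIBP.pderiv l (fun y => F y s) x) :=
    (IsAdapted.coord hl').mul (hF.pderiv hl hd)
  have a2 : IsAdapted m (fun x s => (x l - 1) * F x s) := by
    simpa [sub_eq_add_neg] using ((IsAdapted.coord hl').add (IsAdapted.const m (-1))).mul hF
  have b2 : ∀ x ∈ noiseDomain m, ∀ s, |(x l - 1) * F x s| ≤ K * noiseGauge m x ^ (r + 1) * C s := by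
    intro x hx s
    rw [abs_mul]
    have h1 : |x l - 1| ≤ noiseGauge m x := by
      have := le_gauge hx hl
      have := one_le_gauge hx
      have := pos_of_mem_noiseDomain hx hl
      exact abs_le.2 ⟨by linarith, by linarith⟩
    calc _ ≤ noiseGauge m x * (K * noiseGauge m x ^ r * C s) :=
          mul_le_mul h1 (hb x hx s) (abs_nonneg _) (by linarith [one_le_gauge hx])
      _ = _ := by ring
  -- Joint measurability is available only on the domain, so the resampling formula is applied to
  -- the function extended by zero. Almost surely neither the noise nor its resampled version leaves
  -- the domain.
  have key : ∀ {G : Noise → S → ℝ} {r' : ℕ}, IsAdapted m G →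
      (∀ x ∈ noiseDomain m, ∀ s, |G x s| ≤ K * noiseGauge m x ^ r' * C s) →
      ∫ ω, G (N ω) (ϑ ω) ∂P = ∫ ω, ∫ t, G (upd (N ω) l t) (ϑ ω) ∂(expMeasure 1) ∂P := by
    intro G r' hG hGb
    have hi := hG.integrable hN hϑ hind hC hCi hGb
    have e : (fun ω => G (N ω) (ϑ ω)) =ᵐ[P] fun ω =>
        (noiseDomain m ×ˢ univ).indicator (fun p : Noise × S => G p.1 p.2) (N ω, ϑ ω) := by
      filter_upwards [hN.ae_mem_noiseDomain m] with ω hω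
      rw [indicator_of_mem (show (N ω, ϑ ω) ∈ noiseDomain m ×ˢ univ from ⟨hω, mem_univ _⟩)]
    rw [integral_congr_ae e, hN.integral_resample hϑ hind hl hG.meas _ (hi.congr e)]
    · refine integral_congr_ae ?_
      filter_upwards [hN.ae_mem_noiseDomain m] with ω hω
      refine integral_congr_ae ?_
      filter_upwards [ae_expMeasure_pos] with t ht
      rw [indicator_of_mem (show (upd (N ω) l t, ϑ ω) ∈ noiseDomain m ×ˢ univ from
        ⟨upd_mem_noiseDomain hω hl ht, mem_univ _⟩)]
    · intro x y s h
      by_cases hx : x ∈ noiseDomain m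
      · rw [indicator_of_mem (show (x, s) ∈ noiseDomain m ×ˢ univ from ⟨hx, mem_univ _⟩),
          indicator_of_mem (show (y, s) ∈ noiseDomain m ×ˢ univ from
            ⟨(noiseDomain_congr h).1 hx, mem_univ _⟩)]
        exact hG.dep x hx y s h
      · rw [indicator_of_notMem fun h => hx h.1,
          indicator_of_notMem fun h' => hx ((noiseDomain_congr h).2 h'.1)]
  rw [key a1 hb', key a2 b2]
  refine integral_congr_ae ?_
  filter_upwards [hN.ae_mem_noiseDomain m] with ω hω
  -- This difference is the constant `c` of the one-dimensional lemma: the gauge with the coordinate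
  -- `l` set to zero.
  have hc : 0 ≤ noiseGauge m (N ω) - N ω l := by linarith [le_gauge hω hl]
  have := integral_mul_deriv_expMeasure (F := fun t => F (upd (N ω) l t) (ϑ ω))
    (K := K * C (ϑ ω)) (r := r) hc
    (fun t ht => by simpa using hd _ (upd_mem_noiseDomain hω hl ht) (ϑ ω))
    (fun t ht => by
      have := hb _ (upd_mem_noiseDomain hω hl ht) (ϑ ω)
      rw [gauge_upd _ hl] at this
      exact this.trans_eq (by ring))
    (fun t ht => by
      have := hb' _ (upd_mem_noiseDomain hω hl ht) (ϑ ω)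
      rw [gauge_upd _ hl, pderiv_eq] at this
      simp only [upd_same, upd_upd] at this
      exact this.trans_eq (by ring))
  simpa only [pderiv_eq, upd_same, upd_upd] using this

end Adapted

/-! ### Calculus of functions with dominated partial derivatives, with constants independent of the
level. -/

section Regular

variable {S : Type*} [MeasurableSpace S] {m : ℕ} {C : S → ℝ}

/-- The function `ψ` is adapted and bounded by `K * noiseGauge m ^ r * C`. -/
def IsDominated (m : ℕ) (C : S → ℝ) (K : ℝ) (r : ℕ) (ψ : Noise → S → ℝ) : Prop :=
  IsAdapted m ψ ∧ ∀ x ∈ noiseDomain m, ∀ s, |ψ x s| ≤ K * noiseGauge m x ^ r * C s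

/-- The function `ψ` is partially differentiable up to order `k` in the exponential variables of
level `m`, and these derivatives are adapted and bounded by `K * noiseGauge m ^ r * C`. -/
def IsRegular (m : ℕ) (C : S → ℝ) (K : ℝ) (r : ℕ) : ℕ → (Noise → S → ℝ) → Prop
  | 0, ψ => IsDominated m C K r ψ
  | k + 1, ψ => IsDominated m C K r ψ ∧ ∀ l ∈ expIdx m,
      (∀ x ∈ noiseDomain m, ∀ s, DifferentiableAt ℝ (fun t => ψ (upd x l t) s) (x l)) ∧
        IsRegular m C K r k (fun x s => pderiv l (fun y => ψ y s) x)

lemma IsRegular.dominated {K : ℝ} {r k : ℕ} {ψ : Noise → S → ℝ} (h : IsRegular m C K r k ψ) :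
    IsDominated m C K r ψ := by
  cases k with
  | zero => exact h
  | succ k => exact h.1

lemma IsRegular.lower {K : ℝ} {r k : ℕ} {ψ : Noise → S → ℝ} (h : IsRegular m C K r (k + 1) ψ) :
    IsRegular m C K r k ψ := by
  induction k generalizing ψ with
  | zero => exact h.1
  | succ k ih => exact ⟨h.1, fun l hl => ⟨(h.2 l hl).1, ih (h.2 l hl).2⟩⟩

lemma IsRegular.of_add {K : ℝ} {r k : ℕ} (j : ℕ) {ψ : Noise → S → ℝ}
    (h : IsRegular m C K r (j + k) ψ) : IsRegular m C K r k ψ := by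
  induction j with
  | zero => rwa [zero_add] at h
  | succ j ih => exact ih (by rw [add_right_comm] at h; exact h.lower)

lemma IsDominated.congr {K : ℝ} {r : ℕ} {ψ ψ' : Noise → S → ℝ} (h : IsDominated m C K r ψ)
    (e : ∀ x ∈ noiseDomain m, ∀ s, ψ x s = ψ' x s) : IsDominated m C K r ψ' :=
  ⟨h.1.congr e, fun x hx s => by rw [← e x hx s]; exact h.2 x hx s⟩

lemma IsRegular.congr {K : ℝ} {r k : ℕ} {ψ ψ' : Noise → S → ℝ} (h : IsRegular m C K r k ψ)
    (e : ∀ x ∈ noiseDomain m, ∀ s, ψ x s = ψ' x s) : IsRegular m C K r k ψ' := by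
  induction k generalizing ψ ψ' with
  | zero => exact IsDominated.congr h e
  | succ k ih =>
    refine ⟨h.1.congr e, fun l hl => ⟨fun x hx s => ?_, ih (h.2 l hl).2 fun x hx s => ?_⟩⟩
    · refine ((h.2 l hl).1 x hx s).congr_of_eventuallyEq ?_
      exact (eventually_upd_mem hx hl).mono fun t ht => (e _ ht s).symm
    · exact pderiv_congr hx hl fun y hy => e y hy s

lemma IsRegular.mono (hC : ∀ s, 0 ≤ C s) {K K' : ℝ} {r r' k : ℕ} (hK : 0 ≤ K) (hKK : K ≤ K')
    (hr : r ≤ r') {ψ : Noise → S → ℝ} (h : IsRegular m C K r k ψ) : IsRegular m C K' r' k ψ := by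
  have hd : ∀ {ψ : Noise → S → ℝ}, IsDominated m C K r ψ → IsDominated m C K' r' ψ := fun h =>
    ⟨h.1, fun x hx s => (h.2 x hx s).trans (by
      have := one_le_gauge hx
      have := hC s
      gcongr
      linarith)⟩
  induction k generalizing ψ with
  | zero => exact hd h
  | succ k ih => exact ⟨hd h.1, fun l hl => ⟨(h.2 l hl).1, ih (h.2 l hl).2⟩⟩

lemma IsRegular.add {K K' : ℝ} {r k : ℕ} {ψ ψ' : Noise → S → ℝ} (h : IsRegular m C K r k ψ)
    (h' : IsRegular m C K' r k ψ') : IsRegular m C (K + K') r k (fun x s => ψ x s + ψ' x s) := by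
  have hd : ∀ {ψ ψ' : Noise → S → ℝ}, IsDominated m C K r ψ → IsDominated m C K' r ψ' →
      IsDominated m C (K + K') r (fun x s => ψ x s + ψ' x s) := fun h h' =>
    ⟨h.1.add h'.1, fun x hx s => (abs_add_le _ _).trans
      ((add_le_add (h.2 x hx s) (h'.2 x hx s)).trans_eq (by ring))⟩
  induction k generalizing ψ ψ' with
  | zero => exact hd h h'
  | succ k ih =>
    refine ⟨hd h.1 h'.1, fun l hl => ⟨fun x hx s =>
      ((h.2 l hl).1 x hx s).add ((h'.2 l hl).1 x hx s),
      (ih (h.2 l hl).2 (h'.2 l hl).2).congr fun x hx s => ?_⟩⟩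
    simp only [pderiv_eq]
    exact (deriv_fun_add ((h.2 l hl).1 x hx s) ((h'.2 l hl).1 x hx s)).symm

lemma IsRegular.const_mul {K : ℝ} {r k : ℕ} {ψ : Noise → S → ℝ} (h : IsRegular m C K r k ψ)
    (c : ℝ) : IsRegular m C (|c| * K) r k (fun x s => c * ψ x s) := by
  have hd : ∀ {ψ : Noise → S → ℝ}, IsDominated m C K r ψ →
      IsDominated m C (|c| * K) r (fun x s => c * ψ x s) := fun h =>
    ⟨(IsAdapted.const m c).mul h.1, fun x hx s => by
      rw [abs_mul]
      exact (mul_le_mul_of_nonneg_left (h.2 x hx s) (abs_nonneg c)).trans_eq (by ring)⟩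
  induction k generalizing ψ with
  | zero => exact hd h
  | succ k ih =>
    refine ⟨hd h.1, fun l hl => ⟨fun x hx s => ((h.2 l hl).1 x hx s).const_mul c,
      (ih (h.2 l hl).2).congr fun x hx s => ?_⟩⟩
    simp only [pderiv_eq]
    exact (deriv_const_mul c ((h.2 l hl).1 x hx s)).symm

/-- By the Leibniz rule each derivative splits the product into two products, hence the factor `2 ^
k`. One factor carries the parameter bound `1`, so that `C` occurs only to the first power and only
its mean is ever needed. -/
lemma IsRegular.mul (hC : ∀ s, 0 ≤ C s) {K K' : ℝ} (hK : 0 ≤ K) (hK' : 0 ≤ K') {r r' k : ℕ}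
    {ζ ψ : Noise → S → ℝ} (h' : IsRegular m (fun _ => 1) K' r' k ζ) (h : IsRegular m C K r k ψ) :
    IsRegular m C (2 ^ k * K' * K) (r + r') k (fun x s => ζ x s * ψ x s) := by
  have hd : ∀ {ζ ψ : Noise → S → ℝ} (k : ℕ), IsDominated m C K r ψ →
      IsDominated m (fun _ => 1) K' r' ζ →
      IsDominated m C (2 ^ k * K' * K) (r + r') (fun x s => ζ x s * ψ x s) := by
    intro ζ ψ k h h'
    refine ⟨h'.1.mul h.1, fun x hx s => ?_⟩
    have hg := one_le_gauge hx
    have h1 := h.2 x hx s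
    have h2 := h'.2 x hx s
    have h3 := hC s
    rw [abs_mul]
    calc |ζ x s| * |ψ x s| ≤ (K' * noiseGauge m x ^ r' * 1) * (K * noiseGauge m x ^ r * C s) := by
          gcongr
      _ = 1 * (K' * K * noiseGauge m x ^ (r + r') * C s) := by ring
      _ ≤ 2 ^ k * (K' * K * noiseGauge m x ^ (r + r') * C s) := by
          gcongr
          exact one_le_pow₀ (by norm_num)
      _ = _ := by ring
  induction k generalizing ζ ψ with
  | zero => exact hd 0 h h'
  | succ k ih =>
    refine ⟨hd _ h.1 h'.1, fun l hl => ⟨fun x hx s =>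
      ((h'.2 l hl).1 x hx s).mul ((h.2 l hl).1 x hx s), ?_⟩⟩
    have h1 := ih (h'.2 l hl).2 h.lower
    have h2 := ih h'.lower (h.2 l hl).2
    have h3 := h1.add h2
    rw [show (2 : ℝ) ^ (k + 1) * K' * K = 2 ^ k * K' * K + 2 ^ k * K' * K by ring]
    refine h3.congr fun x hx s => ?_
    simp only [pderiv_eq]
    have := deriv_fun_mul ((h'.2 l hl).1 x hx s) ((h.2 l hl).1 x hx s)
    simp only [upd_self] at this
    exact this.symm

/-- The `m + 2` summands are paid for by one more power of the gauge, which is at least `m + 2`. In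
this way the constant `K` stays free of `m`. -/
lemma IsRegular.sum (hC : ∀ s, 0 ≤ C s) {K : ℝ} (hK : 0 ≤ K) {r k : ℕ}
    {ψ : NoiseIdx → Noise → S → ℝ} (h : ∀ i ∈ expIdx m, IsRegular m C K r k (ψ i)) :
    IsRegular m C K (r + 1) k (fun x s => ∑ i ∈ expIdx m, ψ i x s) := by
  have hd : ∀ {ψ : NoiseIdx → Noise → S → ℝ}, (∀ i ∈ expIdx m, IsDominated m C K r (ψ i)) →
      IsDominated m C K (r + 1) (fun x s => ∑ i ∈ expIdx m, ψ i x s) := by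
    intro ψ h
    refine ⟨IsAdapted.sum fun i hi => (h i hi).1, fun x hx s => ?_⟩
    have hg := one_le_gauge hx
    have h3 := hC s
    calc _ ≤ ∑ i ∈ expIdx m, |ψ i x s| := Finset.abs_sum_le_sum_abs _ _
      _ ≤ ∑ i ∈ expIdx m, K * noiseGauge m x ^ r * C s := Finset.sum_le_sum fun i hi => (h i hi).2 x hx s
      _ = ((m : ℝ) + 2) * (K * noiseGauge m x ^ r * C s) := by simp [card_expIdx]
      _ ≤ noiseGauge m x * (K * noiseGauge m x ^ r * C s) := by
          gcongr
          exact card_le_gauge hx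
      _ = _ := by ring
  induction k generalizing ψ with
  | zero => exact hd h
  | succ k ih =>
    refine ⟨hd fun i hi => (h i hi).1, fun l hl => ⟨fun x hx s =>
      DifferentiableAt.fun_sum fun i hi => ((h i hi).2 l hl).1 x hx s, ?_⟩⟩
    refine (ih fun i hi => ((h i hi).2 l hl).2).congr fun x hx s => ?_
    simp only [pderiv_eq]
    exact (deriv_fun_sum fun i hi => ((h i hi).2 l hl).1 x hx s).symm

lemma IsRegular.const {c K : ℝ} (hc : |c| ≤ K) (k : ℕ) :
    IsRegular m (fun _ : S => 1) K 0 k (fun _ _ => c) := by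
  induction k generalizing c with
  | zero => exact ⟨IsAdapted.const m c, fun x _ s => by simpa using hc⟩
  | succ k ih =>
    refine ⟨⟨IsAdapted.const m c, fun x _ s => by simpa using hc⟩, fun l hl =>
      ⟨fun x hx s => by simp, ?_⟩⟩
    refine (ih (c := 0) (by simpa using (abs_nonneg c).trans hc)).congr fun x hx s => ?_
    simp [pderiv_eq]

/-- For the sign indicators: discontinuous as functions of the `V i`, but constant in the
exponential variables, the only ones differentiated. -/
lemma IsRegular.of_upd_eq {K : ℝ} {ψ : Noise → S → ℝ} (hψ : IsDominated m (fun _ => 1) K 0 ψ)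
    (hK : 0 ≤ K) (hu : ∀ l ∈ expIdx m, ∀ x t s, ψ (upd x l t) s = ψ x s) (k : ℕ) :
    IsRegular m (fun _ => 1) K 0 k ψ := by
  cases k with
  | zero => exact hψ
  | succ k =>
    refine ⟨hψ, fun l hl => ⟨fun x hx s => by simp [hu l hl], ?_⟩⟩
    refine (IsRegular.const (c := 0) (by simpa) k).congr fun x hx s => ?_
    simp [pderiv_eq, hu l hl]

lemma IsRegular.coord {l : NoiseIdx} (hl : l ∈ expIdx m) (k : ℕ) :
    IsRegular m (fun _ : S => 1) 1 1 k (fun x _ => x l) := by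
  have hd : IsDominated m (fun _ : S => 1) 1 1 (fun x _ => x l) :=
    ⟨IsAdapted.coord (expIdx_subset m hl), fun x hx s => by
      simpa [abs_of_pos (pos_of_mem_noiseDomain hx hl)] using le_gauge hx hl⟩
  cases k with
  | zero => exact hd
  | succ k =>
    refine ⟨hd, fun l' hl' => ?_⟩
    by_cases h : l = l'
    · subst h
      refine ⟨fun x hx s => by simp, ?_⟩
      refine ((IsRegular.const (c := 1) (K := 1) (by simp) k).mono (by simp) zero_le_one le_rfl
        zero_le_one).congr fun x hx s => ?_
      simp [pderiv_eq]
    · refine ⟨fun x hx s => by simp [upd_of_ne _ h], ?_⟩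
      refine ((IsRegular.const (c := 0) (K := 1) (by simp) k).mono (by simp) zero_le_one le_rfl
        zero_le_one).congr fun x hx s => ?_
      simp [pderiv_eq, upd_of_ne _ h]

end Regular

/-! ### The weight operators without the factor `1 / X_±`. -/

section Weights

variable {S : Type*} [MeasurableSpace S] {m : ℕ} {C : S → ℝ} (α ρ : ℝ)

/-- The indicator attached to the exponential variable `l` in the operator `opD`. -/
def lineInd (σ : PM) (x : Noise) : NoiseIdx → ℝ
  | .E i => sgnInd α ρ σ x i
  | .eta σ' => open Classical in if σ' = σ then 1 else 0
  | _ => 0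

lemma opD_eq (m : ℕ) (σ : PM) (ψ : Noise → ℝ) (x : Noise) :
    opD α ρ m σ ψ x = ∑ l ∈ expIdx m, x l * lineInd α ρ σ x l * pderiv l ψ x := by
  rw [sum_expIdx, opD]
  cases σ <;> simp [lineInd]

lemma lineInd_mem (σ : PM) (x : Noise) (l : NoiseIdx) :
    lineInd α ρ σ x l = 0 ∨ lineInd α ρ σ x l = 1 := by
  rcases l with i | i | i | σ'
  · by_cases h : 0 < part σ (angular α ρ x i) <;> simp [lineInd, sgnInd, h]
  · simp [lineInd]
  · simp [lineInd]
  · by_cases h : σ' = σ <;> simp [lineInd, h]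

lemma abs_lineInd_le (σ : PM) (x : Noise) (l : NoiseIdx) : |lineInd α ρ σ x l| ≤ 1 := by
  rcases lineInd_mem α ρ σ x l with h | h <;> simp [h]

lemma measurable_cms : Measurable (cms α ρ) := by
  unfold cms; fun_prop

lemma measurable_part (σ : PM) : Measurable (part σ) := by
  cases σ
  · exact measurable_id.max measurable_const
  · exact measurable_neg.max measurable_const

lemma measurable_lineInd (σ : PM) (l : NoiseIdx) : Measurable fun x => lineInd α ρ σ x l := by
  classical
  rcases l with i | i | i | σ'
  · simp only [lineInd, sgnInd]
    refine Measurable.ite (measurableSet_lt measurable_const ?_) measurable_const measurable_const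
    exact (measurable_part σ).comp ((measurable_cms α ρ).comp (measurable_pi_apply _))
  · exact measurable_const
  · exact measurable_const
  · exact measurable_const

lemma lineInd_upd (σ : PM) (x : Noise) {l : NoiseIdx} (hl : l ∈ expIdx m) (t : ℝ)
    (l' : NoiseIdx) : lineInd α ρ σ (upd x l t) l' = lineInd α ρ σ x l' := by
  rcases l' with i | i | i | σ'
  · have : angular α ρ (upd x l t) i = angular α ρ x i := by
      rw [angular, angular, upd_of_ne _ (by rintro rfl; simp at hl)]
    simp only [lineInd, sgnInd, this]
  · rfl
  · rfl
  · rfl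

lemma isRegular_lineInd (σ : PM) {l : NoiseIdx} (hl : l ∈ expIdx m) (k : ℕ) :
    IsRegular m (fun _ : S => 1) 1 0 k (fun x _ => lineInd α ρ σ x l) := by
  refine IsRegular.of_upd_eq ⟨IsAdapted.of_measurable
    ((measurable_lineInd α ρ σ l).comp measurable_fst) fun x _ y s h => ?_, fun x _ s => ?_⟩
    zero_le_one (fun l' hl' x t s => lineInd_upd α ρ σ x hl' t l) k
  · rcases l with i | i | i | σ'
    · have : angular α ρ x i = angular α ρ y i := by
        rw [angular, angular, h (.V i) (by simpa using hl)]
      simp only [lineInd, sgnInd, this]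
    · rfl
    · rfl
    · rfl
  · simpa using abs_lineInd_le α ρ σ x l

/-- One power of the gauge pays for the coordinate in front of the derivative and one for the sum.
The factor `4 ^ k` comes from two applications of the product rule, and one derivative is lost. -/
lemma isRegular_opD (hC : ∀ s, 0 ≤ C s) {K : ℝ} (hK : 0 ≤ K) {r k : ℕ} {ψ : Noise → S → ℝ}
    (h : IsRegular m C K r (k + 1) ψ) (σ : PM) :
    IsRegular m C (4 ^ k * K) (r + 2) k (fun x s => opD α ρ m σ (fun y => ψ y s) x) := by
  simp only [opD_eq]
  refine IsRegular.sum (r := r + 1) hC (by positivity) fun l hl => ?_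
  have h1 := IsRegular.mul (S := S) (m := m) (fun _ => zero_le_one) zero_le_one zero_le_one
    (IsRegular.coord hl k) (isRegular_lineInd α ρ σ hl k)
  have h2 := IsRegular.mul hC hK (by positivity) h1 (h.2 l hl).2
  rw [show (4 : ℝ) ^ k * K = 2 ^ k * (2 ^ k * 1 * 1) * K by
    rw [show (4 : ℝ) = 2 * 2 by norm_num, mul_pow]; ring]
  simpa using h2

/-- The first-order multiplier `η_± - 1/α + ∑ (E_i - 1) 1_{[G_i]^± > 0}` of `opH`. -/
def multiplier (m : ℕ) (σ : PM) (x : Noise) : ℝ :=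
  x (.eta σ) - 1 / α + ∑ i ∈ Finset.range m, (x (.E i) - 1) * sgnInd α ρ σ x i

/-- The sum is what integration by parts produces. The leftover `1 - 1/α` compensates for
differentiating the factor `1 / X_σ` by which the test function is divided. -/
lemma multiplier_eq (m : ℕ) (σ : PM) (x : Noise) :
    multiplier α ρ m σ x = (1 - 1 / α) + ∑ l ∈ expIdx m, (x l - 1) * lineInd α ρ σ x l := by
  rw [sum_expIdx, multiplier]
  cases σ <;> simp [lineInd] <;> ring

/-- The weight operator `opH` stripped of the factor `1 / X_±`, acting on the coefficient of
`X_± ^ (-j)`. -/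
def coreH (m : ℕ) (σ : PM) (j : ℕ) (ψ : Noise → ℝ) (x : Noise) : ℝ :=
  α / (α - 1) * ((multiplier α ρ m σ x + j * (1 - 1 / α)) * ψ x - opD α ρ m σ ψ x)

/-- The growth constant of `coreH`. -/
def coreConst (α : ℝ) (k j : ℕ) : ℝ :=
  |α / (α - 1)| * (2 ^ k * (2 ^ k * 2 + |(1 - 1 / α) + j * (1 - 1 / α)|) + 4 ^ k)

lemma coreConst_nonneg (k j : ℕ) : 0 ≤ coreConst α k j := by unfold coreConst; positivity

/-- Each application costs one derivative and two powers of the gauge, with a constant depending on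
`α`, `k` and `j` but not on `m`. The bound on the level differences rests on this uniformity. -/
lemma isRegular_coreH (hC : ∀ s, 0 ≤ C s) {K : ℝ} (hK : 0 ≤ K) {r k : ℕ} {ψ : Noise → S → ℝ}
    (h : IsRegular m C K r (k + 1) ψ) (σ : PM) (j : ℕ) :
    IsRegular m C (coreConst α k j * K) (r + 2) k
      (fun x s => coreH α ρ m σ j (fun y => ψ y s) x) := by
  set b := (1 - 1 / α) + j * (1 - 1 / α) with hb
  have h1 : ∀ l ∈ expIdx m, IsRegular m (fun _ : S => 1) (2 ^ k * 2 * 1) (0 + 1) k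
      (fun x _ => (x l + (-1)) * lineInd α ρ σ x l) := fun l hl =>
    IsRegular.mul (fun _ => zero_le_one) zero_le_one zero_le_two
      (by
        have := (IsRegular.coord (S := S) hl k).add ((IsRegular.const (m := m) (S := S)
          (c := -1) (K := 1) (by simp) k).mono (by simp) zero_le_one le_rfl zero_le_one)
        rwa [one_add_one_eq_two] at this)
      (isRegular_lineInd α ρ σ hl k)
  have h2 := (IsRegular.sum (fun _ => zero_le_one) (by positivity) h1).add
    ((IsRegular.const (m := m) (S := S) (c := b) le_rfl k).mono (by simp) (abs_nonneg b) le_rfl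
      (zero_le_two))
  have h3 := IsRegular.mul hC hK (by positivity) h2 h.lower
  have h4 := (isRegular_opD α ρ hC hK h σ).const_mul (-1)
  have h5 := (h3.add h4).const_mul (α / (α - 1))
  rw [abs_neg, abs_one, one_mul] at h5
  rw [show coreConst α k j * K = |α / (α - 1)| *
    (2 ^ k * (2 ^ k * 2 * 1 + |b|) * K + 4 ^ k * K) by rw [coreConst, ← hb]; ring]
  refine h5.congr fun x hx s => ?_
  rw [coreH, multiplier_eq, hb]
  simp only [← sub_eq_add_neg]
  ring

end Weights

/-! ### Smooth representations are regular. -/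

section Representation

variable {S : Type*} [MeasurableSpace S] {m : ℕ} {C : S → ℝ}

/-- The direction in `Coord m` of the variable `l`. -/
def coordDir (m : ℕ) (l : NoiseIdx) : Coord m := trunc m (upd 0 l 1)

lemma trunc_upd (x : Noise) (l : NoiseIdx) (t : ℝ) :
    trunc m (upd x l t) = trunc m x + (t - x l) • coordDir m l := by
  have : ∀ k, upd x l t k = x k + (t - x l) * upd 0 l 1 k := by
    intro k
    by_cases h : k = l
    · subst h; simp
    · simp [upd_of_ne _ h]
  simp only [coordDir, trunc, this]
  rfl

lemma norm_coordDir_le (l : NoiseIdx) : ‖coordDir m l‖ ≤ 1 := by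
  have h : ∀ k, ‖upd 0 l 1 k‖ ≤ 1 := by
    intro k
    by_cases h : k = l
    · subst h; simp
    · simp [upd_of_ne _ h]
  simp only [coordDir, trunc, norm_prod_le_iff, pi_norm_le_iff_of_nonneg zero_le_one]
  exact ⟨fun i => h _, fun i => h _, fun i => h _, h _, h _⟩

lemma isAdapted_rep [TopologicalSpace S] [OpensMeasurableSpace S] {φ : Coord m → S → ℝ}
    (hφ : ContinuousOn (fun p : Coord m × S => φ p.1 p.2) (coordDomain m ×ˢ univ)) :
    IsAdapted m (fun x s => φ (trunc m x) s) where
  meas := by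
    have hm : MeasurableSet (coordDomain m ×ˢ (univ : Set S)) :=
      (isOpen_coordDomain m).measurableSet.prod MeasurableSet.univ
    have h1 : Measurable ((coordDomain m ×ˢ univ).indicator
        fun p : Coord m × S => φ p.1 p.2) := by
      classical
      have h := ContinuousOn.measurable_piecewise (g := 0) hφ continuousOn_const hm
      rwa [piecewise_eq_indicator] at h
    exact h1.comp (((measurable_trunc m).comp measurable_fst).prodMk measurable_snd)
  dep x _ y s h := by rw [trunc_congr h]

/-- A partial derivative of the `j`-th derivative evaluated at `j` vectors is the next derivative
with one more vector in front. All these vectors have norm at most one, so `C` bounds every partial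
derivative. The order `j` and the vectors must vary for the induction on `k`. -/
lemma isRegular_iteratedFDeriv {φ : Coord m → S → ℝ}
    (hφ : ∀ s, ContDiffOn ℝ (⊤ : ℕ∞) (fun c => φ c s) (coordDomain m)) (k : ℕ) :
    ∀ (j : ℕ) (v : Fin j → Coord m), (∀ i, ‖v i‖ ≤ 1) →
      (∀ i ≤ j + k, ∀ c ∈ coordDomain m, ∀ s,
        ‖iteratedFDeriv ℝ i (fun c' => φ c' s) c‖ ≤ C s) →
      IsAdapted m (fun x s => iteratedFDeriv ℝ j (fun c' => φ c' s) (trunc m x) v) →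
      IsRegular m C 1 0 k (fun x s => iteratedFDeriv ℝ j (fun c' => φ c' s) (trunc m x) v) := by
  have hd : ∀ (k j : ℕ) (v : Fin j → Coord m), (∀ i, ‖v i‖ ≤ 1) →
      (∀ i ≤ j + k, ∀ c ∈ coordDomain m, ∀ s,
        ‖iteratedFDeriv ℝ i (fun c' => φ c' s) c‖ ≤ C s) →
      IsAdapted m (fun x s => iteratedFDeriv ℝ j (fun c' => φ c' s) (trunc m x) v) →
      IsDominated m C 1 0
        (fun x s => iteratedFDeriv ℝ j (fun c' => φ c' s) (trunc m x) v) := by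
    intro k j v hv hb ha
    refine ⟨ha, fun x hx s => ?_⟩
    have h1 := ContinuousMultilinearMap.le_opNorm
      (iteratedFDeriv ℝ j (fun c' => φ c' s) (trunc m x)) v
    have h2 : ∏ i, ‖v i‖ ≤ 1 := Finset.prod_le_one (fun i _ => norm_nonneg _) fun i _ => hv i
    have h3 := hb j (by omega) _ hx s
    rw [Real.norm_eq_abs] at h1
    refine h1.trans ((mul_le_of_le_one_right (norm_nonneg _) h2).trans ?_)
    simpa using h3
  induction k with
  | zero => exact hd 0
  | succ k ih =>
    intro j v hv hb ha
    refine ⟨hd _ j v hv hb ha, fun l hl => ?_⟩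
    have key : ∀ x ∈ noiseDomain m, ∀ s, HasDerivAt
        (fun t => iteratedFDeriv ℝ j (fun c' => φ c' s) (trunc m (upd x l t)) v)
        (iteratedFDeriv ℝ (j + 1) (fun c' => φ c' s) (trunc m x)
          (Fin.cons (coordDir m l) v)) (x l) := by
      intro x hx s
      have h1 : DifferentiableAt ℝ (iteratedFDeriv ℝ j (fun c' => φ c' s)) (trunc m x) :=
        ((hφ s).contDiffAt ((isOpen_coordDomain m).mem_nhds hx)).differentiableAt_iteratedFDeriv
          (by exact_mod_cast ENat.natCast_lt_top j)
      have h2 : HasDerivAt (fun t => trunc m (upd x l t)) (coordDir m l) (x l) := by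
        simp only [trunc_upd]
        have := (((hasDerivAt_id (x l)).sub_const (x l)).smul_const (coordDir m l)).const_add
          (trunc m x)
        simpa using this
      have h1' : HasFDerivAt (iteratedFDeriv ℝ j (fun c' => φ c' s))
        (fderiv ℝ (iteratedFDeriv ℝ j (fun c' => φ c' s)) (trunc m x))
        (trunc m (upd x l (x l))) := by rw [upd_self]; exact h1.hasFDerivAt
      have h3 := h1'.comp_hasDerivAt (x l) h2
      have h4 := ((ContinuousMultilinearMap.apply ℝ (fun _ : Fin j => Coord m) ℝ
        v).hasFDerivAt).comp_hasDerivAt (x l) h3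
      refine h4.congr_deriv ?_
      rw [iteratedFDeriv_succ_apply_left]
      rfl
    have hdiff := fun x hx s => (key x hx s).differentiableAt
    refine ⟨hdiff, ?_⟩
    have hc : ∀ x ∈ noiseDomain m, ∀ s, pderiv l
        (fun y => iteratedFDeriv ℝ j (fun c' => φ c' s) (trunc m y) v) x
        = iteratedFDeriv ℝ (j + 1) (fun c' => φ c' s) (trunc m x)
          (Fin.cons (coordDir m l) v) := fun x hx s => (key x hx s).deriv
    refine (ih (j + 1) (Fin.cons (coordDir m l) v) ?_ ?_ ?_).congr
      fun x hx s => (hc x hx s).symm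
    · intro i
      refine Fin.cases ?_ (fun i => ?_) i
      · simpa using norm_coordDir_le l
      · simpa using hv i
    · intro i hi; exact hb i (by omega)
    · exact (ha.pderiv hl hdiff).congr hc

lemma isRegular_rep [TopologicalSpace S] [OpensMeasurableSpace S] {φ : Coord m → S → ℝ}
    (hφ : ContinuousOn (fun p : Coord m × S => φ p.1 p.2) (coordDomain m ×ˢ univ))
    (hφ' : ∀ s, ContDiffOn ℝ (⊤ : ℕ∞) (fun c => φ c s) (coordDomain m)) (k : ℕ)
    (hb : ∀ i ≤ k, ∀ c ∈ coordDomain m, ∀ s,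
      ‖iteratedFDeriv ℝ i (fun c' => φ c' s) c‖ ≤ C s) :
    IsRegular m C 1 0 k (fun x s => φ (trunc m x) s) := by
  have h := isRegular_iteratedFDeriv (C := C) hφ' k 0 (fun _ => 0) (by simp) (by simpa using hb)
    (by simpa using isAdapted_rep hφ)
  simpa using h

end Representation

/-! ### The Euler identity for `approxX`, and iterates of the weights. -/

section Approximation

variable {α ρ T κ : ℝ} {n m : ℕ}

lemma part_nonneg (σ : PM) (y : ℝ) : 0 ≤ part σ y := by
  cases σ <;> exact le_max_right _ _

lemma part_mul (σ : PM) {a : ℝ} (ha : 0 ≤ a) (y : ℝ) : part σ (a * y) = a * part σ y := by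
  cases σ
  · simp only [part, mul_max_of_nonneg _ _ ha, mul_zero]
  · simp only [part, mul_max_of_nonneg _ _ ha, mul_zero, mul_neg]

variable (α ρ T κ n) in
/-- The contribution of the exponential variable `l` to `approxX`. -/
def lineTerm (σ : PM) (x : Noise) : NoiseIdx → ℝ
  | .E i => if i < n then jumpTerm α ρ T σ x i else 0
  | .eta σ' => open Classical in
      if σ' = σ then T ^ (1 / α) * κ ^ n * x (.eta σ') ^ (1 - 1 / α) else 0
  | _ => 0

lemma approxX_eq_sum (hnm : n ≤ m) (σ : PM) (x : Noise) :
    approxX α ρ T κ n σ x = ∑ l ∈ expIdx m, lineTerm α ρ T κ n σ x l := by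
  have h : ∑ i ∈ Finset.range m, lineTerm α ρ T κ n σ x (.E i)
      = ∑ i ∈ Finset.range n, jumpTerm α ρ T σ x i := by
    simp only [lineTerm]
    rw [← Finset.sum_filter]
    congr 1
    ext i; simp; omega
  rw [sum_expIdx, h, approxX]
  cases σ <;> simp [lineTerm] <;> ring

lemma stick_nonneg (hT : 0 < T) {x : Noise} (hx : x ∈ noiseDomain m) {i : ℕ} (hi : i < m) :
    0 ≤ stick T x i := by
  have h := (mem_noiseDomain_iff.1 hx).2.1
  have h1 := (h i hi).2
  refine mul_nonneg (mul_nonneg hT.le (by linarith)) (Finset.prod_nonneg fun j hj => ?_)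
  exact (h j ((Finset.mem_range.1 hj).trans hi)).1.le

lemma jumpTerm_nonneg (hT : 0 < T) {x : Noise} (hx : x ∈ noiseDomain m) {i : ℕ} (hi : i < m)
    (σ : PM) : 0 ≤ jumpTerm α ρ T σ x i :=
  mul_nonneg (Real.rpow_nonneg (stick_nonneg hT hx hi) _) (part_nonneg _ _)

lemma lineTerm_nonneg (hT : 0 < T) (hκ : 0 < κ) {x : Noise} (hx : x ∈ noiseDomain m) {l : NoiseIdx}
    (hl : l ∈ expIdx m) (σ : PM) : 0 ≤ lineTerm α ρ T κ n σ x l := by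
  rcases l with i | i | i | σ'
  · simp only [lineTerm]
    split_ifs
    · exact jumpTerm_nonneg hT hx (by simpa using hl) σ
    · exact le_rfl
  · exact le_rfl
  · exact le_rfl
  · have := pos_of_mem_noiseDomain hx hl
    simp only [lineTerm]
    split_ifs
    · positivity
    · exact le_rfl

lemma lineTerm_le_approxX (hT : 0 < T) (hκ : 0 < κ) (hnm : n ≤ m) {x : Noise}
    (hx : x ∈ noiseDomain m) {l : NoiseIdx} (hl : l ∈ expIdx m) (σ : PM) :
    lineTerm α ρ T κ n σ x l ≤ approxX α ρ T κ n σ x := by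
  rw [approxX_eq_sum hnm]
  exact Finset.single_le_sum (fun l hl => lineTerm_nonneg hT hκ hx hl σ) hl

lemma approxX_pos (hT : 0 < T) (hκ : 0 < κ) (hnm : n ≤ m) {x : Noise} (hx : x ∈ noiseDomain m)
    (σ : PM) : 0 < approxX α ρ T κ n σ x := by
  refine lt_of_lt_of_le ?_ (lineTerm_le_approxX hT hκ hnm hx (l := .eta σ) (by simp) σ)
  have := pos_of_mem_noiseDomain hx (l := .eta σ) (by simp)
  simp only [lineTerm, if_true]
  positivity

lemma lineTerm_upd_of_ne (σ : PM) (x : Noise) {l l' : NoiseIdx} (hl : l ∈ expIdx m) (h : l' ≠ l)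
    (t : ℝ) : lineTerm α ρ T κ n σ (upd x l t) l' = lineTerm α ρ T κ n σ x l' := by
  have hU : ∀ i, upd x l t (.U i) = x (.U i) :=
    fun i => upd_of_ne _ (by rintro rfl; simp at hl) _
  have hV : ∀ i, upd x l t (.V i) = x (.V i) :=
    fun i => upd_of_ne _ (by rintro rfl; simp at hl) _
  rcases l' with i | i | i | σ'
  · simp only [lineTerm, jumpTerm, stick, stable, angular, hU, hV, upd_of_ne x h]
  · rfl
  · rfl
  · simp only [lineTerm, upd_of_ne x h]

/-- The stick lengths and the angular factor contain no exponential variable, and a positive factor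
passes through the positive and negative parts. This homogeneity is the source of the Euler
identity. -/
lemma lineTerm_homogeneous (σ : PM) (x : Noise) {l : NoiseIdx} (hl : l ∈ expIdx m) :
    ∃ c, ∀ t, 0 < t → lineTerm α ρ T κ n σ (upd x l t) l = c * t ^ (1 - 1 / α) := by
  have hU : ∀ t i, upd x l t (.U i) = x (.U i) :=
    fun t i => upd_of_ne _ (by rintro rfl; simp at hl) _
  have hV : ∀ t i, upd x l t (.V i) = x (.V i) :=
    fun t i => upd_of_ne _ (by rintro rfl; simp at hl) _
  rcases l with i | i | i | σ'
  · refine ⟨if i < n then stick T x i ^ (1 / α) * part σ (angular α ρ x i) else 0, fun t ht => ?_⟩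
    simp only [lineTerm, jumpTerm, stick, stable, angular, hU, hV, upd_same]
    rw [part_mul σ (Real.rpow_nonneg ht.le _)]
    split_ifs <;> ring
  · exact ⟨0, fun t _ => by simp [lineTerm]⟩
  · exact ⟨0, fun t _ => by simp [lineTerm]⟩
  · classical
    refine ⟨if σ' = σ then T ^ (1 / α) * κ ^ n else 0, fun t ht => ?_⟩
    simp only [lineTerm, upd_same]
    split_ifs <;> simp

lemma hasDerivAt_approxX (hnm : n ≤ m) {x : Noise} (hx : x ∈ noiseDomain m) {l : NoiseIdx}
    (hl : l ∈ expIdx m) (σ : PM) :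
    HasDerivAt (fun t => approxX α ρ T κ n σ (upd x l t))
      ((1 - 1 / α) * lineTerm α ρ T κ n σ x l / x l) (x l) := by
  classical
  simp only [approxX_eq_sum hnm]
  have hpos := pos_of_mem_noiseDomain hx hl
  have h : ∀ l' ∈ expIdx m, HasDerivAt (fun t => lineTerm α ρ T κ n σ (upd x l t) l')
      (if l' = l then (1 - 1 / α) * lineTerm α ρ T κ n σ x l / x l else 0) (x l) := by
    intro l' _
    by_cases h : l' = l
    · subst h
      rw [if_pos rfl]
      obtain ⟨c, hc⟩ := lineTerm_homogeneous (α := α) (ρ := ρ) (T := T) (κ := κ) (n := n) σ x hl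
      have h1 := (Real.hasDerivAt_rpow_const (x := x l') (p := 1 - 1 / α)
        (Or.inl hpos.ne')).const_mul c
      refine (h1.congr_of_eventuallyEq ?_).congr_deriv ?_
      · exact (lt_mem_nhds hpos).mono fun t ht => hc t ht
      · have h2 := hc _ hpos
        rw [upd_self] at h2
        rw [h2, Real.rpow_sub_one hpos.ne']
        field_simp
    · rw [if_neg h]
      simp only [lineTerm_upd_of_ne σ x hl h]
      exact hasDerivAt_const _ _
  have := HasDerivAt.fun_sum h
  simpa [hl] using this

/-- The indicator in the operator loses nothing: where it vanishes, so does the term. -/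
lemma lineInd_mul_lineTerm {x : Noise} (hx : x ∈ noiseDomain m)
    {l : NoiseIdx} (hl : l ∈ expIdx m) (σ : PM) :
    lineInd α ρ σ x l * lineTerm α ρ T κ n σ x l = lineTerm α ρ T κ n σ x l := by
  rcases l with i | i | i | σ'
  · have hE := pos_of_mem_noiseDomain hx hl
    simp only [lineInd, lineTerm, sgnInd, jumpTerm, stable]
    rw [part_mul σ (Real.rpow_nonneg hE.le _)]
    by_cases h : 0 < part σ (angular α ρ x i)
    · simp [h]
    · rw [le_antisymm (not_lt.1 h) (part_nonneg _ _)]; simp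
  · simp [lineTerm]
  · simp [lineTerm]
  · by_cases h : σ' = σ <;> simp [lineInd, lineTerm, h]

/-- The positive and negative parts of `G` cannot both be nonzero, and each `eta` serves one sign.
Hence the operator of one sign does not see the other component of `χ_n`. -/
lemma lineInd_mul_lineTerm_of_ne {x : Noise} (hx : x ∈ noiseDomain m)
    {l : NoiseIdx} (hl : l ∈ expIdx m) {σ τ : PM} (hστ : σ ≠ τ) :
    lineInd α ρ σ x l * lineTerm α ρ T κ n τ x l = 0 := by
  rcases l with i | i | i | σ'
  · have hE := pos_of_mem_noiseDomain hx hl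
    simp only [lineInd, lineTerm, sgnInd, jumpTerm, stable]
    rw [part_mul τ (Real.rpow_nonneg hE.le _)]
    by_cases h : 0 < part σ (angular α ρ x i)
    · have : part τ (angular α ρ x i) = 0 := by
        cases σ <;> cases τ <;> simp_all [part] <;> linarith
      simp [this]
    · simp [h]
  · simp [lineTerm]
  · simp [lineTerm]
  · by_cases h : σ' = σ
    · simp [lineInd, lineTerm, h, hστ]
    · simp [lineInd, h]

/-- The coordinate of sign `σ` of a point of the plane. -/
def comp : PM → ℝ × ℝ → ℝ
  | .plus, p => p.1
  | .minus, p => p.2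

/-- The unit vector of sign `σ`. -/
def dir : PM → ℝ × ℝ
  | .plus => (1, 0)
  | .minus => (0, 1)

/-- The partial derivative of sign `σ` of a function on the plane. -/
def pd (σ : PM) (g : ℝ × ℝ → ℝ) (p : ℝ × ℝ) : ℝ := fderiv ℝ g p (dir σ)

/-- The open positive quadrant. -/
def quadrant : Set (ℝ × ℝ) := {p | ∀ σ, 0 < comp σ p}

lemma comp_approxChi (σ : PM) (x : Noise) :
    comp σ (approxChi α ρ T κ n x) = approxX α ρ T κ n σ x := by cases σ <;> rfl

lemma approxChi_mem_quadrant (hT : 0 < T) (hκ : 0 < κ) (hnm : n ≤ m) {x : Noise}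
    (hx : x ∈ noiseDomain m) : approxChi α ρ T κ n x ∈ quadrant := fun σ => by
  rw [comp_approxChi]; exact approxX_pos hT hκ hnm hx σ

lemma hasDerivAt_comp_approxChi (hnm : n ≤ m) {x : Noise} (hx : x ∈ noiseDomain m) {l : NoiseIdx}
    (hl : l ∈ expIdx m) {G : ℝ × ℝ → ℝ} (hG : DifferentiableAt ℝ G (approxChi α ρ T κ n x)) :
    HasDerivAt (fun t => G (approxChi α ρ T κ n (upd x l t)))
      ((1 - 1 / α) / x l *
        (lineTerm α ρ T κ n .plus x l * pd .plus G (approxChi α ρ T κ n x)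
        + lineTerm α ρ T κ n .minus x l * pd .minus G (approxChi α ρ T κ n x))) (x l) := by
  have h1 := (hasDerivAt_approxX (α := α) (ρ := ρ) (T := T) (κ := κ) hnm hx hl .plus).prodMk
    (hasDerivAt_approxX (α := α) (ρ := ρ) (T := T) (κ := κ) hnm hx hl .minus)
  have hG' : HasFDerivAt G (fderiv ℝ G (approxChi α ρ T κ n x))
      (approxX α ρ T κ n .plus (upd x l (x l)), approxX α ρ T κ n .minus (upd x l (x l))) := by
    rw [upd_self]; exact hG.hasFDerivAt
  refine (hG'.comp_hasDerivAt (x l) h1).congr_deriv ?_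
  simp only [pd, dir]
  set D := fderiv ℝ G (approxChi α ρ T κ n x)
  have hD : ∀ a b : ℝ, D (a, b) = a * D (1, 0) + b * D (0, 1) := by
    intro a b
    have : ((a, b) : ℝ × ℝ) = a • ((1 : ℝ), (0 : ℝ)) + b • ((0 : ℝ), (1 : ℝ)) := by simp
    rw [this, map_add, map_smul, map_smul]; simp
  rw [hD]
  ring

/-- Along lines, the indicator of sign `σ` selects the derivative in the direction `σ`. -/
lemma lineInd_mul_pderiv_comp (hnm : n ≤ m) {x : Noise} (hx : x ∈ noiseDomain m)
    {l : NoiseIdx} (hl : l ∈ expIdx m) {G : ℝ × ℝ → ℝ}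
    (hG : DifferentiableAt ℝ G (approxChi α ρ T κ n x)) (σ : PM) :
    x l * lineInd α ρ σ x l * pderiv l (fun y => G (approxChi α ρ T κ n y)) x
      = (1 - 1 / α) * lineTerm α ρ T κ n σ x l * pd σ G (approxChi α ρ T κ n x) := by
  have hpos := pos_of_mem_noiseDomain hx hl
  have h1 := lineInd_mul_lineTerm (α := α) (ρ := ρ) (T := T) (κ := κ) (n := n) hx hl σ
  rw [pderiv_eq, (hasDerivAt_comp_approxChi hnm hx hl hG).deriv]
  generalize 1 - 1 / α = b
  cases σ
  · have h2 := lineInd_mul_lineTerm_of_ne (α := α) (ρ := ρ) (T := T) (κ := κ) (n := n) hx hl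
      (σ := .plus) (τ := .minus) (by simp)
    field_simp
    linear_combination b * pd .plus G (approxChi α ρ T κ n x) * h1 +
      b * pd .minus G (approxChi α ρ T κ n x) * h2
  · have h2 := lineInd_mul_lineTerm_of_ne (α := α) (ρ := ρ) (T := T) (κ := κ) (n := n) hx hl
      (σ := .minus) (τ := .plus) (by simp)
    field_simp
    linear_combination b * pd .minus G (approxChi α ρ T κ n x) * h1 +
      b * pd .plus G (approxChi α ρ T κ n x) * h2

lemma pderiv_comp_mul (hnm : n ≤ m) {x : Noise} (hx : x ∈ noiseDomain m)
    {l : NoiseIdx} (hl : l ∈ expIdx m) {G : ℝ × ℝ → ℝ}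
    (hG : DifferentiableAt ℝ G (approxChi α ρ T κ n x)) {W : Noise → ℝ}
    (hW : DifferentiableAt ℝ (fun t => W (upd x l t)) (x l)) :
    pderiv l (fun y => G (approxChi α ρ T κ n y) * W y) x
      = pderiv l (fun y => G (approxChi α ρ T κ n y)) x * W x
        + G (approxChi α ρ T κ n x) * pderiv l W x := by
  simp only [pderiv_eq]
  rw [deriv_fun_mul (hasDerivAt_comp_approxChi hnm hx hl hG).differentiableAt hW]
  simp only [upd_self]

/-- On each line the indicator leaves `(1 - 1/α)` times the line term times the derivative in
direction `σ`. The line terms add up to `X_σ`, those with `n ≤ i < m` being zero. -/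
lemma opD_comp_mul (hnm : n ≤ m) {x : Noise} (hx : x ∈ noiseDomain m) {G : ℝ × ℝ → ℝ}
    (hG : DifferentiableAt ℝ G (approxChi α ρ T κ n x)) {W : Noise → ℝ}
    (hW : ∀ l ∈ expIdx m, DifferentiableAt ℝ (fun t => W (upd x l t)) (x l)) (σ : PM) :
    opD α ρ m σ (fun y => G (approxChi α ρ T κ n y) * W y) x
      = (1 - 1 / α) * (comp σ (approxChi α ρ T κ n x) * pd σ G (approxChi α ρ T κ n x)) * W x
        + G (approxChi α ρ T κ n x) * opD α ρ m σ W x := by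
  rw [opD_eq, opD_eq, comp_approxChi, approxX_eq_sum hnm, Finset.sum_mul, Finset.mul_sum,
    Finset.sum_mul, Finset.mul_sum, ← Finset.sum_add_distrib]
  refine Finset.sum_congr rfl fun l hl => ?_
  rw [pderiv_comp_mul hnm hx hl hG (hW l hl)]
  have := lineInd_mul_pderiv_comp hnm hx hl hG σ
  linear_combination W x * this

/-- The monomial `(x_+ ^ e_+ x_- ^ e_-)⁻¹`. -/
def invMonom (e : PM → ℕ) (p : ℝ × ℝ) : ℝ := (p.1 ^ e .plus)⁻¹ * (p.2 ^ e .minus)⁻¹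

lemma invMonom_succ {e e' : PM → ℕ} {σ : PM} (h1 : e' σ = e σ + 1) (h2 : ∀ τ, τ ≠ σ → e' τ = e τ)
    {p : ℝ × ℝ} (hp : p ∈ quadrant) : comp σ p * invMonom e' p = invMonom e p := by
  have := hp σ
  cases σ
  · have h3 := h2 .minus (by simp)
    simp only [comp] at this
    simp only [invMonom, h1, h3, comp, pow_succ]
    field_simp
  · have h3 := h2 .plus (by simp)
    simp only [comp] at this
    simp only [invMonom, h1, h3, comp, pow_succ]
    field_simp

lemma pd_eq_of_hasDerivAt_plus {G : ℝ × ℝ → ℝ} {p : ℝ × ℝ} {d : ℝ} (hG : DifferentiableAt ℝ G p)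
    (h : HasDerivAt (fun t => G (t, p.2)) d p.1) : pd .plus G p = d := by
  have h1 : HasDerivAt (fun t : ℝ => (t, p.2)) ((1 : ℝ), (0 : ℝ)) p.1 :=
    (hasDerivAt_id _).prodMk (hasDerivAt_const _ _)
  exact (hG.hasFDerivAt.comp_hasDerivAt p.1 h1).unique h

lemma pd_eq_of_hasDerivAt_minus {G : ℝ × ℝ → ℝ} {p : ℝ × ℝ} {d : ℝ} (hG : DifferentiableAt ℝ G p)
    (h : HasDerivAt (fun t => G (p.1, t)) d p.2) : pd .minus G p = d := by
  have h1 : HasDerivAt (fun t : ℝ => (p.1, t)) ((0 : ℝ), (1 : ℝ)) p.2 :=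
    (hasDerivAt_const _ _).prodMk (hasDerivAt_id _)
  exact (hG.hasFDerivAt.comp_hasDerivAt p.2 h1).unique h

lemma differentiableAt_invMonom (e : PM → ℕ) {p : ℝ × ℝ} (hp : p ∈ quadrant) :
    DifferentiableAt ℝ (invMonom e) p := by
  have h1 : p.1 ≠ 0 := (hp .plus).ne'
  have h2 : p.2 ≠ 0 := (hp .minus).ne'
  unfold invMonom
  exact ((differentiableAt_fst.pow _).inv (pow_ne_zero _ h1)).mul
    ((differentiableAt_snd.pow _).inv (pow_ne_zero _ h2))

lemma hasDerivAt_inv_pow (j : ℕ) {t : ℝ} (ht : t ≠ 0) :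
    HasDerivAt (fun t : ℝ => (t ^ j)⁻¹) (-(j * (t ^ j)⁻¹ / t)) t := by
  refine ((hasDerivAt_pow j t).inv (pow_ne_zero _ ht)).congr_deriv ?_
  cases j with
  | zero => simp
  | succ j =>
    simp only [Nat.add_sub_cancel, pow_succ]
    field_simp

lemma comp_mul_pd_invMonom (e : PM → ℕ) {p : ℝ × ℝ} (hp : p ∈ quadrant) (σ : PM) :
    comp σ p * pd σ (invMonom e) p = -(e σ * invMonom e p) := by
  cases σ
  · have h1 : p.1 ≠ 0 := (hp .plus).ne'
    rw [pd_eq_of_hasDerivAt_plus (differentiableAt_invMonom e hp)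
      ((hasDerivAt_inv_pow (e .plus) h1).mul_const ((p.2 ^ e .minus)⁻¹))]
    simp only [comp, invMonom]
    field_simp
  · have h1 : p.2 ≠ 0 := (hp .minus).ne'
    rw [pd_eq_of_hasDerivAt_minus (differentiableAt_invMonom e hp)
      ((hasDerivAt_inv_pow (e .minus) h1).const_mul ((p.1 ^ e .plus)⁻¹))]
    simp only [comp, invMonom]
    field_simp

/-- Differentiating `X_σ ^ (-j)` with the Euler identity only multiplies it by `-j (1 - 1/α)`, so
powers of `X_σ` factor out of the weight. Their sole trace is the constant `j (1 - 1/α)` in `coreH`.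
The power of the other component is inert. -/
lemma opH_invMonom_mul (hT : 0 < T) (hκ : 0 < κ) (hnm : n ≤ m) {x : Noise} (hx : x ∈ noiseDomain m)
    {W : Noise → ℝ} (hW : ∀ l ∈ expIdx m, DifferentiableAt ℝ (fun t => W (upd x l t)) (x l))
    {σ : PM} {e e' : PM → ℕ} (h1 : e' σ = e σ + 1) (h2 : ∀ τ, τ ≠ σ → e' τ = e τ) :
    opH α ρ T κ n m σ (fun y => invMonom e (approxChi α ρ T κ n y) * W y) x
      = invMonom e' (approxChi α ρ T κ n x) * coreH α ρ m σ (e σ) W x := by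
  have hq := approxChi_mem_quadrant (α := α) (ρ := ρ) hT hκ hnm hx
  have h3 := invMonom_succ h1 h2 hq
  have hpos := approxX_pos (α := α) (ρ := ρ) hT hκ hnm hx σ
  rw [opH, opD_comp_mul hnm hx (differentiableAt_invMonom e hq) hW, comp_mul_pd_invMonom e hq,
    coreH, multiplier]
  rw [comp_approxChi] at h3
  rw [← h3]
  generalize x (.eta σ) - 1 / α + ∑ i ∈ Finset.range m, (x (.E i) - 1) * sgnInd α ρ σ x i = A
  generalize α / (α - 1) = c
  generalize (1 - 1 / α) = b
  field_simp
  ring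

variable (α ρ) in
/-- The `j`-fold iterate of `coreH`. -/
def coreIter (m : ℕ) (σ : PM) : ℕ → (Noise → ℝ) → Noise → ℝ
  | 0, ψ => ψ
  | j + 1, ψ => coreH α ρ m σ j (coreIter m σ j ψ)

/-- The growth constant of `coreIter`. -/
def iterConst (α : ℝ) : ℕ → ℕ → ℝ
  | _, 0 => 1
  | k, j + 1 => coreConst α k j * iterConst α (k + 1) j

lemma iterConst_nonneg (α : ℝ) (k j : ℕ) : 0 ≤ iterConst α k j := by
  induction j generalizing k with
  | zero => exact zero_le_one
  | succ j ih => exact mul_nonneg (coreConst_nonneg α k j) (ih _)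

/-- Starting from `k + j` derivatives, `k` are left after `j` steps, and the degree in the gauge has
grown by two at each step. -/
lemma isRegular_coreIter {S : Type*} [MeasurableSpace S] {C : S → ℝ} (hC : ∀ s, 0 ≤ C s)
    {K : ℝ} (hK : 0 ≤ K) (σ : PM) (j : ℕ) : ∀ {r k : ℕ} {ψ : Noise → S → ℝ},
    IsRegular m C K r (k + j) ψ →
    IsRegular m C (iterConst α k j * K) (r + 2 * j) k
      (fun x s => coreIter α ρ m σ j (fun y => ψ y s) x) := by
  induction j with
  | zero => intro r k ψ h; simpa [iterConst, coreIter] using h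
  | succ j ih =>
    intro r k ψ h
    have h1 := ih (r := r) (k := k + 1) (ψ := ψ) (by rwa [add_right_comm k 1 j])
    have h2 := isRegular_coreH α ρ hC (mul_nonneg (iterConst_nonneg _ _ _) hK) h1 σ j
    rw [iterConst, mul_assoc]
    exact h2

lemma opH_congr {x : Noise} (hx : x ∈ noiseDomain m) {ψ ψ' : Noise → ℝ}
    (h : ∀ y ∈ noiseDomain m, ψ y = ψ' y) (σ : PM) :
    opH α ρ T κ n m σ ψ x = opH α ρ T κ n m σ ψ' x := by
  have : opD α ρ m σ ψ x = opD α ρ m σ ψ' x := by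
    rw [opD_eq, opD_eq]
    exact Finset.sum_congr rfl fun l hl => by rw [pderiv_congr hx hl h]
  rw [opH, opH, h x hx, this]

/-- The initial function may already carry a power of the other component. This allows the iterates
of sign `+` to be stacked on those of sign `-`. -/
lemma iterate_opH_eq {S : Type*} [MeasurableSpace S] {C : S → ℝ} (hC : ∀ s, 0 ≤ C s)
    (hT : 0 < T) (hκ : 0 < κ) (hnm : n ≤ m) {K : ℝ} (hK : 0 ≤ K) {r : ℕ} {σ : PM}
    {e : ℕ → PM → ℕ} (h1 : ∀ j, e j σ = j) (h2 : ∀ j τ, τ ≠ σ → e j τ = e 0 τ)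
    {W : Noise → S → ℝ} {ψ : Noise → S → ℝ}
    (hψ : ∀ x ∈ noiseDomain m, ∀ s, ψ x s = invMonom (e 0) (approxChi α ρ T κ n x) * W x s)
    (j : ℕ) (hW : IsRegular m C K r j W) (s : S) :
    ∀ x ∈ noiseDomain m, (opH α ρ T κ n m σ)^[j] (fun y => ψ y s) x
      = invMonom (e j) (approxChi α ρ T κ n x) * coreIter α ρ m σ j (fun y => W y s) x := by
  induction j with
  | zero => intro x hx; exact hψ x hx s
  | succ j ih =>
    intro x hx
    rw [Function.iterate_succ_apply', opH_congr hx (ih hW.lower), opH_invMonom_mul hT hκ hnm hx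
      (e' := e (j + 1)) _ (by rw [h1, h1]) (fun τ hτ => by rw [h2 _ τ hτ, h2 j τ hτ]), h1]
    · rfl
    · intro l hl
      have h3 := isRegular_coreIter (α := α) (ρ := ρ) hC hK σ j (k := 1) (r := r) (ψ := W)
        (by rwa [add_comm 1 j])
      exact (h3.2 l hl).1 x hx s

end Approximation

/-! ### Partial derivatives on the plane and test functions. -/

section PlaneDerivatives

lemma contDiff_pd {k : ℕ} {g : ℝ × ℝ → ℝ} (hg : ContDiff ℝ (k + 1 : ℕ) g) (σ : PM) :
    ContDiff ℝ k (pd σ g) :=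
  (hg.fderiv_right (m := k) (by norm_cast)).clm_apply contDiff_const

lemma contDiff_iterate_pd {j k : ℕ} {g : ℝ × ℝ → ℝ} (hg : ContDiff ℝ (k + j : ℕ) g) (σ : PM) :
    ContDiff ℝ k ((pd σ)^[j] g) := by
  induction j generalizing g with
  | zero => exact hg
  | succ j ih => rw [Function.iterate_succ_apply]; exact ih (contDiff_pd hg σ)

lemma pd_comm {g : ℝ × ℝ → ℝ} (hg : ContDiff ℝ (2 : ℕ) g) (σ τ : PM) :
    pd σ (pd τ g) = pd τ (pd σ g) := by
  have key : ∀ σ τ p, pd σ (pd τ g) p = fderiv ℝ (fderiv ℝ g) p (dir σ) (dir τ) := by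
    intro σ τ p
    have h1 : DifferentiableAt ℝ (fderiv ℝ g) p :=
      ((hg.fderiv_right (m := 1) (by norm_num)).differentiable one_ne_zero) p
    have h2 : HasFDerivAt (fun p => fderiv ℝ g p (dir τ))
        ((ContinuousLinearMap.apply ℝ ℝ (dir τ)).comp (fderiv ℝ (fderiv ℝ g) p)) p :=
      (ContinuousLinearMap.apply ℝ ℝ (dir τ)).hasFDerivAt.comp p h1.hasFDerivAt
    change fderiv ℝ (fun p => fderiv ℝ g p (dir τ)) p (dir σ) = _
    rw [h2.fderiv]; rfl
  funext p
  rw [key, key]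
  exact (hg.contDiffAt.isSymmSndFDerivAt (by simp)) _ _

lemma pd_iterate_comm {b : ℕ} {g : ℝ × ℝ → ℝ} (hg : ContDiff ℝ (b + 1 : ℕ) g) (σ τ : PM) :
    pd σ ((pd τ)^[b] g) = (pd τ)^[b] (pd σ g) := by
  induction b generalizing g with
  | zero => rfl
  | succ b ih =>
    rw [Function.iterate_succ_apply, ih (contDiff_pd hg τ),
      pd_comm (hg.of_le (by norm_cast; omega)), ← Function.iterate_succ_apply]

lemma iterate_pd_comm {a b : ℕ} {g : ℝ × ℝ → ℝ} (hg : ContDiff ℝ (a + b : ℕ) g) (σ τ : PM) :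
    (pd σ)^[a] ((pd τ)^[b] g) = (pd τ)^[b] ((pd σ)^[a] g) := by
  induction a generalizing g with
  | zero => rfl
  | succ a ih =>
    rw [Function.iterate_succ_apply, pd_iterate_comm (hg.of_le (by norm_cast; omega)),
      ih (contDiff_pd (by rwa [add_right_comm] at hg) σ), ← Function.iterate_succ_apply]

lemma iteratedDeriv_slice_minus {k : ℕ} {g : ℝ × ℝ → ℝ} (hg : ContDiff ℝ k g) (a : ℝ) :
    iteratedDeriv k (fun b => g (a, b)) = fun b => (pd .minus)^[k] g (a, b) := by
  induction k generalizing g with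
  | zero => simp
  | succ k ih =>
    rw [iteratedDeriv_succ', Function.iterate_succ_apply, ← ih (contDiff_pd hg _)]
    congr 1
    funext b
    have hd : DifferentiableAt ℝ g (a, b) := (hg.differentiable (by simp)) _
    have h1 : HasDerivAt (fun t : ℝ => (a, t)) ((0 : ℝ), (1 : ℝ)) b :=
      (hasDerivAt_const _ _).prodMk (hasDerivAt_id _)
    exact (hd.hasFDerivAt.comp_hasDerivAt b h1).deriv

lemma iteratedDeriv_slice_plus {k : ℕ} {g : ℝ × ℝ → ℝ} (hg : ContDiff ℝ k g) (b : ℝ) :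
    iteratedDeriv k (fun a => g (a, b)) = fun a => (pd .plus)^[k] g (a, b) := by
  induction k generalizing g with
  | zero => simp
  | succ k ih =>
    rw [iteratedDeriv_succ', Function.iterate_succ_apply, ← ih (contDiff_pd hg _)]
    congr 1
    funext a
    have hd : DifferentiableAt ℝ g (a, b) := (hg.differentiable (by simp)) _
    have h1 : HasDerivAt (fun t : ℝ => (t, b)) ((1 : ℝ), (0 : ℝ)) a :=
      (hasDerivAt_id _).prodMk (hasDerivAt_const _ _)
    exact (hd.hasFDerivAt.comp_hasDerivAt a h1).deriv

/-- Symmetry of the derivatives puts those of sign `-` outermost. They are then the first to be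
integrated by parts, in agreement with `H^-` being the first weight applied to `Φ`. -/
lemma mixedDeriv_eq {kp km : ℕ} {f : ℝ × ℝ → ℝ} (hf : ContDiff ℝ (kp + km : ℕ) f) :
    mixedDeriv kp km f = (pd .minus)^[km] ((pd .plus)^[kp] f) := by
  rw [← iterate_pd_comm hf]
  funext p
  rw [mixedDeriv]
  have h1 : ∀ a, iteratedDeriv km (fun b => f (a, b)) p.2 = (pd .minus)^[km] f (a, p.2) :=
    fun a => by rw [iteratedDeriv_slice_minus (hf.of_le (by norm_cast; omega))]
  simp only [h1]
  rw [iteratedDeriv_slice_plus (contDiff_iterate_pd hf _)]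

variable {ε : ℝ}

lemma norm_dir (σ : PM) : ‖dir σ‖ = 1 := by cases σ <;> simp [dir, Prod.norm_def]

lemma IsTestFunction.pd {k : ℕ} {g : ℝ × ℝ → ℝ} (hg : IsTestFunction (k + 1) ε g) (σ : PM) :
    IsTestFunction k ε (pd σ g) where
  contDiff := contDiff_pd hg.contDiff σ
  bounded j hj := by
    obtain ⟨C, hC⟩ := hg.bounded (j + 1) (by omega)
    refine ⟨C, fun p => ?_⟩
    have h1 := norm_iteratedFDeriv_clm_apply_const (𝕜 := ℝ) (f := fderiv ℝ g) (c := dir σ) (x := p)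
      (N := (k : ℕ∞)) (n := j) ((hg.contDiff.fderiv_right (by norm_cast)).contDiffAt)
      (by exact_mod_cast hj)
    rw [norm_dir, one_mul, norm_iteratedFDeriv_fderiv] at h1
    exact h1.trans (hC p)
  support_subset := by
    -- Closedness of the quadrant makes it contain the topological support of `g`, and so the
    -- support of its derivative.
    have hcl : IsClosed (Ici ε ×ˢ Ici ε) := isClosed_Ici.prod isClosed_Ici
    have h1 : tsupport g ⊆ Ici ε ×ˢ Ici ε := closure_minimal hg.support_subset hcl
    refine Subset.trans (fun p hp => ?_) h1
    by_contra h
    refine hp ?_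
    have : fderiv ℝ g p = 0 := by
      by_contra h2
      exact h (support_fderiv_subset ℝ h2)
    simp [StableIBP.pd, this]

lemma IsTestFunction.iterate_pd {j k : ℕ} {g : ℝ × ℝ → ℝ} (hg : IsTestFunction (k + j) ε g)
    (σ : PM) : IsTestFunction k ε ((StableIBP.pd σ)^[j] g) := by
  induction j generalizing g with
  | zero => exact hg
  | succ j ih => rw [Function.iterate_succ_apply]; exact ih (hg.pd σ)

lemma IsTestFunction.exists_bound {k : ℕ} {g : ℝ × ℝ → ℝ} (hg : IsTestFunction k ε g) :
    ∃ M, 0 ≤ M ∧ ∀ p, |g p| ≤ M := by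
  obtain ⟨M, hM⟩ := hg.bounded 0 (by omega)
  simp only [norm_iteratedFDeriv_zero, Real.norm_eq_abs] at hM
  exact ⟨M, (abs_nonneg _).trans (hM 0), hM⟩

/-- On the support both coordinates are at least `ε`; this distance from the axes pays for the
negative powers of `X_±`. -/
lemma IsTestFunction.exists_bound_mul_invMonom (hε : 0 < ε) {k : ℕ} {g : ℝ × ℝ → ℝ}
    (hg : IsTestFunction k ε g) (e : PM → ℕ) :
    ∃ M, 0 ≤ M ∧ ∀ p, |g p * invMonom e p| ≤ M := by
  obtain ⟨M, hM0, hM⟩ := hg.exists_bound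
  refine ⟨M * ((ε ^ e .plus)⁻¹ * (ε ^ e .minus)⁻¹), by positivity, fun p => ?_⟩
  by_cases hp : g p = 0
  · rw [hp, zero_mul, abs_zero]; positivity
  · have h1 := hg.support_subset hp
    have h2 : ε ≤ p.1 := h1.1
    have h3 : ε ≤ p.2 := h1.2
    have h4 : 0 < p.1 := hε.trans_le h2
    have h5 : 0 < p.2 := hε.trans_le h3
    rw [abs_mul, invMonom, abs_of_pos (a := (p.1 ^ e .plus)⁻¹ * _) (by positivity)]
    gcongr
    exact hM p

lemma measurable_invMonom (e : PM → ℕ) : Measurable (invMonom e) := by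
  unfold invMonom; fun_prop

end PlaneDerivatives

/-! ### Integration by parts at a fixed level. -/

section IntegrationByParts

variable {α ρ T κ : ℝ} {n m : ℕ}

lemma measurable_jumpTerm (σ : PM) (i : ℕ) : Measurable fun x => jumpTerm α ρ T σ x i := by
  have h1 : Measurable fun x => stable α ρ x i := by
    unfold stable angular
    exact ((measurable_pi_apply _).pow_const _).mul
      ((measurable_cms α ρ).comp (measurable_pi_apply _))
  have h2 : Measurable fun x => stick T x i := by unfold stick; fun_prop
  exact (h2.pow_const _).mul ((measurable_part σ).comp h1)

lemma measurable_approxX (σ : PM) : Measurable fun x => approxX α ρ T κ n σ x := by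
  unfold approxX
  exact (Finset.measurable_sum _ fun i _ => measurable_jumpTerm σ i).add
    (((measurable_pi_apply _).pow_const _).const_mul _)

lemma measurable_approxChi : Measurable fun x => approxChi α ρ T κ n x :=
  (measurable_approxX _).prodMk (measurable_approxX _)

lemma jumpTerm_congr {x y : Noise} (h : ∀ k ∈ levelIdx m, x k = y k) {i : ℕ} (hi : i < m)
    (σ : PM) : jumpTerm α ρ T σ x i = jumpTerm α ρ T σ y i := by
  have h1 : ∏ j ∈ Finset.range i, x (.U j) = ∏ j ∈ Finset.range i, y (.U j) :=
    Finset.prod_congr rfl fun j hj => h _ (by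
      simp only [Finset.mem_range] at hj; simp only [U_mem_levelIdx]; omega)
  simp only [jumpTerm, stick, stable, angular, h1, h (.E i) (by simpa), h (.U i) (by simpa),
    h (.V i) (by simpa)]

lemma approxX_congr (hnm : n ≤ m) {x y : Noise} (h : ∀ k ∈ levelIdx m, x k = y k) (σ : PM) :
    approxX α ρ T κ n σ x = approxX α ρ T κ n σ y := by
  have h1 : ∑ i ∈ Finset.range n, jumpTerm α ρ T σ x i
      = ∑ i ∈ Finset.range n, jumpTerm α ρ T σ y i :=
    Finset.sum_congr rfl fun i hi => jumpTerm_congr h (by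
      simp only [Finset.mem_range] at hi; omega) σ
  rw [approxX, approxX, h1, h (.eta σ) (by simp)]

variable {S : Type*} [MeasurableSpace S] {C : S → ℝ}

lemma isAdapted_comp_approxChi (hnm : n ≤ m) {G : ℝ × ℝ → ℝ} (hG : Measurable G) :
    IsAdapted m (fun x (_ : S) => G (approxChi α ρ T κ n x)) :=
  .of_measurable (hG.comp (measurable_approxChi.comp measurable_fst)) fun x _ y _ h => by
    rw [approxChi, approxChi, approxX_congr hnm h, approxX_congr hnm h]

lemma isDominated_comp_mul (hT : 0 < T) (hκ : 0 < κ) (hnm : n ≤ m) {G : ℝ × ℝ → ℝ}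
    (hG : Measurable G) {M : ℝ} (hM0 : 0 ≤ M) (hM : ∀ p ∈ quadrant, |G p| ≤ M)
    {K : ℝ} {r : ℕ} {W : Noise → S → ℝ} (hW : IsDominated m C K r W) :
    IsDominated m C (M * K) r (fun x s => G (approxChi α ρ T κ n x) * W x s) := by
  refine ⟨(isAdapted_comp_approxChi hnm hG).mul hW.1, fun x hx s => ?_⟩
  rw [abs_mul]
  have h1 := hM _ (approxChi_mem_quadrant (α := α) (ρ := ρ) hT hκ hnm hx)
  calc _ ≤ M * (K * noiseGauge m x ^ r * C s) := mul_le_mul h1 (hW.2 x hx s) (abs_nonneg _) hM0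
    _ = _ := by ring

variable {Ω : Type*} [MeasurableSpace Ω] {P : Measure Ω} [IsProbabilityMeasure P] {N : Ω → Noise}
  {ϑ : Ω → S}

/-- Integration by parts against `opD`. -/
lemma integral_opD_eq_zero (hN : IsDrivingNoise P N) (hϑ : Measurable ϑ)
    (hind : IndepFun (fun ω => trunc m (N ω)) ϑ P) (hC : Measurable C) (hC0 : ∀ s, 0 ≤ C s)
    (hCi : Integrable (fun ω => C (ϑ ω)) P) (hT : 0 < T) (hκ : 0 < κ) (hnm : n ≤ m)
    {G : ℝ × ℝ → ℝ} (hG : Measurable G) (hGd : ∀ p ∈ quadrant, DifferentiableAt ℝ G p) (σ : PM)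
    {M : ℝ} (hM0 : 0 ≤ M) (hM : ∀ p ∈ quadrant, |G p| ≤ M)
    (hM' : ∀ p ∈ quadrant, |comp σ p * pd σ G p| ≤ M)
    {K : ℝ} (hK : 0 ≤ K) {r : ℕ} {W : Noise → S → ℝ} (hW : IsRegular m C K r 1 W) :
    ∫ ω, ((1 - 1 / α) * (comp σ (approxChi α ρ T κ n (N ω)) * pd σ G (approxChi α ρ T κ n (N ω)))
          * W (N ω) (ϑ ω)
        + G (approxChi α ρ T κ n (N ω)) * opD α ρ m σ (fun y => W y (ϑ ω)) (N ω)
        - (∑ l ∈ expIdx m, (N ω l - 1) * lineInd α ρ σ (N ω) l)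
          * (G (approxChi α ρ T κ n (N ω)) * W (N ω) (ϑ ω))) ∂P = 0 := by
  set χ : Noise → ℝ × ℝ := approxChi α ρ T κ n with hχ
  have hq : ∀ x ∈ noiseDomain m, χ x ∈ quadrant := fun x hx =>
    approxChi_mem_quadrant (α := α) (ρ := ρ) hT hκ hnm hx
  have hGW := isDominated_comp_mul (α := α) (ρ := ρ) hT hκ hnm hG hM0 hM hW.dominated
  -- The indicator does not depend on the exponential variables, so it can be included in the
  -- function to which the one-coordinate formula is applied.
  set F : NoiseIdx → Noise → S → ℝ := fun l x s => lineInd α ρ σ x l * (G (χ x) * W x s) with hF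
  have hFa : ∀ l ∈ expIdx m, IsAdapted m (F l) := fun l hl =>
    (isRegular_lineInd α ρ σ hl 0).dominated.1.mul hGW.1
  have hFd : ∀ l ∈ expIdx m, ∀ x ∈ noiseDomain m, ∀ s,
      DifferentiableAt ℝ (fun t => F l (upd x l t) s) (x l) := by
    intro l hl x hx s
    simp only [hF, lineInd_upd α ρ σ x hl]
    exact ((hasDerivAt_comp_approxChi hnm hx hl (hGd _ (hq x hx))).differentiableAt.mul
      ((hW.2 l hl).1 x hx s)).const_mul _
  have hFp : ∀ l ∈ expIdx m, ∀ x ∈ noiseDomain m, ∀ s, x l * pderiv l (fun y => F l y s) x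
      = x l * lineInd α ρ σ x l * pderiv l (fun y => G (χ y) * W y s) x := by
    intro l hl x hx s
    simp only [hF, pderiv_eq, lineInd_upd α ρ σ x hl]
    have hd := (hasDerivAt_comp_approxChi hnm hx hl (hGd _ (hq x hx))).differentiableAt.mul
      ((hW.2 l hl).1 x hx s)
    rw [mul_assoc]
    congr 1
    exact deriv_const_mul _ hd
  have hFp' : ∀ l ∈ expIdx m, ∀ x ∈ noiseDomain m, ∀ s, x l * pderiv l (fun y => F l y s) x
      = (1 - 1 / α) * lineTerm α ρ T κ n σ x l * pd σ G (χ x) * W x s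
        + G (χ x) * (x l * (lineInd α ρ σ x l * pderiv l (fun y => W y s) x)) := by
    intro l hl x hx s
    rw [hFp l hl x hx s, pderiv_comp_mul hnm hx hl (hGd _ (hq x hx)) ((hW.2 l hl).1 x hx s),
      ← lineInd_mul_pderiv_comp hnm hx hl (hGd _ (hq x hx)) σ]
    ring
  set K' := (|1 - 1 / α| + 1) * M * K with hK'
  have hFb : ∀ l ∈ expIdx m, ∀ x ∈ noiseDomain m, ∀ s, |F l x s| ≤ K' * noiseGauge m x ^ (r + 1) * C s := by
    intro l hl x hx s
    have h0 := one_le_gauge hx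
    have h3 := hC0 s
    simp only [hF]
    rw [abs_mul]
    calc _ ≤ 1 * (M * K * noiseGauge m x ^ r * C s) :=
          mul_le_mul (abs_lineInd_le α ρ σ x l) (hGW.2 x hx s) (abs_nonneg _) zero_le_one
      _ ≤ (|1 - 1 / α| + 1) * (M * K * noiseGauge m x ^ (r + 1) * C s) := by
          gcongr
          · linarith [abs_nonneg (1 - 1 / α)]
          · omega
      _ = _ := by rw [hK']; ring
  have hFb' : ∀ l ∈ expIdx m, ∀ x ∈ noiseDomain m, ∀ s,
      |x l * pderiv l (fun y => F l y s) x| ≤ K' * noiseGauge m x ^ (r + 1) * C s := by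
    intro l hl x hx s
    rw [hFp' l hl x hx s]
    have h0 := one_le_gauge hx
    have h3 := hC0 s
    have hg0 : 0 ≤ noiseGauge m x := by linarith
    have hb1 := (hW.dominated).2 x hx s
    have hb2 := ((hW.2 l hl).2.dominated).2 x hx s
    have hl1 := lineTerm_nonneg (α := α) (ρ := ρ) (n := n) hT hκ hx hl σ
    -- Every single term is at most the whole of `X_σ`. Hence a bound on `X_σ ∂_σ G` suffices, and
    -- no bound on `∂_σ G` itself is needed.
    have hl2 := lineTerm_le_approxX (α := α) (ρ := ρ) hT hκ hnm hx hl σ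
    have hm := hM' _ (hq x hx)
    rw [hχ, comp_approxChi, abs_mul, abs_of_pos (approxX_pos hT hκ hnm hx σ)] at hm
    have e1 : |(1 - 1 / α) * lineTerm α ρ T κ n σ x l * pd σ G (χ x) * W x s|
        ≤ |1 - 1 / α| * M * (K * noiseGauge m x ^ (r + 1) * C s) := by
      rw [abs_mul, mul_assoc (1 - 1 / α), abs_mul, abs_mul (lineTerm _ _ _ _ _ _ _ _),
        abs_of_nonneg hl1]
      refine mul_le_mul (mul_le_mul_of_nonneg_left ?_ (abs_nonneg _)) (hb1.trans ?_)
        (abs_nonneg _) (by positivity)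
      · exact (mul_le_mul_of_nonneg_right hl2 (abs_nonneg _)).trans hm
      · gcongr
        omega
    have e2 : |G (χ x) * (x l * (lineInd α ρ σ x l * pderiv l (fun y => W y s) x))|
        ≤ M * (noiseGauge m x * (1 * (K * noiseGauge m x ^ r * C s))) := by
      rw [abs_mul, abs_mul, abs_mul, abs_of_pos (pos_of_mem_noiseDomain hx hl)]
      have hxl := pos_of_mem_noiseDomain hx hl
      gcongr
      · exact hM _ (hq x hx)
      · exact le_gauge hx hl
      · exact abs_lineInd_le α ρ σ x l
    refine (abs_add_le _ _).trans ((add_le_add e1 e2).trans_eq ?_)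
    rw [hK']; ring
  have hibp := fun l hl => (hFa l hl).integral_mul_pderiv hN hϑ hind hC hCi hl (hFd l hl)
    (hFb l hl) (hFb' l hl)
  have hi1 : ∀ l ∈ expIdx m,
      Integrable (fun ω => N ω l * pderiv l (fun y => F l y (ϑ ω)) (N ω)) P := fun l hl =>
    IsAdapted.integrable (F := fun x s => x l * pderiv l (fun y => F l y s) x)
      ((IsAdapted.coord (expIdx_subset m hl)).mul ((hFa l hl).pderiv hl (hFd l hl)))
      hN hϑ hind hC hCi (hFb' l hl)
  have hi2 : ∀ l ∈ expIdx m, Integrable (fun ω => (N ω l - 1) * F l (N ω) (ϑ ω)) P := by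
    intro l hl
    refine IsAdapted.integrable (F := fun x s => (x l - 1) * F l x s) (r := r + 2) (K := K') ?_
      hN hϑ hind hC hCi ?_
    · simpa [sub_eq_add_neg] using ((IsAdapted.coord (S := S) (expIdx_subset m hl)).add
        (IsAdapted.const m (-1))).mul (hFa l hl)
    · intro x hx s
      rw [abs_mul]
      have h1 : |x l - 1| ≤ noiseGauge m x := by
        have := le_gauge hx hl
        have := one_le_gauge hx
        have := pos_of_mem_noiseDomain hx hl
        exact abs_le.2 ⟨by linarith, by linarith⟩
      calc _ ≤ noiseGauge m x * (K' * noiseGauge m x ^ (r + 1) * C s) :=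
            mul_le_mul h1 (hFb l hl x hx s) (abs_nonneg _) (by linarith [one_le_gauge hx])
        _ = _ := by ring
  have hsum : ∫ ω, (∑ l ∈ expIdx m, N ω l * pderiv l (fun y => F l y (ϑ ω)) (N ω)
      - ∑ l ∈ expIdx m, (N ω l - 1) * F l (N ω) (ϑ ω)) ∂P = 0 := by
    rw [integral_sub (integrable_finsetSum _ hi1) (integrable_finsetSum _ hi2),
      integral_finsetSum _ hi1, integral_finsetSum _ hi2, Finset.sum_congr rfl hibp, sub_self]
  rw [← hsum]
  refine integral_congr_ae ?_
  filter_upwards [hN.ae_mem_noiseDomain m] with ω hω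
  have hop := opD_comp_mul (W := fun y => W y (ϑ ω)) hnm hω (hGd _ (hq _ hω))
    (fun l hl => (hW.2 l hl).1 _ hω (ϑ ω)) σ
  rw [← hχ] at hop
  rw [← hop, opD_eq, Finset.sum_mul]
  congr 1
  · exact Finset.sum_congr rfl fun l hl => (hFp l hl _ hω _).symm
  · exact Finset.sum_congr rfl fun l hl => by simp only [hF]; ring

variable {ε : ℝ}

/-- The vanishing identity is used for `G = g · invMonom e'`, which has one more power of `1 / X_σ`.
Then `X_σ ∂_σ G` is the wanted derivative term minus `(e σ + 1) G`, and this correction supplies the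
constants `1 - 1/α` of `multiplier` and `e σ (1 - 1/α)` of `coreH`. -/
lemma integral_pd_eq (hα : α ≠ 0) (hα1 : α ≠ 1) (hN : IsDrivingNoise P N) (hϑ : Measurable ϑ)
    (hind : IndepFun (fun ω => trunc m (N ω)) ϑ P) (hC : Measurable C) (hC0 : ∀ s, 0 ≤ C s)
    (hCi : Integrable (fun ω => C (ϑ ω)) P) (hT : 0 < T) (hκ : 0 < κ) (hnm : n ≤ m) (hε : 0 < ε)
    {g : ℝ × ℝ → ℝ} (hg : IsTestFunction 1 ε g) {σ : PM}
    {e e' : PM → ℕ} (h1 : e' σ = e σ + 1) (h2 : ∀ τ, τ ≠ σ → e' τ = e τ)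
    {K : ℝ} (hK : 0 ≤ K) {r : ℕ} {W : Noise → S → ℝ} (hW : IsRegular m C K r 1 W) :
    ∫ ω, pd σ g (approxChi α ρ T κ n (N ω)) * invMonom e (approxChi α ρ T κ n (N ω))
        * W (N ω) (ϑ ω) ∂P
      = ∫ ω, g (approxChi α ρ T κ n (N ω)) * invMonom e' (approxChi α ρ T κ n (N ω))
        * coreH α ρ m σ (e σ) (fun y => W y (ϑ ω)) (N ω) ∂P := by
  have hg' := hg.pd σ
  obtain ⟨M1, hM10, hM1⟩ := hg.exists_bound_mul_invMonom hε e'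
  obtain ⟨M2, hM20, hM2⟩ := hg'.exists_bound_mul_invMonom hε e
  set G : ℝ × ℝ → ℝ := fun p => g p * invMonom e' p with hGdef
  have hgd : ∀ p, DifferentiableAt ℝ g p := hg.contDiff.differentiable (by simp)
  have hGd : ∀ p ∈ quadrant, DifferentiableAt ℝ G p := fun p hp =>
    (hgd p).mul (differentiableAt_invMonom e' hp)
  have hGm : Measurable G := hg.contDiff.continuous.measurable.mul (measurable_invMonom e')
  have hG'm : Measurable (fun p => pd σ g p * invMonom e p) :=
    hg'.contDiff.continuous.measurable.mul (measurable_invMonom e)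
  have hpd : ∀ p ∈ quadrant, comp σ p * pd σ G p
      = pd σ g p * invMonom e p - (e σ + 1) * G p := by
    intro p hp
    have h3 : pd σ G p = g p * pd σ (invMonom e') p + invMonom e' p * pd σ g p := by
      simp only [pd, hGdef]
      rw [fderiv_fun_mul (hgd p) (differentiableAt_invMonom e' hp)]
      simp
    have h4 := comp_mul_pd_invMonom e' hp σ
    have h5 := invMonom_succ h1 h2 hp
    rw [h1] at h4
    push_cast at h4
    rw [h3, ← h5]
    simp only [hGdef]
    linear_combination g p * h4
  have hMM : ∀ p ∈ quadrant, |comp σ p * pd σ G p| ≤ M2 + (e σ + 1) * M1 := by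
    intro p hp
    rw [hpd p hp]
    refine (abs_sub _ _).trans (add_le_add (hM2 p) ?_)
    rw [abs_mul, abs_of_nonneg (by positivity : (0 : ℝ) ≤ e σ + 1)]
    exact mul_le_mul_of_nonneg_left (hM1 p) (by positivity)
  have h0 := integral_opD_eq_zero (α := α) (ρ := ρ) (T := T) (κ := κ) hN hϑ hind hC hC0 hCi hT hκ
    hnm hGm hGd σ (M := M1 + (M2 + (e σ + 1) * M1)) (by positivity)
    (fun p _ => (hM1 p).trans (le_add_of_nonneg_right (by positivity)))
    (fun p hp => (hMM p hp).trans (le_add_of_nonneg_left hM10)) hK hW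
  have d1 := isDominated_comp_mul (α := α) (ρ := ρ) hT hκ hnm hG'm hM20 (fun p _ => hM2 p)
    hW.dominated
  have d2 := isDominated_comp_mul (α := α) (ρ := ρ) hT hκ hnm hGm hM10 (fun p _ => hM1 p)
    (isRegular_coreH α ρ hC0 hK hW σ (e σ)).dominated
  have i1 := d1.1.integrable hN hϑ hind hC hCi d1.2
  have i2 := d2.1.integrable hN hϑ hind hC hCi d2.2
  rw [← sub_eq_zero, ← integral_sub i1 i2]
  -- The factor `α / (α - 1)` is the inverse of the homogeneity degree `1 - 1/α`.
  rw [← mul_zero (α / (α - 1)), ← h0, ← integral_const_mul]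
  refine integral_congr_ae ?_
  filter_upwards [hN.ae_mem_noiseDomain m] with ω hω
  rw [hpd _ (approxChi_mem_quadrant (α := α) (ρ := ρ) hT hκ hnm hω), coreH, multiplier_eq]
  have hα2 : α - 1 ≠ 0 := sub_ne_zero.2 hα1
  simp only [hGdef]
  field_simp
  ring

lemma integral_iterate_pd_eq (hα : α ≠ 0) (hα1 : α ≠ 1) (hN : IsDrivingNoise P N)
    (hϑ : Measurable ϑ) (hind : IndepFun (fun ω => trunc m (N ω)) ϑ P) (hC : Measurable C)
    (hC0 : ∀ s, 0 ≤ C s) (hCi : Integrable (fun ω => C (ϑ ω)) P) (hT : 0 < T) (hκ : 0 < κ)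
    (hnm : n ≤ m) (hε : 0 < ε) {σ : PM}
    {e : ℕ → PM → ℕ} (h1 : ∀ j, e j σ = j) (h2 : ∀ j τ, τ ≠ σ → e j τ = e 0 τ)
    {K : ℝ} (hK : 0 ≤ K) {r : ℕ} {W : Noise → S → ℝ} (j : ℕ) :
    ∀ {g : ℝ × ℝ → ℝ}, IsTestFunction j ε g → IsRegular m C K r j W →
    ∫ ω, (pd σ)^[j] g (approxChi α ρ T κ n (N ω)) * invMonom (e 0) (approxChi α ρ T κ n (N ω))
        * W (N ω) (ϑ ω) ∂P
      = ∫ ω, g (approxChi α ρ T κ n (N ω)) * invMonom (e j) (approxChi α ρ T κ n (N ω))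
        * coreIter α ρ m σ j (fun y => W y (ϑ ω)) (N ω) ∂P := by
  induction j with
  | zero => intro g hg hW; rfl
  | succ j ih =>
    intro g hg hW
    rw [Function.iterate_succ_apply, ih (hg.pd σ) hW.lower]
    have h3 := isRegular_coreIter (α := α) (ρ := ρ) hC0 hK σ j (k := 1) (r := r) (ψ := W)
      (by rwa [add_comm 1 j])
    have hg1 : IsTestFunction 1 ε g :=
      ⟨hg.contDiff.of_le (by norm_cast; omega), fun i hi => hg.bounded i (by omega),
        hg.support_subset⟩
    rw [integral_pd_eq hα hα1 hN hϑ hind hC hC0 hCi hT hκ hnm hε hg1 (e' := e (j + 1))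
      (by rw [h1, h1]) (fun τ hτ => by rw [h2 _ τ hτ, h2 j τ hτ])
      (mul_nonneg (iterConst_nonneg _ _ _) hK) h3, h1]
    rfl

end IntegrationByParts

/-! ### Series that are absolutely summable in mean. -/

section Series

variable {Ω : Type*} [MeasurableSpace Ω] {P : Measure Ω}

lemma tsum_lintegral_enorm_ne_top {F : ℕ → Ω → ℝ} (hF : ∀ i, Integrable (F i) P)
    (hs : Summable fun i => ∫ ω, |F i ω| ∂P) : ∑' i, ∫⁻ ω, ‖F i ω‖ₑ ∂P ≠ ⊤ := by
  have h : ∀ i, ∫⁻ ω, ‖F i ω‖ₑ ∂P = ENNReal.ofReal (∫ ω, |F i ω| ∂P) := fun i => by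
    have := ofReal_integral_norm_eq_lintegral_enorm (hF i)
    simpa only [Real.norm_eq_abs] using this.symm
  simp only [h]
  exact hs.tsum_ofReal_ne_top

lemma ae_summable_of_summable_integral {F : ℕ → Ω → ℝ} (hF : ∀ i, Integrable (F i) P)
    (hs : Summable fun i => ∫ ω, |F i ω| ∂P) : ∀ᵐ ω ∂P, Summable fun i => F i ω := by
  have h1 := tsum_lintegral_enorm_ne_top hF hs
  rw [← lintegral_tsum fun i => (hF i).1.enorm] at h1
  filter_upwards [ae_lt_top' (AEMeasurable.tsum fun i => (hF i).1.enorm) h1] with ω hω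
  refine Summable.of_norm ?_
  have := ENNReal.summable_toReal hω.ne
  simpa using this

lemma integrable_tsum_of_summable_integral {F : ℕ → Ω → ℝ} (hF : ∀ i, Integrable (F i) P)
    (hs : Summable fun i => ∫ ω, |F i ω| ∂P) : Integrable (fun ω => ∑' i, F i ω) P := by
  have h1 := tsum_lintegral_enorm_ne_top hF hs
  rw [← lintegral_tsum fun i => (hF i).1.enorm] at h1
  have h2 := ae_summable_of_summable_integral hF hs
  refine ⟨?_, ?_⟩
  · refine aestronglyMeasurable_of_tendsto_ae atTop
      (f := fun n ω => ∑ i ∈ Finset.range n, F i ω) (fun n => ?_) ?_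
    · exact (integrable_finsetSum _ fun i _ => hF i).1
    · filter_upwards [h2] with ω hω using hω.hasSum.tendsto_sum_nat
  · rw [hasFiniteIntegral_iff_enorm]
    refine lt_of_le_of_lt (lintegral_mono fun ω => ?_) (lt_top_iff_ne_top.2 h1)
    exact enorm_tsum_le_tsum_enorm

end Series

/-! ### Geometric decay of small moments of the jumps. -/

section Decay

variable {α ρ T κ : ℝ}

lemma cos_ge_of_abs_le {d θ : ℝ} (hd : 0 ≤ d) (h : |θ| ≤ Real.pi / 2 - d) :
    2 / Real.pi * d ≤ Real.cos θ := by
  have h1 := Real.mul_le_sin (x := Real.pi / 2 - |θ|) (by linarith)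
    (by linarith [abs_nonneg θ])
  rw [Real.sin_pi_div_two_sub, Real.cos_abs] at h1
  refine le_trans ?_ h1
  have := Real.pi_pos
  gcongr
  linarith

/-- The admissible range of `ρ` amounts to `α |ρ - 1/2| ≤ (1 - |1 - α|) / 2`: from `0 < ρ < 1` when
`α ≤ 1`, from `1 - 1/α ≤ ρ ≤ 1/α` when `α ≥ 1`. So the second cosine in `cms` can degenerate only as
`v` approaches `±π/2`, and at most linearly. -/
lemma abs_angle_le (hα : α ∈ Ioo (0 : ℝ) 2)
    (hρ : ρ ∈ Icc (1 - 1 / α) (1 / α) ∩ Ioo (0 : ℝ) 1) {v : ℝ} :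
    |(1 - α) * v - α * (Real.pi * (ρ - 1 / 2))|
      ≤ Real.pi / 2 - |1 - α| * (Real.pi / 2 - |v|) := by
  obtain ⟨⟨h1, h2⟩, h3, h4⟩ := hρ
  have hα0 := hα.1
  have hπ := Real.pi_pos
  have e1 : |(1 - α) * v - α * (Real.pi * (ρ - 1 / 2))|
      ≤ |1 - α| * |v| + α * (Real.pi * |ρ - 1 / 2|) := by
    refine (abs_sub _ _).trans_eq ?_
    rw [abs_mul, abs_mul, abs_mul, abs_of_pos hα0, abs_of_pos hπ]
  have e2 : α * |ρ - 1 / 2| ≤ (1 - |1 - α|) / 2 := by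
    rcases le_total α 1 with h | h
    · rw [abs_of_nonneg (by linarith : 0 ≤ 1 - α)]
      have : |ρ - 1 / 2| ≤ 1 / 2 := abs_le.2 ⟨by linarith, by linarith⟩
      nlinarith
    · rw [abs_of_nonpos (by linarith : 1 - α ≤ 0)]
      have h5 : |ρ - 1 / 2| ≤ 1 / α - 1 / 2 := abs_le.2 ⟨by linarith, by linarith⟩
      calc α * |ρ - 1 / 2| ≤ α * (1 / α - 1 / 2) := by gcongr
        _ = _ := by field_simp; ring
  nlinarith

/-- One lower bound for both signs of `q`: a negative power of a number in `(0, 1]` is at least one.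
It is used with `q = 1 - 1/α`, whose sign depends on whether `α < 1`. -/
lemma rpow_abs_le_rpow {y c q : ℝ} (hy : 0 < y) (hyc : y ≤ c) (hc : c ≤ 1) :
    y ^ |q| ≤ c ^ q := by
  rcases le_total 0 q with h | h
  · rw [abs_of_nonneg h]; exact Real.rpow_le_rpow hy.le hyc h
  · exact (Real.rpow_le_one hy.le (hyc.trans hc) (abs_nonneg q)).trans
      (Real.one_le_rpow_of_pos_of_le_one_of_nonpos (hy.trans_le hyc) hc h)

/-- Both cosines are bounded below linearly in the distance of `v` to the endpoints. The exponent is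
not sharp when `α < 1`, which does no harm since only small moments are used. -/
lemma exists_abs_cms_le (hα : α ∈ Ioo (0 : ℝ) 2) (hα1 : α ≠ 1)
    (hρ : ρ ∈ Icc (1 - 1 / α) (1 / α) ∩ Ioo (0 : ℝ) 1) :
    ∃ K, 0 ≤ K ∧ ∀ v ∈ Ioo (-(Real.pi / 2)) (Real.pi / 2),
      |cms α ρ v| ≤ K * (Real.pi / 2 - |v|) ^ (-(1 / α + |1 - 1 / α|)) := by
  have hπ := Real.pi_pos
  have hα0 := hα.1
  have h1α : 0 < |1 - α| := abs_pos.2 (sub_ne_zero.2 hα1.symm)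
  have h1α' : |1 - α| ≤ 1 := abs_le.2 ⟨by linarith [hα.2], by linarith⟩
  refine ⟨((2 / Real.pi) ^ (1 / α) * (2 / Real.pi * |1 - α|) ^ |1 - 1 / α|)⁻¹, by positivity,
    fun v hv => ?_⟩
  have hv' : |v| < Real.pi / 2 := abs_lt.2 hv
  set d := Real.pi / 2 - |v| with hd
  have hd0 : 0 < d := by linarith
  have hdπ : d ≤ Real.pi / 2 := by linarith [abs_nonneg v]
  have h2d : 2 / Real.pi * d ≤ 1 := by
    rw [div_mul_eq_mul_div, div_le_one hπ]; linarith
  have c1 : 2 / Real.pi * d ≤ Real.cos v := cos_ge_of_abs_le hd0.le (by rw [hd]; linarith)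
  have c2 : 2 / Real.pi * |1 - α| * d
      ≤ Real.cos ((1 - α) * v - α * (Real.pi * (ρ - 1 / 2))) := by
    rw [mul_assoc]
    exact cos_ge_of_abs_le (by positivity) (abs_angle_le hα hρ)
  have p1 : (2 / Real.pi * d) ^ (1 / α) ≤ Real.cos v ^ (1 / α) :=
    Real.rpow_le_rpow (by positivity) c1 (by positivity)
  have p2 := rpow_abs_le_rpow (q := 1 - 1 / α) (by positivity) c2 (Real.cos_le_one _)
  have hD : 0 < (2 / Real.pi * d) ^ (1 / α) * (2 / Real.pi * |1 - α| * d) ^ |1 - 1 / α| := by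
    positivity
  rw [cms, abs_div]
  have hcos : 0 ≤ Real.cos v := le_trans (by positivity) c1
  have hp := mul_le_mul p1 p2 (by positivity) (by positivity)
  rw [abs_of_pos (hD.trans_le hp)]
  calc _ ≤ 1 / ((2 / Real.pi * d) ^ (1 / α) * (2 / Real.pi * |1 - α| * d) ^ |1 - 1 / α|) :=
        div_le_div₀ zero_le_one (Real.abs_sin_le_one _) hD hp
    _ = _ := by
        rw [Real.mul_rpow (by positivity) hd0.le, Real.mul_rpow (by positivity) hd0.le,
          Real.rpow_neg hd0.le, Real.rpow_add hd0, ← mul_inv, one_div]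
        congr 1; ring

variable (α) in
/-- An exponent for which the jumps have finite moments. -/
def smallExp : ℝ := 1 / (2 * (1 + 1 / α + |1 - 1 / α|))

lemma smallExp_pos (hα : 0 < α) : 0 < smallExp α := by unfold smallExp; positivity

/-- Makes the singularity of `cms`, raised to the power `smallExp`, integrable at `±π/2`. It also
yields integrability at zero of the power of the exponential variable, whose exponent is negative
when `α < 1`. -/
lemma smallExp_mul_lt (hα : 0 < α) : smallExp α * (1 / α + |1 - 1 / α|) < 1 := by
  unfold smallExp
  have h1 : 0 < 1 / α + |1 - 1 / α| := by positivity
  rw [div_mul_eq_mul_div, div_lt_one (by positivity)]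
  linarith

lemma smallExp_le_one (hα : 0 < α) : smallExp α ≤ 1 := by
  unfold smallExp
  rw [div_le_one (by positivity)]
  have h1 : 0 < 1 / α + |1 - 1 / α| := by positivity
  linarith

lemma neg_one_lt_smallExp_mul (hα : 0 < α) : -1 < smallExp α * (1 - 1 / α) := by
  have h1 := smallExp_mul_lt hα
  have h2 := smallExp_pos hα
  have h3 : 0 < 1 / α := by positivity
  have h4 := neg_abs_le (1 - 1 / α)
  nlinarith

lemma lintegral_abs_cms_lt_top (hα : α ∈ Ioo (0 : ℝ) 2) (hα1 : α ≠ 1)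
    (hρ : ρ ∈ Icc (1 - 1 / α) (1 / α) ∩ Ioo (0 : ℝ) 1) :
    ∫⁻ v, ENNReal.ofReal (|cms α ρ v| ^ smallExp α)
      ∂(ProbabilityTheory.cond volume (Ioo (-(Real.pi / 2)) (Real.pi / 2))) < ⊤ := by
  obtain ⟨K, hK, h⟩ := exists_abs_cms_le hα hα1 hρ
  have hp := smallExp_pos hα.1
  have hs : -1 < -(1 / α + |1 - 1 / α|) * smallExp α := by
    have := smallExp_mul_lt hα.1; linarith
  have hi := (integrableOn_pi_div_two_sub_abs_rpow hs).const_mul (K ^ smallExp α)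
  rw [ProbabilityTheory.cond, lintegral_smul_measure]
  refine ENNReal.mul_lt_top ?_ ?_
  · rw [ENNReal.inv_lt_top, Real.volume_Ioo]
    simp only [ENNReal.ofReal_pos]
    linarith [Real.pi_pos]
  · refine lt_of_le_of_lt (setLIntegral_mono' measurableSet_Ioo fun v hv => ?_)
      (Integrable.lintegral_lt_top hi)
    refine ENNReal.ofReal_le_ofReal ?_
    have hd : 0 ≤ Real.pi / 2 - |v| := by linarith [abs_lt.2 hv]
    rw [Real.rpow_mul hd, ← Real.mul_rpow hK (Real.rpow_nonneg hd _)]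
    exact Real.rpow_le_rpow (abs_nonneg _) (h v hv) hp.le

lemma lintegral_rpow_expMeasure_lt_top (hα : 0 < α) :
    ∫⁻ t, ENNReal.ofReal (t ^ (smallExp α * (1 - 1 / α))) ∂(expMeasure 1) < ⊤ :=
  (integrable_rpow_expMeasure (neg_one_lt_smallExp_mul hα)).lintegral_lt_top

lemma lintegral_rpow_unit {s : ℝ} (hs : 0 < s) :
    ∫⁻ u, ENNReal.ofReal (u ^ s) ∂(ProbabilityTheory.cond volume (Ioo (0 : ℝ) 1))
      = ENNReal.ofReal (1 / (s + 1)) := by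
  rw [ProbabilityTheory.cond, lintegral_smul_measure, Real.volume_Ioo]
  simp only [sub_zero, ENNReal.ofReal_one, inv_one, one_smul]
  have h0 : IntervalIntegrable (fun u : ℝ => u ^ s) volume 0 1 :=
    intervalIntegral.intervalIntegrable_rpow' (by linarith)
  rw [intervalIntegrable_iff_integrableOn_Ioo_of_le zero_le_one] at h0
  rw [← ofReal_integral_eq_lintegral_ofReal h0, ← integral_Ioc_eq_integral_Ioo,
    ← intervalIntegral.integral_of_le zero_le_one, integral_rpow (Or.inl (by linarith))]
  · simp [Real.zero_rpow (by linarith : s + 1 ≠ 0)]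
  · filter_upwards [ae_restrict_mem measurableSet_Ioo] with u hu using Real.rpow_nonneg hu.1.le _

lemma part_le_abs (σ : PM) (y : ℝ) : part σ y ≤ |y| := by
  cases σ
  · exact max_le (le_abs_self y) (abs_nonneg y)
  · exact max_le (neg_le_abs y) (abs_nonneg y)

variable (α ρ) in
/-- The factors of the moment bound for the jumps. -/
def momentFactor : NoiseIdx → ℝ → ℝ
  | .E _, t => t ^ (smallExp α * (1 - 1 / α))
  | .U _, u => u ^ (smallExp α * (1 / α))
  | .V _, v => |cms α ρ v| ^ smallExp α
  | .eta _, _ => 1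

lemma measurable_momentFactor (k : NoiseIdx) : Measurable (momentFactor α ρ k) := by
  cases k
  · exact measurable_id.pow_const _
  · exact measurable_id.pow_const _
  · exact (measurable_cms α ρ).abs.pow_const _
  · exact measurable_const

/-- Discarding `1 - U ≤ 1` leaves a product of functions of distinct, hence independent, variables.
-/
lemma jumpTerm_rpow_le (hα : 0 < α) (hT : 0 < T) {i m : ℕ} (hi : i < m) {x : Noise}
    (hx : x ∈ noiseDomain m) (σ : PM) :
    jumpTerm α ρ T σ x i ^ smallExp α ≤ T ^ (smallExp α * (1 / α)) *
      ((∏ j ∈ Finset.range i, momentFactor α ρ (.U j) (x (.U j))) *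
        (momentFactor α ρ (.E i) (x (.E i)) * momentFactor α ρ (.V i) (x (.V i)))) := by
  have hp := smallExp_pos hα
  obtain ⟨hE, hU, -, -⟩ := mem_noiseDomain_iff.1 hx
  have hEi := hE i hi
  have hUp : ∀ j ∈ Finset.range i, 0 ≤ x (.U j) := fun j hj =>
    (hU j ((Finset.mem_range.1 hj).trans hi)).1.le
  have hprod : 0 ≤ ∏ j ∈ Finset.range i, x (.U j) := Finset.prod_nonneg hUp
  have h1 : stick T x i ≤ T * ∏ j ∈ Finset.range i, x (.U j) := by
    rw [stick]
    have := (hU i hi).1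
    have : T * (1 - x (.U i)) ≤ T := by nlinarith
    exact mul_le_mul_of_nonneg_right this hprod
  have h2 : part σ (stable α ρ x i) ≤ x (.E i) ^ (1 - 1 / α) * |cms α ρ (x (.V i))| := by
    rw [stable, part_mul σ (Real.rpow_nonneg hEi.le _)]
    exact mul_le_mul_of_nonneg_left (part_le_abs _ _) (Real.rpow_nonneg hEi.le _)
  have h3 : jumpTerm α ρ T σ x i ≤ (T * ∏ j ∈ Finset.range i, x (.U j)) ^ (1 / α) *
      (x (.E i) ^ (1 - 1 / α) * |cms α ρ (x (.V i))|) :=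
    mul_le_mul (Real.rpow_le_rpow (stick_nonneg hT hx hi) h1 (by positivity)) h2
      (part_nonneg _ _) (Real.rpow_nonneg (mul_nonneg hT.le hprod) _)
  refine (Real.rpow_le_rpow (jumpTerm_nonneg hT hx hi σ) h3 hp.le).trans_eq ?_
  simp only [momentFactor]
  rw [Real.mul_rpow (by positivity) (by positivity), Real.mul_rpow (by positivity) (abs_nonneg _),
    ← Real.rpow_mul (by positivity), ← Real.rpow_mul hEi.le, Real.mul_rpow hT.le hprod,
    Real.finsetProd_rpow _ _ hUp, mul_comm (1 / α), mul_comm (1 - 1 / α)]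
  ring

variable {Ω : Type*} [MeasurableSpace Ω] {P : Measure Ω} {N : Ω → Noise}

lemma IsDrivingNoise.lintegral_momentFactor_prod (hN : IsDrivingNoise P N) (i : ℕ) :
    ∫⁻ ω, ENNReal.ofReal ((∏ j ∈ Finset.range i, momentFactor α ρ (.U j) (N ω (.U j))) *
        (momentFactor α ρ (.E i) (N ω (.E i)) * momentFactor α ρ (.V i) (N ω (.V i)))) ∂P
      = (∏ j ∈ Finset.range i, ∫⁻ ω, ENNReal.ofReal (momentFactor α ρ (.U j) (N ω (.U j))) ∂P) *
        ((∫⁻ ω, ENNReal.ofReal (momentFactor α ρ (.E i) (N ω (.E i))) ∂P) *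
          ∫⁻ ω, ENNReal.ofReal (momentFactor α ρ (.V i) (N ω (.V i))) ∂P) := by
  classical
  set X : NoiseIdx → Ω → ENNReal := fun k ω => ENNReal.ofReal (momentFactor α ρ k (N ω k)) with hX
  have hXi : iIndepFun X P := hN.indep.comp (fun k t => ENNReal.ofReal (momentFactor α ρ k t))
    fun k => ENNReal.measurable_ofReal.comp (measurable_momentFactor k)
  have hXm : ∀ k, Measurable (X k) := fun k =>
    ENNReal.measurable_ofReal.comp ((measurable_momentFactor k).comp (hN.measurable k))
  have hs : ∀ h : NoiseIdx → ENNReal,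
      ∏ k ∈ insert (.E i) (insert (.V i) ((Finset.range i).image NoiseIdx.U)), h k
      = (∏ j ∈ Finset.range i, h (.U j)) * (h (.E i) * h (.V i)) := by
    intro h
    rw [Finset.prod_insert (by simp), Finset.prod_insert (by simp), Finset.prod_image]
    · ring
    · intro a _ b _ hab; simpa using hab
  have h1 := lintegral_prod_eq_prod_lintegral_of_indepFun
    (insert (.E i) (insert (.V i) ((Finset.range i).image NoiseIdx.U))) X hXi hXm
  simp only [hs] at h1
  rw [← h1]
  refine lintegral_congr_ae ?_
  filter_upwards [hN.ae_mem_noiseDomain (i + 1)] with ω hω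
  obtain ⟨hE, hU, -, -⟩ := mem_noiseDomain_iff.1 hω
  have hU0 : ∀ j ∈ Finset.range i, 0 ≤ momentFactor α ρ (.U j) (N ω (.U j)) := fun j hj =>
    Real.rpow_nonneg (hU j (by simp at hj; omega)).1.le _
  have hE0 : 0 ≤ momentFactor α ρ (.E i) (N ω (.E i)) :=
    Real.rpow_nonneg (hE i (by omega)).le _
  rw [ENNReal.ofReal_mul (Finset.prod_nonneg hU0), ENNReal.ofReal_mul hE0,
    ENNReal.ofReal_prod_of_nonneg hU0]

/-- Small moments of the jumps decay geometrically. -/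
lemma IsDrivingNoise.exists_jumpTerm_moment (hN : IsDrivingNoise P N) (hα : α ∈ Ioo (0 : ℝ) 2)
    (hα1 : α ≠ 1) (hρ : ρ ∈ Icc (1 - 1 / α) (1 / α) ∩ Ioo (0 : ℝ) 1) (hT : 0 < T) :
    ∃ B, 0 ≤ B ∧ ∃ θ, 0 < θ ∧ θ < 1 ∧ ∀ i σ,
      Integrable (fun ω => jumpTerm α ρ T σ (N ω) i ^ smallExp α) P ∧
      ∫ ω, jumpTerm α ρ T σ (N ω) i ^ smallExp α ∂P ≤ B * θ ^ i := by
  have hα0 := hα.1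
  have hp := smallExp_pos hα0
  set s := smallExp α * (1 / α) with hs
  have hs0 : 0 < s := by positivity
  set A1 := ∫⁻ t, ENNReal.ofReal (t ^ (smallExp α * (1 - 1 / α))) ∂(expMeasure 1)
  set A2 := ∫⁻ v, ENNReal.ofReal (|cms α ρ v| ^ smallExp α)
      ∂(ProbabilityTheory.cond volume (Ioo (-(Real.pi / 2)) (Real.pi / 2)))
  have hA1 : A1 ≠ ⊤ := (lintegral_rpow_expMeasure_lt_top hα0).ne
  have hA2 : A2 ≠ ⊤ := (lintegral_abs_cms_lt_top hα hα1 hρ).ne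
  have hmap : ∀ (k : NoiseIdx), ∫⁻ ω, ENNReal.ofReal (momentFactor α ρ k (N ω k)) ∂P
      = ∫⁻ t, ENNReal.ofReal (momentFactor α ρ k t) ∂(P.map fun ω => N ω k) := fun k =>
    (lintegral_map (ENNReal.measurable_ofReal.comp (measurable_momentFactor k))
      (hN.measurable k)).symm
  have hU : ∀ j, ∫⁻ ω, ENNReal.ofReal (momentFactor α ρ (.U j) (N ω (.U j))) ∂P
      = ENNReal.ofReal (1 / (s + 1)) := fun j => by
    rw [hmap, show P.map (fun ω => N ω (.U j)) = _ from hN.law_U j, ← lintegral_rpow_unit hs0]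
    rfl
  have hE : ∀ j, ∫⁻ ω, ENNReal.ofReal (momentFactor α ρ (.E j) (N ω (.E j))) ∂P = A1 := fun j => by
    rw [hmap, hN.law_E j]; rfl
  have hV : ∀ j, ∫⁻ ω, ENNReal.ofReal (momentFactor α ρ (.V j) (N ω (.V j))) ∂P = A2 := fun j => by
    rw [hmap, show P.map (fun ω => N ω (.V j)) = _ from hN.law_V j]; rfl
  -- The ratio `1 / (s + 1)` is the mean of `U ^ s`, one such factor arising from each earlier
  -- stick.
  refine ⟨T ^ s * (A1.toReal * A2.toReal), by positivity, 1 / (s + 1), by positivity,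
    by rw [div_lt_one (by positivity)]; linarith, fun i σ => ?_⟩
  have hnn : ∀ᵐ ω ∂P, 0 ≤ jumpTerm α ρ T σ (N ω) i ^ smallExp α := by
    filter_upwards [hN.ae_mem_noiseDomain (i + 1)] with ω hω
    exact Real.rpow_nonneg (jumpTerm_nonneg hT hω (by omega) σ) _
  have hmeas : AEStronglyMeasurable (fun ω => jumpTerm α ρ T σ (N ω) i ^ smallExp α) P :=
    (((measurable_jumpTerm σ i).comp hN.measurable_noise).pow_const _).aestronglyMeasurable
  have hb : ∫⁻ ω, ENNReal.ofReal (jumpTerm α ρ T σ (N ω) i ^ smallExp α) ∂P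
      ≤ ENNReal.ofReal (T ^ s) * (ENNReal.ofReal (1 / (s + 1)) ^ i * (A1 * A2)) := by
    have h1 := hN.lintegral_momentFactor_prod (α := α) (ρ := ρ) i
    simp only [hU, hE, hV, Finset.prod_const, Finset.card_range] at h1
    rw [← h1, ← lintegral_const_mul' _ _ ENNReal.ofReal_ne_top]
    refine lintegral_mono_ae ?_
    filter_upwards [hN.ae_mem_noiseDomain (i + 1)] with ω hω
    rw [← ENNReal.ofReal_mul (by positivity)]
    exact ENNReal.ofReal_le_ofReal (jumpTerm_rpow_le hα0 hT (by omega) hω σ)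
  have htop : ENNReal.ofReal (T ^ s) * (ENNReal.ofReal (1 / (s + 1)) ^ i * (A1 * A2)) ≠ ⊤ :=
    ENNReal.mul_ne_top ENNReal.ofReal_ne_top (ENNReal.mul_ne_top
      (ENNReal.pow_ne_top ENNReal.ofReal_ne_top) (ENNReal.mul_ne_top hA1 hA2))
  refine ⟨⟨hmeas, ?_⟩, ?_⟩
  · rw [hasFiniteIntegral_iff_ofReal hnn]
    exact lt_of_le_of_lt hb (lt_top_iff_ne_top.2 htop)
  · rw [integral_eq_lintegral_of_nonneg_ae hnn hmeas]
    refine (ENNReal.toReal_mono htop hb).trans_eq ?_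
    rw [ENNReal.toReal_mul, ENNReal.toReal_mul, ENNReal.toReal_mul, ENNReal.toReal_pow,
      ENNReal.toReal_ofReal (by positivity), ENNReal.toReal_ofReal (by positivity)]
    ring

/-- The terms are eventually at most one, and there `a ≤ a ^ p`. -/
lemma summable_of_summable_rpow {a : ℕ → ℝ} (ha : ∀ i, 0 ≤ a i) {p : ℝ} (hp : 0 < p) (hp1 : p ≤ 1)
    (h : Summable fun i => a i ^ p) : Summable a := by
  refine h.of_norm_bounded_eventually_nat ?_
  filter_upwards [h.tendsto_atTop_zero.eventually (gt_mem_nhds one_pos)] with i hi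
  rw [Real.norm_of_nonneg (ha i)]
  have h1 : a i ≤ 1 := by
    by_contra h2
    exact absurd (Real.one_le_rpow (not_le.1 h2).le hp.le) (not_le.2 hi)
  exact Real.self_le_rpow_of_le_one (ha i) h1 hp1

lemma IsDrivingNoise.ae_summable_jumpTerm (hN : IsDrivingNoise P N) (hα : α ∈ Ioo (0 : ℝ) 2)
    (hα1 : α ≠ 1) (hρ : ρ ∈ Icc (1 - 1 / α) (1 / α) ∩ Ioo (0 : ℝ) 1) (hT : 0 < T) (σ : PM) :
    ∀ᵐ ω ∂P, Summable (jumpTerm α ρ T σ (N ω)) := by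
  obtain ⟨B, hB, θ, hθ0, hθ1, h⟩ := hN.exists_jumpTerm_moment hα hα1 hρ hT
  have hdom : ∀ᵐ ω ∂P, ∀ i, N ω ∈ noiseDomain (i + 1) :=
    ae_all_iff.2 fun i => hN.ae_mem_noiseDomain (i + 1)
  have hs : Summable fun i => ∫ ω, |jumpTerm α ρ T σ (N ω) i ^ smallExp α| ∂P := by
    refine Summable.of_nonneg_of_le (fun i => integral_nonneg fun ω => abs_nonneg _) (fun i => ?_)
      ((summable_geometric_of_lt_one hθ0.le hθ1).mul_left B)
    refine (integral_congr_ae ?_).trans_le (h i σ).2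
    filter_upwards [hdom] with ω hω
    exact abs_of_nonneg (Real.rpow_nonneg (jumpTerm_nonneg hT (hω i) (by omega) σ) _)
  filter_upwards [hdom, ae_summable_of_summable_integral (fun i => (h i σ).1) hs] with ω h1 h2
  exact summable_of_summable_rpow (fun i => jumpTerm_nonneg hT (h1 i) (by omega) σ)
    (smallExp_pos hα.1) (smallExp_le_one hα.1) h2

end Decay

/-! ### The weighted variables `Theta`: factorisation, integrability and mean. -/

section Weighted

lemma IsTestFunction.of_le {ε : ℝ} {j k : ℕ} {g : ℝ × ℝ → ℝ} (hg : IsTestFunction k ε g)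
    (h : j ≤ k) : IsTestFunction j ε g :=
  ⟨hg.contDiff.of_le (by exact_mod_cast h), fun i hi => hg.bounded i (hi.trans h),
    hg.support_subset⟩

/-- The pair of exponents `(a, b)`. -/
def expo (a b : ℕ) : PM → ℕ
  | .plus => a
  | .minus => b

lemma invMonom_expo_zero (p : ℝ × ℝ) : invMonom (expo 0 0) p = 1 := by simp [invMonom, expo]

variable {S : Type*} [MeasurableSpace S] {m : ℕ}

/-- The weight of order `(kp, km)` of a represented variable, stripped of its powers of `X_±`. -/
def fullCore (α ρ : ℝ) (m kp km : ℕ) (φ : Coord m → S → ℝ) (x : Noise) (s : S) : ℝ :=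
  coreIter α ρ m .plus kp (coreIter α ρ m .minus km (fun z => φ (trunc m z) s)) x

/-- The growth constant of `fullCore`. -/
def fullConst (α : ℝ) (kp km : ℕ) : ℝ := iterConst α 0 kp * (iterConst α kp km * 1)

lemma fullConst_nonneg (α : ℝ) (kp km : ℕ) : 0 ≤ fullConst α kp km :=
  mul_nonneg (iterConst_nonneg _ _ _) (mul_nonneg (iterConst_nonneg _ _ _) zero_le_one)

variable {α ρ T κ ε : ℝ} {C : S → ℝ} {n kp km : ℕ} {φ : Coord m → S → ℝ} {f : ℝ × ℝ → ℝ}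

lemma isRegular_coreIter_minus (hC0 : ∀ s, 0 ≤ C s)
    (hφ : IsRegular m C 1 0 (kp + km) (fun x s => φ (trunc m x) s)) :
    IsRegular m C (iterConst α kp km * 1) (0 + 2 * km) kp
      (fun x s => coreIter α ρ m .minus km (fun z => φ (trunc m z) s) x) :=
  isRegular_coreIter hC0 zero_le_one .minus km hφ

lemma isDominated_fullCore (hC0 : ∀ s, 0 ≤ C s)
    (hφ : IsRegular m C 1 0 (kp + km) (fun x s => φ (trunc m x) s)) :
    IsDominated m C (fullConst α kp km) (0 + 2 * km + 2 * kp) (fullCore α ρ m kp km φ) := by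
  have h := isRegular_coreIter (α := α) (ρ := ρ) hC0
    (mul_nonneg (iterConst_nonneg _ _ _) zero_le_one) .plus kp (k := 0)
    (ψ := fun x s => coreIter α ρ m .minus km (fun z => φ (trunc m z) s) x)
    (by rw [zero_add kp]; exact isRegular_coreIter_minus hC0 hφ)
  exact h.dominated

/-- In this form `n` occurs only in the argument of a function on the plane and `m` only in
`fullCore`. Two levels `n` with the same `m` are thus compared through the plane function alone. -/
lemma Theta_eq {Ω : Type*} {N : Ω → Noise} {ϑ : Ω → S} (hC0 : ∀ s, 0 ≤ C s) (hT : 0 < T) (hκ : 0 < κ) (hnm : n ≤ m)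
    (hφ : IsRegular m C 1 0 (kp + km) (fun x s => φ (trunc m x) s)) {ω : Ω}
    (hω : N ω ∈ noiseDomain m) :
    Theta α ρ T κ N f kp km n m φ ϑ ω
      = (f (approxChi α ρ T κ n (N ω)) * invMonom (expo kp km) (approxChi α ρ T κ n (N ω)))
        * fullCore α ρ m kp km φ (N ω) (ϑ ω) := by
  have h1 := iterate_opH_eq (α := α) (ρ := ρ) (σ := .minus) (e := fun j => expo 0 j) hC0 hT hκ hnm
    zero_le_one (fun j => rfl) (fun j τ hτ => by cases τ <;> simp_all [expo])
    (ψ := fun x s => φ (trunc m x) s) (W := fun x s => φ (trunc m x) s)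
    (fun x hx s => by rw [invMonom_expo_zero, one_mul]) km (hφ.of_add kp)
  have h2 := iterate_opH_eq (α := α) (ρ := ρ) (σ := .plus) (e := fun j => expo j km) hC0 hT hκ hnm
    (mul_nonneg (iterConst_nonneg _ _ _) zero_le_one) (fun j => rfl)
    (fun j τ hτ => by cases τ <;> simp_all [expo])
    (ψ := fun x s => (opH α ρ T κ n m .minus)^[km] (fun y => φ (trunc m y) s) x)
    (W := fun x s => coreIter α ρ m .minus km (fun z => φ (trunc m z) s) x)
    (fun x hx s => h1 s x hx) kp (isRegular_coreIter_minus hC0 hφ) (ϑ ω) (N ω) hω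
  rw [Theta, mul_assoc]
  congr 1

variable {Ω : Type*} [MeasurableSpace Ω] {P : Measure Ω} {N : Ω → Noise} {ϑ : Ω → S}

lemma coordDomain_nonempty (m : ℕ) : (coordDomain m).Nonempty :=
  ⟨(fun _ => 1, fun _ => 1 / 2, fun _ => 0, 1, 1), by
    have := Real.pi_pos
    simp only [coordDomain, mem_ofPred_eq, mem_Ioo]
    refine ⟨fun _ => one_pos, fun _ => ⟨by norm_num, by norm_num⟩,
      fun _ => ⟨by linarith, by linarith⟩, one_pos, one_pos⟩⟩

/-- One dominating function for all derivatives of order at most `k`. -/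
lemma exists_common_bound {K : ℕ → ℝ} (k : ℕ)
    (h : ∀ j, DerivBoundedInMean P m φ ϑ j (K j)) :
    ∃ C : S → ℝ, Measurable C ∧ (∀ s, 0 ≤ C s) ∧
      (∀ i ≤ k, ∀ c ∈ coordDomain m, ∀ s, ‖iteratedFDeriv ℝ i (fun c' => φ c' s) c‖ ≤ C s) ∧
      Integrable (fun ω => C (ϑ ω)) P ∧
      ∫ ω, C (ϑ ω) ∂P ≤ ∑ j ∈ Finset.range (k + 1), K j := by
  choose C hCm hCb hCi hCK using h
  obtain ⟨c₀, hc₀⟩ := coordDomain_nonempty m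
  have hC0 : ∀ j s, 0 ≤ C j s := fun j s => (norm_nonneg _).trans (hCb j c₀ hc₀ s)
  refine ⟨fun s => ∑ j ∈ Finset.range (k + 1), C j s,
    Finset.measurable_sum _ fun j _ => hCm j, fun s => Finset.sum_nonneg fun j _ => hC0 j s,
    fun i hi c hc s => (hCb i c hc s).trans ?_, integrable_finsetSum _ fun j _ => hCi j, ?_⟩
  · exact Finset.single_le_sum (f := fun j => C j s) (fun j _ => hC0 j s)
      (Finset.mem_range.2 (by omega))
  · rw [integral_finsetSum _ fun j _ => hCi j]
    exact Finset.sum_le_sum fun j _ => hCK j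

lemma integrable_Theta (hN : IsDrivingNoise P N) (hϑ : Measurable ϑ)
    (hind : IndepFun (fun ω => trunc m (N ω)) ϑ P) (hC : Measurable C) (hC0 : ∀ s, 0 ≤ C s)
    (hCi : Integrable (fun ω => C (ϑ ω)) P) (hT : 0 < T) (hκ : 0 < κ) (hnm : n ≤ m) (hε : 0 < ε)
    (hφ : IsRegular m C 1 0 (kp + km) (fun x s => φ (trunc m x) s))
    (hf : IsTestFunction (kp + km) ε f) :
    Integrable (Theta α ρ T κ N f kp km n m φ ϑ) P := by
  obtain ⟨M, hM0, hM⟩ := hf.exists_bound_mul_invMonom hε (expo kp km)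
  have h := isDominated_comp_mul (α := α) (ρ := ρ) (n := n) hT hκ hnm
    (G := fun p => f p * invMonom (expo kp km) p)
    (hf.contDiff.continuous.measurable.mul (measurable_invMonom _)) hM0 (fun p _ => hM p)
    (isDominated_fullCore (α := α) (ρ := ρ) hC0 hφ)
  refine (h.1.integrable hN hϑ hind hC hCi h.2).congr ?_
  filter_upwards [hN.ae_mem_noiseDomain m] with ω hω
  exact (Theta_eq hC0 hT hκ hnm hφ hω).symm

/-- The iterated integration by parts formula. -/
lemma integral_Theta [IsProbabilityMeasure P] (hα : α ≠ 0) (hα1 : α ≠ 1) (hN : IsDrivingNoise P N) (hϑ : Measurable ϑ)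
    (hind : IndepFun (fun ω => trunc m (N ω)) ϑ P) (hC : Measurable C) (hC0 : ∀ s, 0 ≤ C s)
    (hCi : Integrable (fun ω => C (ϑ ω)) P) (hT : 0 < T) (hκ : 0 < κ) (hnm : n ≤ m) (hε : 0 < ε)
    (hφ : IsRegular m C 1 0 (kp + km) (fun x s => φ (trunc m x) s))
    (hf : IsTestFunction (kp + km) ε f) :
    ∫ ω, Theta α ρ T κ N f kp km n m φ ϑ ω ∂P
      = ∫ ω, mixedDeriv kp km f (approxChi α ρ T κ n (N ω)) * φ (trunc m (N ω)) (ϑ ω) ∂P := by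
  have h1 := integral_iterate_pd_eq (ρ := ρ) hα hα1 hN hϑ hind hC hC0 hCi hT hκ hnm hε (σ := .minus)
    (e := fun j => expo 0 j) (fun j => rfl) (fun j τ hτ => by cases τ <;> simp_all [expo])
    zero_le_one (W := fun x s => φ (trunc m x) s) km (g := (pd .plus)^[kp] f)
    (IsTestFunction.iterate_pd (by rwa [add_comm] at hf) .plus) (hφ.of_add kp)
  have h2 := integral_iterate_pd_eq (ρ := ρ) hα hα1 hN hϑ hind hC hC0 hCi hT hκ hnm hε (σ := .plus)
    (e := fun j => expo j km) (fun j => rfl) (fun j τ hτ => by cases τ <;> simp_all [expo])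
    (mul_nonneg (iterConst_nonneg _ _ _) zero_le_one)
    (W := fun x s => coreIter α ρ m .minus km (fun z => φ (trunc m z) s) x) kp (g := f)
    (hf.of_le (by omega)) (isRegular_coreIter_minus hC0 hφ)
  rw [mixedDeriv_eq hf.contDiff]
  simp only [invMonom_expo_zero, mul_one] at h1
  rw [h1, h2]
  refine integral_congr_ae ?_
  filter_upwards [hN.ae_mem_noiseDomain m] with ω hω
  exact Theta_eq hC0 hT hκ hnm hφ hω

end Weighted

/-! ### Lipschitz bounds for test functions times negative powers. -/

section Lipschitz

/-- Bounded Lipschitz functions on the plane. -/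
def IsBoundedLipschitz (h : ℝ × ℝ → ℝ) : Prop :=
  ∃ M, 0 ≤ M ∧ (∀ p, |h p| ≤ M) ∧ ∀ p p', |h p - h p'| ≤ M * ‖p - p'‖

lemma IsBoundedLipschitz.mul {g h : ℝ × ℝ → ℝ} (hg : IsBoundedLipschitz g)
    (hh : IsBoundedLipschitz h) : IsBoundedLipschitz fun p => g p * h p := by
  obtain ⟨A, hA0, hA, hA'⟩ := hg
  obtain ⟨B, hB0, hB, hB'⟩ := hh
  refine ⟨2 * A * B, by positivity, fun p => ?_, fun p p' => ?_⟩
  · rw [abs_mul]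
    have := mul_le_mul (hA p) (hB p) (abs_nonneg _) hA0
    nlinarith [mul_nonneg hA0 hB0]
  · have e : g p * h p - g p' * h p' = g p * (h p - h p') + (g p - g p') * h p' := by ring
    rw [e]
    refine (abs_add_le _ _).trans ?_
    rw [abs_mul, abs_mul]
    have h1 := mul_le_mul (hA p) (hB' p p') (abs_nonneg _) hA0
    have h2 := mul_le_mul (hA' p p') (hB p') (abs_nonneg _) (by positivity)
    linarith

lemma IsBoundedLipschitz.pow {g : ℝ × ℝ → ℝ} (hg : IsBoundedLipschitz g) (j : ℕ) :
    IsBoundedLipschitz fun p => g p ^ j := by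
  induction j with
  | zero => exact ⟨1, zero_le_one, by simp, by simp⟩
  | succ j ih => simpa only [pow_succ] using ih.mul hg

lemma isBoundedLipschitz_inv_max {ε : ℝ} (hε : 0 < ε) {c : ℝ × ℝ → ℝ}
    (hc : ∀ p p', |c p - c p'| ≤ ‖p - p'‖) :
    IsBoundedLipschitz fun p => (max (c p) ε)⁻¹ := by
  have hpos : ∀ p, 0 < max (c p) ε := fun p => lt_max_of_lt_right hε
  have hinv : ∀ p, (max (c p) ε)⁻¹ ≤ ε⁻¹ := fun p => inv_anti₀ hε (le_max_right _ _)
  refine ⟨ε⁻¹ + ε⁻¹ * ε⁻¹, by positivity, fun p => ?_, fun p p' => ?_⟩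
  · rw [abs_of_pos (inv_pos.2 (hpos p))]
    exact (hinv p).trans (le_add_of_nonneg_right (by positivity))
  · rw [inv_sub_inv (hpos p).ne' (hpos p').ne', abs_div, abs_of_pos (mul_pos (hpos p) (hpos p')),
      div_eq_inv_mul, mul_inv]
    have h1 : |max (c p') ε - max (c p) ε| ≤ ‖p - p'‖ :=
      (abs_max_sub_max_le_abs _ _ _).trans (by rw [abs_sub_comm]; exact hc p p')
    have h2 : (max (c p) ε)⁻¹ * (max (c p') ε)⁻¹ ≤ ε⁻¹ * ε⁻¹ :=
      mul_le_mul (hinv p) (hinv p') (inv_pos.2 (hpos p')).le (by positivity)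
    calc _ ≤ ε⁻¹ * ε⁻¹ * ‖p - p'‖ := mul_le_mul h2 h1 (abs_nonneg _) (by positivity)
      _ ≤ _ := by
        have : 0 ≤ ε⁻¹ * ‖p - p'‖ := by positivity
        nlinarith

lemma IsTestFunction.isBoundedLipschitz {ε : ℝ} {f : ℝ × ℝ → ℝ} (hf : IsTestFunction 1 ε f) :
    IsBoundedLipschitz f := by
  obtain ⟨A, hA0, hA⟩ := hf.exists_bound
  obtain ⟨B, hB⟩ := hf.bounded 1 le_rfl
  have hB' : ∀ p, ‖fderiv ℝ f p‖ ≤ B := fun p => by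
    have := hB p
    rwa [← zero_add 1, ← norm_iteratedFDeriv_fderiv, norm_iteratedFDeriv_zero] at this
  have hB0 : 0 ≤ B := (norm_nonneg _).trans (hB 0)
  refine ⟨A + B, by positivity, fun p => (hA p).trans (by linarith), fun p p' => ?_⟩
  have := Convex.norm_image_sub_le_of_norm_fderiv_le (𝕜 := ℝ) (f := f) (C := B) (s := univ)
    (x := p') (y := p) (fun x _ => hf.contDiff.differentiable (by simp) x) (fun x _ => hB' x)
    convex_univ (mem_univ _) (mem_univ _)
  rw [Real.norm_eq_abs] at this
  exact this.trans (mul_le_mul_of_nonneg_right (by linarith) (norm_nonneg _))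

/-- Replacing each coordinate in the monomial by its maximum with `ε` changes nothing where `f` is
nonzero, and makes the monomial bounded and Lipschitz on the whole plane. -/
lemma IsTestFunction.isBoundedLipschitz_mul_invMonom {ε : ℝ} (hε : 0 < ε) {f : ℝ × ℝ → ℝ}
    (hf : IsTestFunction 1 ε f) (e : PM → ℕ) :
    IsBoundedLipschitz fun p => f p * invMonom e p := by
  have h1 : IsBoundedLipschitz fun p : ℝ × ℝ => (max p.1 ε)⁻¹ :=
    isBoundedLipschitz_inv_max hε fun p p' => norm_fst_le (p - p')
  have h2 : IsBoundedLipschitz fun p : ℝ × ℝ => (max p.2 ε)⁻¹ :=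
    isBoundedLipschitz_inv_max hε fun p p' => norm_snd_le (p - p')
  have h3 := hf.isBoundedLipschitz.mul ((h1.pow (e .plus)).mul (h2.pow (e .minus)))
  have e : (fun p => f p * invMonom e p) = fun p =>
      f p * ((max p.1 ε)⁻¹ ^ e .plus * (max p.2 ε)⁻¹ ^ e .minus) := by
    funext p
    by_cases hp : f p = 0
    · simp [hp]
    · have hs := hf.support_subset hp
      rw [max_eq_left (show ε ≤ p.1 from hs.1), max_eq_left (show ε ≤ p.2 from hs.2), invMonom,
        inv_pow, inv_pow]
  rwa [e]

lemma IsBoundedLipschitz.exists_min {h : ℝ × ℝ → ℝ} (hh : IsBoundedLipschitz h) :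
    ∃ M, 0 ≤ M ∧ ∀ p p', |h p - h p'| ≤ M * min 1 ‖p - p'‖ := by
  obtain ⟨M, hM0, hM, hM'⟩ := hh
  refine ⟨2 * M, by positivity, fun p p' => ?_⟩
  rcases le_total 1 ‖p - p'‖ with h1 | h1
  · rw [min_eq_left h1]
    have := abs_sub (h p) (h p')
    linarith [hM p, hM p']
  · rw [min_eq_right h1]
    have := hM' p p'
    nlinarith [norm_nonneg (p - p')]

end Lipschitz

/-! ### Summability in mean of the level differences. -/

section LevelDifferences

variable {α ρ T κ ε : ℝ} {Ω : Type*} [MeasurableSpace Ω] {P : Measure Ω}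
  {N : Ω → Noise}

lemma min_one_add_le {a b : ℝ} (ha : 0 ≤ a) (hb : 0 ≤ b) : min 1 (a + b) ≤ min 1 a + min 1 b := by
  rcases le_total 1 a with h | h
  · rw [min_eq_left h]
    exact (min_le_left _ _).trans (le_add_of_nonneg_right (le_min zero_le_one hb))
  · rcases le_total 1 b with h' | h'
    · rw [min_eq_left h']
      exact (min_le_left _ _).trans (le_add_of_nonneg_left (le_min zero_le_one ha))
    · rw [min_eq_right h, min_eq_right h']; exact min_le_right _ _

lemma min_one_le_rpow {a p : ℝ} (ha : 0 ≤ a) (hp : 0 < p) (hp1 : p ≤ 1) : min 1 a ≤ a ^ p := by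
  rcases le_total 1 a with h | h
  · rw [min_eq_left h]; exact Real.one_le_rpow h hp.le
  · rw [min_eq_right h]; exact Real.self_le_rpow_of_le_one ha h hp1

variable (α T κ) in
/-- The remainder term of `approxX`. -/
def tailTerm (i : ℕ) (σ : PM) (x : Noise) : ℝ :=
  T ^ (1 / α) * κ ^ i * x (.eta σ) ^ (1 - 1 / α)

lemma tailTerm_nonneg (hT : 0 < T) (hκ : 0 < κ) (i : ℕ) (σ : PM) {x : Noise} {m : ℕ}
    (hx : x ∈ noiseDomain m) : 0 ≤ tailTerm α T κ i σ x := by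
  have := pos_of_mem_noiseDomain hx (l := .eta σ) (by simp)
  unfold tailTerm
  positivity

lemma abs_approxX_succ_sub_le (hT : 0 < T) (hκ : κ ∈ Ioo (0 : ℝ) 1) (i : ℕ) (σ : PM) {x : Noise}
    (hx : x ∈ noiseDomain (i + 1)) :
    |approxX α ρ T κ (i + 1) σ x - approxX α ρ T κ i σ x|
      ≤ jumpTerm α ρ T σ x i + tailTerm α T κ i σ x := by
  have h1 : approxX α ρ T κ (i + 1) σ x - approxX α ρ T κ i σ x
      = jumpTerm α ρ T σ x i - (1 - κ) * tailTerm α T κ i σ x := by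
    simp only [approxX, Finset.sum_range_succ, tailTerm, pow_succ]
    ring
  have h2 := jumpTerm_nonneg (α := α) (ρ := ρ) hT hx (Nat.lt_succ_self i) σ
  have h3 := tailTerm_nonneg (α := α) hT hκ.1 i σ hx
  have h4 := hκ.1
  have h5 := hκ.2
  rw [h1]
  exact abs_le.2 ⟨by nlinarith, by nlinarith⟩

/-- The increments may have infinite mean. Truncation at one remedies this: `min 1 a ≤ a ^ p` for `p
≤ 1` reduces everything to the small moments already controlled. -/
lemma min_one_norm_sub_le (hα : 0 < α) (hT : 0 < T) (hκ : κ ∈ Ioo (0 : ℝ) 1) (i : ℕ) {x : Noise}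
    (hx : x ∈ noiseDomain (i + 1)) :
    min 1 ‖approxChi α ρ T κ (i + 1) x - approxChi α ρ T κ i x‖
      ≤ (jumpTerm α ρ T .plus x i ^ smallExp α + tailTerm α T κ i .plus x ^ smallExp α)
        + (jumpTerm α ρ T .minus x i ^ smallExp α + tailTerm α T κ i .minus x ^ smallExp α) := by
  have hp := smallExp_pos hα
  have hp1 := smallExp_le_one hα
  have key : ∀ σ, min 1 |approxX α ρ T κ (i + 1) σ x - approxX α ρ T κ i σ x|
      ≤ jumpTerm α ρ T σ x i ^ smallExp α + tailTerm α T κ i σ x ^ smallExp α := by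
    intro σ
    have h2 := jumpTerm_nonneg (α := α) (ρ := ρ) hT hx (Nat.lt_succ_self i) σ
    have h3 := tailTerm_nonneg (α := α) hT hκ.1 i σ hx
    exact (min_le_min_left 1 (abs_approxX_succ_sub_le hT hκ i σ hx)).trans
      ((min_one_add_le h2 h3).trans
        (add_le_add (min_one_le_rpow h2 hp hp1) (min_one_le_rpow h3 hp hp1)))
  have hnorm : ‖approxChi α ρ T κ (i + 1) x - approxChi α ρ T κ i x‖
      ≤ |approxX α ρ T κ (i + 1) .plus x - approxX α ρ T κ i .plus x|
        + |approxX α ρ T κ (i + 1) .minus x - approxX α ρ T κ i .minus x| :=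
    max_le (le_add_of_nonneg_right (abs_nonneg _)) (le_add_of_nonneg_left (abs_nonneg _))
  exact (min_le_min_left 1 hnorm).trans ((min_one_add_le (abs_nonneg _) (abs_nonneg _)).trans
    (add_le_add (key .plus) (key .minus)))

lemma IsDrivingNoise.exists_tailTerm_moment (hN : IsDrivingNoise P N) (hα : 0 < α) (hT : 0 < T)
    (hκ : κ ∈ Ioo (0 : ℝ) 1) :
    ∃ B, 0 ≤ B ∧ ∀ i σ, Integrable (fun ω => tailTerm α T κ i σ (N ω) ^ smallExp α) P ∧
      ∫ ω, tailTerm α T κ i σ (N ω) ^ smallExp α ∂P ≤ B * (κ ^ smallExp α) ^ i := by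
  have hp := smallExp_pos hα
  have hκ0 := hκ.1
  set s := smallExp α * (1 - 1 / α) with hs
  have hi := integrable_rpow_expMeasure (neg_one_lt_smallExp_mul hα)
  set A := ∫ t, t ^ s ∂(expMeasure 1) with hA
  have hA0 : 0 ≤ A := integral_nonneg_of_ae
    (ae_expMeasure_pos.mono fun t ht => Real.rpow_nonneg ht.le _)
  refine ⟨(T ^ (1 / α)) ^ smallExp α * A, by positivity, fun i σ => ?_⟩
  have hmap := hN.law_eta σ
  have hm := hN.measurable (.eta σ)
  have e : (fun ω => tailTerm α T κ i σ (N ω) ^ smallExp α) =ᵐ[P] fun ω =>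
      (T ^ (1 / α)) ^ smallExp α * (κ ^ smallExp α) ^ i * N ω (.eta σ) ^ s := by
    filter_upwards [hN.ae_mem_noiseDomain 0] with ω hω
    have := pos_of_mem_noiseDomain hω (l := .eta σ) (by simp)
    rw [tailTerm, Real.mul_rpow (by positivity) (by positivity),
      Real.mul_rpow (by positivity) (by positivity), ← Real.rpow_mul this.le, hs,
      mul_comm (1 - 1 / α), ← Real.rpow_natCast, ← Real.rpow_natCast, ← Real.rpow_mul hκ0.le,
      ← Real.rpow_mul hκ0.le, mul_comm (i : ℝ)]
  rw [← hmap] at hi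
  have hi2 : Integrable (fun ω => N ω (.eta σ) ^ s) P := hi.comp_measurable hm
  refine ⟨(hi2.const_mul _).congr e.symm, ?_⟩
  have hint : ∫ ω, N ω (.eta σ) ^ s ∂P = A := by
    rw [hA, ← hmap, integral_map hm.aemeasurable hi.1]
  rw [integral_congr_ae e, integral_const_mul, hint]
  exact le_of_eq (by ring)

/-- The increments of `approxChi` decay geometrically in a truncated mean. -/
lemma IsDrivingNoise.exists_increment_moment (hN : IsDrivingNoise P N) (hα : α ∈ Ioo (0 : ℝ) 2)
    (hα1 : α ≠ 1) (hρ : ρ ∈ Icc (1 - 1 / α) (1 / α) ∩ Ioo (0 : ℝ) 1) (hT : 0 < T)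
    (hκ : κ ∈ Ioo (0 : ℝ) 1) :
    ∃ B, 0 ≤ B ∧ ∃ θ, 0 < θ ∧ θ < 1 ∧ ∀ i,
      ∫ ω, min 1 ‖approxChi α ρ T κ (i + 1) (N ω) - approxChi α ρ T κ i (N ω)‖ ∂P ≤ B * θ ^ i := by
  obtain ⟨B, hB, θ, hθ0, hθ1, h⟩ := hN.exists_jumpTerm_moment hα hα1 hρ hT
  obtain ⟨B', hB', h'⟩ := hN.exists_tailTerm_moment hα.1 hT hκ
  have hp := smallExp_pos hα.1
  have hκp : κ ^ smallExp α < 1 := Real.rpow_lt_one hκ.1.le hκ.2 hp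
  have hκ0 := hκ.1
  refine ⟨2 * (B + B'), by positivity, max θ (κ ^ smallExp α), lt_max_of_lt_left hθ0,
    max_lt hθ1 hκp, fun i => ?_⟩
  have hle : ∀ σ, Integrable (fun ω => jumpTerm α ρ T σ (N ω) i ^ smallExp α
      + tailTerm α T κ i σ (N ω) ^ smallExp α) P ∧
      ∫ ω, (jumpTerm α ρ T σ (N ω) i ^ smallExp α + tailTerm α T κ i σ (N ω) ^ smallExp α) ∂P
      ≤ (B + B') * max θ (κ ^ smallExp α) ^ i := by
    intro σ
    refine ⟨(h i σ).1.add (h' i σ).1, ?_⟩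
    rw [integral_add (h i σ).1 (h' i σ).1, add_mul]
    refine add_le_add ((h i σ).2.trans ?_) ((h' i σ).2.trans ?_)
    · gcongr; exact le_max_left _ _
    · gcongr; exact le_max_right _ _
  calc _ ≤ ∫ ω, ((jumpTerm α ρ T .plus (N ω) i ^ smallExp α
            + tailTerm α T κ i .plus (N ω) ^ smallExp α)
          + (jumpTerm α ρ T .minus (N ω) i ^ smallExp α
            + tailTerm α T κ i .minus (N ω) ^ smallExp α)) ∂P := by
        refine integral_mono_of_nonneg (Eventually.of_forall fun ω =>
          le_min zero_le_one (norm_nonneg _)) ((hle .plus).1.add (hle .minus).1) ?_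
        filter_upwards [hN.ae_mem_noiseDomain (i + 1)] with ω hω
        exact min_one_norm_sub_le hα.1 hT hκ i hω
    _ ≤ _ := by
        rw [integral_add (hle .plus).1 (hle .minus).1]
        have h1 := (hle .plus).2
        have h2 := (hle .minus).2
        linarith

/-- Young's inequality with a free constant, in place of Cauchy-Schwarz, to separate the small
increment from the large gauge. -/
lemma mul_le_of_pos {a b c : ℝ} (hc : 0 < c) : a * b ≤ c⁻¹ * a ^ 2 + c * b ^ 2 := by
  have h := sq_nonneg (a - c * b)
  have h2 : c * (a * b) ≤ a ^ 2 + c * (c * b ^ 2) := by nlinarith [sq_nonneg a, sq_nonneg (c * b)]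
  have h3 : a * b = c⁻¹ * (c * (a * b)) := by field_simp
  rw [h3]
  calc _ ≤ c⁻¹ * (a ^ 2 + c * (c * b ^ 2)) :=
        mul_le_mul_of_nonneg_left h2 (inv_pos.2 hc).le
    _ = _ := by field_simp

/-- The truncated increments, weighted by a power of the gauge, are summable in mean. -/
lemma IsDrivingNoise.summable_increment_gauge [IsProbabilityMeasure P]
    (hN : IsDrivingNoise P N) (hα : α ∈ Ioo (0 : ℝ) 2)
    (hα1 : α ≠ 1) (hρ : ρ ∈ Icc (1 - 1 / α) (1 / α) ∩ Ioo (0 : ℝ) 1) (hT : 0 < T)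
    (hκ : κ ∈ Ioo (0 : ℝ) 1) (r : ℕ) :
    (∀ i, Integrable (fun ω => min 1 ‖approxChi α ρ T κ (i + 1) (N ω) - approxChi α ρ T κ i (N ω)‖
      * noiseGauge (i + 1) (N ω) ^ r) P) ∧
    Summable fun i => ∫ ω, min 1 ‖approxChi α ρ T κ (i + 1) (N ω) - approxChi α ρ T κ i (N ω)‖
      * noiseGauge (i + 1) (N ω) ^ r ∂P := by
  obtain ⟨B, hB, θ, hθ0, hθ1, h⟩ := hN.exists_increment_moment hα hα1 hρ hT hκ
  set a : ℕ → Ω → ℝ := fun i ω =>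
    min 1 ‖approxChi α ρ T κ (i + 1) (N ω) - approxChi α ρ T κ i (N ω)‖ with ha
  have ha0 : ∀ i ω, 0 ≤ a i ω := fun i ω => le_min zero_le_one (norm_nonneg _)
  have ha1 : ∀ i ω, a i ω ≤ 1 := fun i ω => min_le_left _ _
  have ham : ∀ i, Measurable (a i) := fun i => measurable_const.min
    ((measurable_approxChi.comp hN.measurable_noise).sub
      (measurable_approxChi.comp hN.measurable_noise)).norm
  have hai : ∀ i, Integrable (a i) P := fun i => by
    refine Integrable.of_bound (ham i).aestronglyMeasurable 1 (Eventually.of_forall fun ω => ?_)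
    rw [Real.norm_of_nonneg (ha0 i ω)]; exact ha1 i ω
  have hint : ∀ i, Integrable (fun ω => a i ω * noiseGauge (i + 1) (N ω) ^ r) P := fun i => by
    refine (hN.integrable_gauge_pow (i + 1) r).bdd_mul (c := 1) (ham i).aestronglyMeasurable
      (Eventually.of_forall fun ω => ?_)
    rw [Real.norm_of_nonneg (ha0 i ω)]; exact ha1 i ω
  refine ⟨hint, ?_⟩
  -- With the constant `β ^ i` in Young's inequality, the decay `θ ^ i` is shared equally: the
  -- increment contributes `β ^ (-i) θ ^ i = β ^ i`, and the gauge moment keeps a factor `β ^ i`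
  -- against its polynomial growth.
  set β := Real.sqrt θ with hβ
  have hβ0 : 0 < β := Real.sqrt_pos.2 hθ0
  have hβ1 : β < 1 := by rw [hβ, Real.sqrt_lt' one_pos]; simpa
  have hβθ : β * β = θ := Real.mul_self_sqrt hθ0.le
  have hbound : ∀ i, ∫ ω, a i ω * noiseGauge (i + 1) (N ω) ^ r ∂P
      ≤ B * β ^ i + β ^ i * ((((i + 3 : ℕ) : ℝ)) ^ (r * 2 + 1) * gaugeMoment (r * 2)) := by
    intro i
    have hg := hN.integrable_gauge_pow (i + 1) (r * 2)
    calc _ ≤ ∫ ω, ((β ^ i)⁻¹ * a i ω + β ^ i * noiseGauge (i + 1) (N ω) ^ (r * 2)) ∂P := by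
          refine integral_mono (hint i) (((hai i).const_mul _).add (hg.const_mul _)) fun ω => ?_
          refine (mul_le_of_pos (pow_pos hβ0 i)).trans ?_
          rw [← pow_mul]
          have : a i ω ^ 2 ≤ a i ω := by nlinarith [ha0 i ω, ha1 i ω]
          gcongr
      _ = (β ^ i)⁻¹ * ∫ ω, a i ω ∂P + β ^ i * ∫ ω, noiseGauge (i + 1) (N ω) ^ (r * 2) ∂P := by
          rw [integral_add ((hai i).const_mul _) (hg.const_mul _), integral_const_mul,
            integral_const_mul]
      _ ≤ (β ^ i)⁻¹ * (B * θ ^ i) + β ^ i * ((((i + 1 : ℕ) : ℝ) + 2) ^ (r * 2 + 1)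
            * gaugeMoment (r * 2)) := by
          gcongr
          · exact h i
          · exact hN.integral_gauge_pow_le (i + 1) (r * 2)
      _ = _ := by
          rw [← hβθ, mul_pow]
          have : β ^ i ≠ 0 := (pow_pos hβ0 i).ne'
          push_cast
          rw [show ((i : ℝ) + 1 + 2) = i + 3 by ring]
          field_simp
  refine Summable.of_nonneg_of_le (fun i => ?_) hbound ?_
  · refine integral_nonneg_of_ae ?_
    filter_upwards [hN.ae_mem_noiseDomain (i + 1)] with ω hω
    exact mul_nonneg (ha0 i ω) (pow_nonneg (zero_le_one.trans (one_le_gauge hω)) _)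
  · refine ((summable_geometric_of_lt_one hβ0.le hβ1).mul_left B).add ?_
    have h1 : Summable fun i : ℕ => (i : ℝ) ^ (r * 2 + 1) * β ^ i :=
      summable_pow_mul_geometric_of_norm_lt_one _ (by rwa [Real.norm_of_nonneg hβ0.le])
    have h2 := ((summable_nat_add_iff 3).2 h1).mul_left ((β ^ 3)⁻¹ * gaugeMoment (r * 2))
    refine h2.congr fun i => ?_
    rw [pow_add β i 3]
    have : β ^ 3 ≠ 0 := (pow_pos hβ0 3).ne'
    field_simp

/-- Uniform control of one level difference. -/
lemma integral_abs_Theta_sub_le {S : Type*} [MeasurableSpace S] {i kp km : ℕ}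
    {φ : Coord (i + 1) → S → ℝ} {ϑ : Ω → S} {C : S → ℝ} {f : ℝ × ℝ → ℝ} {M : ℝ}
    (hN : IsDrivingNoise P N)
    (hind : IndepFun (fun ω => trunc (i + 1) (N ω)) ϑ P) (hC : Measurable C) (hC0 : ∀ s, 0 ≤ C s)
    (hCi : Integrable (fun ω => C (ϑ ω)) P) (hT : 0 < T) (hκ : 0 < κ)
    (hφ : IsRegular (i + 1) C 1 0 (kp + km) (fun x s => φ (trunc (i + 1) x) s)) (hM0 : 0 ≤ M)
    (hM : ∀ p p', |f p * invMonom (expo kp km) p - f p' * invMonom (expo kp km) p'|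
      ≤ M * min 1 ‖p - p'‖)
    (hint : Integrable (fun ω => min 1
      ‖approxChi α ρ T κ (i + 1) (N ω) - approxChi α ρ T κ i (N ω)‖
        * noiseGauge (i + 1) (N ω) ^ (0 + 2 * km + 2 * kp)) P) :
    ∫ ω, |Theta α ρ T κ N f kp km (i + 1) (i + 1) φ ϑ ω
        - Theta α ρ T κ N f kp km i (i + 1) φ ϑ ω| ∂P
      ≤ M * fullConst α kp km * (∫ ω, min 1
        ‖approxChi α ρ T κ (i + 1) (N ω) - approxChi α ρ T κ i (N ω)‖
          * noiseGauge (i + 1) (N ω) ^ (0 + 2 * km + 2 * kp) ∂P) * ∫ ω, C (ϑ ω) ∂P := by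
  set r := 0 + 2 * km + 2 * kp
  set F : Noise → ℝ := fun x => min 1 ‖approxChi α ρ T κ (i + 1) x - approxChi α ρ T κ i x‖
    * noiseGauge (i + 1) x ^ r with hF
  have hFm : Measurable F := (measurable_const.min
    (measurable_approxChi.sub measurable_approxChi).norm).mul ((measurable_gauge _).pow_const _)
  have hdep : ∀ x y, (∀ k ∈ levelIdx (i + 1), x k = y k) → F x = F y := fun x y h => by
    simp only [hF, approxChi, approxX_congr (n := i + 1) le_rfl h,
      approxX_congr (n := i) (Nat.le_succ i) h, gauge_congr h]
  -- The bound on the noise has level `i + 1`, so it is independent of `C(ϑ)` and the mean of the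
  -- product factorises, with no higher moment of `C(ϑ)` required.
  have hi := indepFun_of_congr hind hFm hdep hC
  have hK := fullConst_nonneg α kp km
  have hdom := isDominated_fullCore (α := α) (ρ := ρ) hC0 hφ
  calc _ ≤ ∫ ω, M * fullConst α kp km * (F (N ω) * C (ϑ ω)) ∂P := by
        refine integral_mono_of_nonneg (Eventually.of_forall fun ω => abs_nonneg _)
          ((hi.integrable_mul hint hCi).const_mul _) ?_
        filter_upwards [hN.ae_mem_noiseDomain (i + 1)] with ω hω
        rw [Theta_eq hC0 hT hκ le_rfl hφ hω, Theta_eq hC0 hT hκ (Nat.le_succ i) hφ hω, ← sub_mul,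
          abs_mul]
        have h1 := hM (approxChi α ρ T κ (i + 1) (N ω)) (approxChi α ρ T κ i (N ω))
        have h2 := hdom.2 _ hω (ϑ ω)
        refine (mul_le_mul h1 h2 (abs_nonneg _)
          (mul_nonneg hM0 (le_min zero_le_one (norm_nonneg _)))).trans_eq ?_
        simp only [hF]
        ring
    _ = _ := by
        rw [integral_const_mul, hi.integral_fun_mul_eq_mul_integral hint.1 hCi.1]
        ring

end LevelDifferences

/-! ### Passage to the limit in `n` and assembly of the series. -/

section Limits

variable {α ρ T κ ε : ℝ} {Ω : Type*} [MeasurableSpace Ω] {P : Measure Ω} {N : Ω → Noise}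

lemma IsSmoothRep.exists_regular {S : Type*} [MetricSpace S] [MeasurableSpace S] [BorelSpace S]
    {m : ℕ} {φ : Coord m → S → ℝ} {ϑ : Ω → S} {Φ : Ω → ℝ} (h : IsSmoothRep P N m φ ϑ Φ)
    {K : ℕ → ℝ} (hK : ∀ j, DerivBoundedInMean P m φ ϑ j (K j)) (k : ℕ) :
    ∃ C : S → ℝ, Measurable C ∧ (∀ s, 0 ≤ C s) ∧ Integrable (fun ω => C (ϑ ω)) P ∧
      ∫ ω, C (ϑ ω) ∂P ≤ ∑ j ∈ Finset.range (k + 1), K j ∧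
      IsRegular m C 1 0 k (fun x s => φ (trunc m x) s) := by
  obtain ⟨C, h1, h2, h3, h4, h5⟩ := exists_common_bound k hK
  exact ⟨C, h1, h2, h4, h5, isRegular_rep h.continuousOn h.contDiffOn k h3⟩

lemma tendsto_approxX (hκ : κ ∈ Ioo (0 : ℝ) 1) {σ : PM} {x : Noise}
    (h : Summable (jumpTerm α ρ T σ x)) :
    Tendsto (fun n => approxX α ρ T κ n σ x) atTop (𝓝 (limX α ρ T σ x)) := by
  have h1 := h.hasSum.tendsto_sum_nat
  have h2 : Tendsto (fun n : ℕ => T ^ (1 / α) * κ ^ n * x (.eta σ) ^ (1 - 1 / α)) atTop (𝓝 0) := by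
    simpa using ((tendsto_pow_atTop_nhds_zero_of_lt_one hκ.1.le hκ.2).const_mul
      (T ^ (1 / α))).mul_const (x (.eta σ) ^ (1 - 1 / α))
  have h3 := h1.add h2
  rw [add_zero] at h3
  exact h3

lemma tendsto_approxChi (hκ : κ ∈ Ioo (0 : ℝ) 1) {x : Noise}
    (h : ∀ σ, Summable (jumpTerm α ρ T σ x)) :
    Tendsto (fun n => approxChi α ρ T κ n x) atTop (𝓝 (limChi α ρ T x)) :=
  (tendsto_approxX hκ (h .plus)).prodMk_nhds (tendsto_approxX hκ (h .minus))

/-- Dominated convergence along `approxChi`. -/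
lemma IsDrivingNoise.tendsto_integral_comp_approxChi (hN : IsDrivingNoise P N)
    (hκ : κ ∈ Ioo (0 : ℝ) 1) (hsum : ∀ᵐ ω ∂P, ∀ σ, Summable (jumpTerm α ρ T σ (N ω)))
    {g : ℝ × ℝ → ℝ} (hg : Continuous g) {M : ℝ} (hM : ∀ p, |g p| ≤ M) {Φ : Ω → ℝ}
    (hΦ : Integrable Φ P) :
    (∀ n, Integrable (fun ω => g (approxChi α ρ T κ n (N ω)) * Φ ω) P) ∧
    Integrable (fun ω => g (limChi α ρ T (N ω)) * Φ ω) P ∧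
    Tendsto (fun n => ∫ ω, g (approxChi α ρ T κ n (N ω)) * Φ ω ∂P) atTop
      (𝓝 (∫ ω, g (limChi α ρ T (N ω)) * Φ ω ∂P)) := by
  have hmeas : ∀ n, AEStronglyMeasurable (fun ω => g (approxChi α ρ T κ n (N ω)) * Φ ω) P :=
    fun n => (hg.measurable.comp
      (measurable_approxChi.comp hN.measurable_noise)).aestronglyMeasurable.mul hΦ.1
  have hlim : ∀ᵐ ω ∂P, Tendsto (fun n => g (approxChi α ρ T κ n (N ω)) * Φ ω) atTop
      (𝓝 (g (limChi α ρ T (N ω)) * Φ ω)) := by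
    filter_upwards [hsum] with ω hω
    exact ((hg.tendsto _).comp (tendsto_approxChi hκ hω)).mul_const _
  have hb : ∀ p ω, ‖g p * Φ ω‖ ≤ M * ‖Φ ω‖ := fun p ω => by
    rw [norm_mul]; exact mul_le_mul_of_nonneg_right (hM p) (norm_nonneg _)
  have hbi : Integrable (fun ω => M * ‖Φ ω‖) P := hΦ.norm.const_mul M
  exact ⟨fun n => hbi.mono' (hmeas n) (Eventually.of_forall fun ω => hb _ ω),
    hbi.mono' (aestronglyMeasurable_of_tendsto_ae atTop hmeas hlim)
      (Eventually.of_forall fun ω => hb _ ω),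
    tendsto_integral_of_dominated_convergence _ hmeas hbi
      (fun n => Eventually.of_forall fun ω => hb _ ω) hlim⟩

/-- A series whose terms are summable in mean converges almost surely to an integrable limit. -/
lemma exists_ae_tendsto_of_summable {A : Ω → ℝ} {D : ℕ → Ω → ℝ} {n : ℕ} {L : ℝ}
    (hA : Integrable A P) (hD : ∀ i, n ≤ i → Integrable (D i) P)
    (hs : Summable fun i => ∫ ω, |D (n + i) ω| ∂P)
    (hL : Tendsto (fun M => (∫ ω, A ω ∂P) + ∑ i ∈ Finset.Ico n M, ∫ ω, D i ω ∂P) atTop (𝓝 L)) :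
    ∃ Z : Ω → ℝ, Integrable Z P ∧
      (∀ᵐ ω ∂P, Tendsto (fun M => A ω + ∑ i ∈ Finset.Ico n M, D i ω) atTop (𝓝 (Z ω))) ∧
      L = ∫ ω, Z ω ∂P := by
  have hDi : ∀ i, Integrable (D (n + i)) P := fun i => hD _ (by omega)
  have hshift : ∀ {a : ℝ} {d : ℕ → ℝ} {s : ℝ}, HasSum (fun i => d (n + i)) s →
      Tendsto (fun M => a + ∑ i ∈ Finset.Ico n M, d i) atTop (𝓝 (a + s)) := by
    intro a d s h
    refine Tendsto.const_add a ?_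
    rw [← tendsto_add_atTop_iff_nat n]
    refine h.tendsto_sum_nat.congr fun M => ?_
    rw [Finset.sum_Ico_eq_sum_range, Nat.add_sub_cancel]
  have hti := integrable_tsum_of_summable_integral hDi hs
  refine ⟨fun ω => A ω + ∑' i, D (n + i) ω, hA.add hti, ?_, ?_⟩
  · filter_upwards [ae_summable_of_summable_integral hDi hs] with ω hω
    exact hshift hω.hasSum
  · rw [integral_add hA hti]
    exact tendsto_nhds_unique hL
      (hshift (hasSum_integral_of_summable_integral_norm (F := fun i => D (n + i)) hDi hs))

lemma add_sum_Ico_sub {n M : ℕ} (h : n ≤ M) (a : ℕ → ℝ) :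
    a n + ∑ i ∈ Finset.Ico n M, (a (i + 1) - a i) = a M := by
  rw [Finset.sum_Ico_sub a h]; ring

end Limits

end StableIBP

end

theorem theorem3p5
    (α ρ T κ ε : ℝ) (hα : α ∈ Ioo (0 : ℝ) 2) (hα1 : α ≠ 1)
    (hρ : ρ ∈ Icc (1 - 1 / α) (1 / α) ∩ Ioo (0 : ℝ) 1)
    (hT : 0 < T) (hκ : κ ∈ Ioo (0 : ℝ) 1) (hε : 0 < ε)
    {Ω : Type*} [MeasurableSpace Ω] (P : Measure Ω) [IsProbabilityMeasure P]
    (N : Ω → Noise) (hN : IsDrivingNoise P N)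
    {S : ℕ → Type*} [∀ m, MetricSpace (S m)] [∀ m, MeasurableSpace (S m)]
    [∀ m, BorelSpace (S m)]
    (Φ : Ω → ℝ) (φ : ∀ m, Coord m → S m → ℝ) (ϑ : ∀ m, Ω → S m)
    (hΦ : ∀ m, 1 ≤ m → IsSmoothRep P N m (φ m) (ϑ m) Φ)
    (n : ℕ) (hn : 1 ≤ n) (kp km : ℕ)
    (f : ℝ × ℝ → ℝ) (hf : IsTestFunction (kp + km) ε f) :
    -- the series defining `χ` converge, and every expectation below exists
    (∀ σ, ∀ᵐ ω ∂P, Summable (jumpTerm α ρ T σ (N ω))) ∧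
    Integrable (fun ω => mixedDeriv kp km f (limChi α ρ T (N ω)) * Φ ω) P ∧
    (∀ i m, 1 ≤ i → i ≤ m → Integrable (Theta α ρ T κ N f kp km i m (φ m) (ϑ m)) P) ∧
    -- the multilevel formula, as a convergent series of expectations
    Tendsto (fun M => (∫ ω, Theta α ρ T κ N f kp km n n (φ n) (ϑ n) ω ∂P)
        + ∑ i ∈ Finset.Ico n M, ∫ ω, levelDiff α ρ T κ N f kp km φ ϑ i ω ∂P)
      atTop (𝓝 (∫ ω, mixedDeriv kp km f (limChi α ρ T (N ω)) * Φ ω ∂P)) ∧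
    -- the multilevel formula, as the expectation of a series that converges almost surely
    (((∀ j, ∃ K, ∀ m, 1 ≤ m → DerivBoundedInMean P m (φ m) (ϑ m) j K) ∨
        Summable (fun i => ∫ ω, |levelDiff α ρ T κ N f kp km φ ϑ (n + i) ω| ∂P)) →
      ∃ Z : Ω → ℝ, Integrable Z P ∧
        (∀ᵐ ω ∂P, Tendsto (fun M => Theta α ρ T κ N f kp km n n (φ n) (ϑ n) ω
            + ∑ i ∈ Finset.Ico n M, levelDiff α ρ T κ N f kp km φ ϑ i ω) atTop (𝓝 (Z ω))) ∧
        (∫ ω, mixedDeriv kp km f (limChi α ρ T (N ω)) * Φ ω ∂P) = ∫ ω, Z ω ∂P) := by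
  have hα0 := hα.1
  have hsum : ∀ σ, ∀ᵐ ω ∂P, Summable (jumpTerm α ρ T σ (N ω)) :=
    fun σ => hN.ae_summable_jumpTerm hα hα1 hρ hT σ
  have hsum' : ∀ᵐ ω ∂P, ∀ σ, Summable (jumpTerm α ρ T σ (N ω)) := by
    filter_upwards [hsum .plus, hsum .minus] with ω h1 h2 σ
    cases σ; exacts [h1, h2]
  have hreg : ∀ m, 1 ≤ m → ∃ C : S m → ℝ, Measurable C ∧ (∀ s, 0 ≤ C s) ∧
      Integrable (fun ω => C (ϑ m ω)) P ∧
      IsRegular m C 1 0 (kp + km) (fun x s => φ m (trunc m x) s) := by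
    intro m hm
    choose K hK using (hΦ m hm).bounded
    obtain ⟨C, h1, h2, h3, -, h4⟩ := (hΦ m hm).exists_regular hK (kp + km)
    exact ⟨C, h1, h2, h3, h4⟩
  have hΦi : Integrable Φ P := by
    obtain ⟨C, h1, h2, h3, h4⟩ := hreg 1 le_rfl
    have hr := hΦ 1 le_rfl
    exact (h4.dominated.1.integrable hN hr.measurable hr.indep h1 h3 h4.dominated.2).congr
      hr.eq_rep.symm
  have hTi : ∀ i m, 1 ≤ i → i ≤ m →
      Integrable (Theta α ρ T κ N f kp km i m (φ m) (ϑ m)) P := by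
    intro i m hi him
    have hm : 1 ≤ m := hi.trans him
    obtain ⟨C, h1, h2, h3, h4⟩ := hreg m hm
    exact integrable_Theta hN (hΦ m hm).measurable (hΦ m hm).indep h1 h2 h3 hT hκ.1 him hε h4 hf
  set I : ℕ → ℝ := fun i => ∫ ω, mixedDeriv kp km f (approxChi α ρ T κ i (N ω)) * Φ ω ∂P with hI
  -- The mean forgets both `m` and the representation of that level, so each level difference has
  -- mean `I (i + 1) - I i` and the sum telescopes even though the chosen representations are
  -- unrelated.
  have hTI : ∀ i m, 1 ≤ i → i ≤ m →
      ∫ ω, Theta α ρ T κ N f kp km i m (φ m) (ϑ m) ω ∂P = I i := by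
    intro i m hi him
    have hm : 1 ≤ m := hi.trans him
    obtain ⟨C, h1, h2, h3, h4⟩ := hreg m hm
    rw [integral_Theta hα0.ne' hα1 hN (hΦ m hm).measurable (hΦ m hm).indep h1 h2 h3 hT hκ.1 him hε
      h4 hf]
    refine integral_congr_ae ?_
    filter_upwards [(hΦ m hm).eq_rep] with ω hω
    rw [hω]
  have hmix : IsTestFunction 0 ε (mixedDeriv kp km f) := by
    rw [mixedDeriv_eq hf.contDiff]
    have h1 : IsTestFunction (km + kp) ε f := by rwa [add_comm] at hf
    have h2 := h1.iterate_pd .plus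
    rw [← zero_add km] at h2
    exact h2.iterate_pd .minus
  obtain ⟨M, -, hM⟩ := hmix.exists_bound
  obtain ⟨-, hli, hlim⟩ := hN.tendsto_integral_comp_approxChi hκ hsum' hmix.contDiff.continuous hM hΦi
  have hLD : ∀ i, 1 ≤ i → Integrable (levelDiff α ρ T κ N f kp km φ ϑ i) P := fun i hi =>
    (hTi (i + 1) (i + 1) (by omega) le_rfl).sub (hTi i (i + 1) hi (by omega))
  have hser : Tendsto (fun M => (∫ ω, Theta α ρ T κ N f kp km n n (φ n) (ϑ n) ω ∂P)
        + ∑ i ∈ Finset.Ico n M, ∫ ω, levelDiff α ρ T κ N f kp km φ ϑ i ω ∂P)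
      atTop (𝓝 (∫ ω, mixedDeriv kp km f (limChi α ρ T (N ω)) * Φ ω ∂P)) := by
    refine hlim.congr' ?_
    filter_upwards [eventually_ge_atTop n] with M hM
    rw [hTI n n hn le_rfl, Finset.sum_congr rfl fun i hi => ?_]
    · exact (add_sum_Ico_sub hM I).symm
    · have hi' : 1 ≤ i := hn.trans (Finset.mem_Ico.1 hi).1
      simp only [levelDiff]
      rw [integral_sub (hTi (i + 1) (i + 1) (by omega) le_rfl) (hTi i (i + 1) hi' (by omega)),
        hTI (i + 1) (i + 1) (by omega) le_rfl, hTI i (i + 1) hi' (by omega)]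
  refine ⟨hsum, hli, hTi, hser, fun hcase => ?_⟩
  have hof : Summable (fun i => ∫ ω, |levelDiff α ρ T κ N f kp km φ ϑ (n + i) ω| ∂P) → _ :=
    fun hs => exists_ae_tendsto_of_summable (hTi n n hn le_rfl) (fun i hi => hLD i (hn.trans hi))
      hs hser
  rcases hcase with hunif | hs
  -- In order zero `f` is merely continuous and the Lipschitz estimate is lost. There are no
  -- weights, though, so the partial sums equal `f(χ_M) Φ` almost surely, and the integrable limit
  -- `f(χ) Φ` serves as the witness.
  · by_cases hk : kp + km = 0
    · obtain ⟨rfl, rfl⟩ : kp = 0 ∧ km = 0 := by omega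
      refine ⟨_, hli, ?_, rfl⟩
      have hrep : ∀ᵐ ω ∂P, ∀ m, 1 ≤ m → Φ ω = φ m (trunc m (N ω)) (ϑ m ω) := by
        rw [ae_all_iff]
        intro m
        by_cases hm : 1 ≤ m
        · filter_upwards [(hΦ m hm).eq_rep] with ω hω _ using hω
        · exact Eventually.of_forall fun ω h => absurd h hm
      filter_upwards [hrep, hsum'] with ω hω hsω
      have hT0 : ∀ i m, 1 ≤ m → Theta α ρ T κ N f 0 0 i m (φ m) (ϑ m) ω
          = f (approxChi α ρ T κ i (N ω)) * Φ ω := fun i m hm => by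
        rw [hω m hm]; rfl
      have hmd : mixedDeriv 0 0 f = f := by funext p; simp [mixedDeriv]
      rw [hmd]
      refine (((hf.contDiff.continuous.tendsto _).comp
        (tendsto_approxChi hκ hsω)).mul_const (Φ ω)).congr' ?_
      filter_upwards [eventually_ge_atTop n] with M hM
      simp only [levelDiff]
      rw [hT0 n n hn, Finset.sum_congr rfl fun i _ => by
        rw [hT0 (i + 1) (i + 1) (by omega), hT0 i (i + 1) (by omega)]]
      exact (add_sum_Ico_sub hM fun i => f (approxChi α ρ T κ i (N ω)) * Φ ω).symm
    · refine hof ?_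
      choose K hK using hunif
      have hf1 : IsTestFunction 1 ε f := hf.of_le (by omega)
      obtain ⟨M, hM0, hM⟩ :=
        (hf1.isBoundedLipschitz_mul_invMonom hε (expo kp km)).exists_min
      -- The exponent is the degree of `fullCore` in the gauge. It is the same at all levels, as is
      -- `fullConst`, so the uniform bounds `K j` on the means of `C` complete the comparison.
      obtain ⟨hgi, hgs⟩ := hN.summable_increment_gauge hα hα1 hρ hT hκ (0 + 2 * km + 2 * kp)
      have hgs' := (hgs.comp_injective (add_right_injective n)).mul_left
        (M * fullConst α kp km * ∑ j ∈ Finset.range (kp + km + 1), K j)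
      refine Summable.of_nonneg_of_le (fun i => integral_nonneg fun ω => abs_nonneg _)
        (fun i => ?_) hgs'
      have hm : 1 ≤ n + i + 1 := by omega
      obtain ⟨C, h1, h2, h3, h4, h5⟩ := (hΦ _ hm).exists_regular (fun j => hK j _ hm) (kp + km)
      refine (integral_abs_Theta_sub_le hN (hΦ _ hm).indep h1 h2 h3 hT hκ.1 h5 hM0 hM
        (hgi (n + i))).trans ?_
      have hnn : 0 ≤ ∫ ω, min 1 ‖approxChi α ρ T κ (n + i + 1) (N ω)
          - approxChi α ρ T κ (n + i) (N ω)‖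
          * noiseGauge (n + i + 1) (N ω) ^ (0 + 2 * km + 2 * kp) ∂P := by
        refine integral_nonneg_of_ae ?_
        filter_upwards [hN.ae_mem_noiseDomain (n + i + 1)] with ω hω
        exact mul_nonneg (le_min zero_le_one (norm_nonneg _))
          (pow_nonneg (zero_le_one.trans (one_le_gauge hω)) _)
      refine (mul_le_mul_of_nonneg_left h4
        (mul_nonneg (mul_nonneg hM0 (fullConst_nonneg α kp km)) hnn)).trans_eq ?_
      simp only [Function.comp_apply]
      ring
  · exact hof hs
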